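/- Let $d\ge 1$ be an integer. For $\beta>0$ and a finite set $A\subset\mathbb Z^d$ put $$\mathrm{Cap}_\beta(A)=\Big(\inf_\mu\sum_{x,y\in A}\mu(x)\mu(y)(|x-y|\vee 1)^{-\beta}\Big)^{-1},$$ and for a compact set $\Lambda\subset\mathbb R^d$ put $$\mathrm{Cap}_\beta(\Lambda)=\Big(\inf_\mu\int_\Lambda\int_\Lambda|x-y|^{-\beta}\,\mu(\mathrm dx)\,\mu(\mathrm dy)\Big)^{-1},$$ where the infima are over all probability measures $\mu$ on $A$, respectively on $\Lambda$, $|\cdot|$ is the Euclidean norm, $|x-y|^{-\beta}=\infty$ for $x=y$, $\infty^{-1}=0$, and the empty set has capacity $0$. For $p\in[0,1]$ fractal percolation is defined as follows. Start with $Z_0=\{[-\frac12,\frac12)^d\}$. Given $Z_k$, divide each cube in $Z_k$ into its $2^d$ dyadic subcubes congruent to $[0,2^{-k-1})^d$ and keep each of them independently with probability $p$; $Z_{k+1}$ is the collection of the kept cubes. Let $$Q_d(p;k)=\Big(\bigcup_{Q\in Z_k}2^kQ\Big)\cap\mathbb Z^d,\qquad Q_d(p)=\bigcap_{n\ge1}\bigcup_{Q\in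 Z_n}\overline Q .$$ Let $0<a<b<d$ be real numbers. There are constants $c,C>0$ depending only on $d,a,b$ such that the following hold, where $+$ denotes the Minkowski sum. (i) For every nonempty finite set $A\subset\mathbb Z^d$ and every integer $m\ge1$, $$c\,2^{(a-b)(m\vee\log_2\mathrm{diam}(A))}\le\frac{\mathrm{Cap}_a(A)}{\mathbb E[\mathrm{Cap}_b(A+Q_d(2^{b-a-d};m))]}\le C\,2^{(a-b)m},$$ where $\mathrm{diam}(A)$ is the Euclidean diameter and $m\vee\log_2\mathrm{diam}(A)=m$ if $\mathrm{diam}(A)=0$. (ii) For every nonempty closed set $\Lambda\subset[0,1]^d$, $$c\,\mathbb E[\mathrm{Cap}_b(\Lambda+Q_d(2^{b-a-d}))]\le\mathrm{Cap}_a(\Lambda)\le C\,\mathbb E[\mathrm{Cap}_b(\Lambda+Q_d(2^{b-a-d}))].$$ -/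

import Mathlib

open MeasureTheory ProbabilityTheory
open scoped ENNReal Pointwise unitInterval

noncomputable section

namespace FractalPercolation

/-- The inclusion of the lattice `ℤ^d` in Euclidean space `ℝ^d`. -/
def latticePoint {d : ℕ} (x : Fin d → ℤ) : EuclideanSpace ℝ (Fin d) :=
  WithLp.toLp 2 fun i => (x i : ℝ)

/-- The Euclidean diameter of a set of lattice points. -/
def latticeDiam {d : ℕ} (A : Set (Fin d → ℤ)) : ℝ :=
  Metric.diam (latticePoint '' A)

/-- Discrete Newtonian capacity with parameter `β` of a set `A` of lattice points: the inverse of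
the infimum of `∑ x, ∑ y, μ x * μ y * (|x - y| ∨ 1) ^ (-β)` over the probability measures `μ`
on `A`. The infimum over the empty family is `∞`, so the empty set has capacity `0`. -/
def latticeCap {d : ℕ} (β : ℝ) (A : Set (Fin d → ℤ)) : ℝ≥0∞ :=
  (⨅ (μ : PMF (Fin d → ℤ)) (_ : μ.support ⊆ A),
    ∑' x, ∑' y, μ x * μ y * max (edist (latticePoint x) (latticePoint y)) 1 ^ (-β))⁻¹

/-- Newtonian capacity with parameter `β` of a (compact) set `K` in `ℝ^d`: the inverse of the
infimum of `∫∫ |x - y| ^ (-β) μ(dx) μ(dy)` over the Borel probability measures `μ` on `K`.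
For `β > 0` the kernel is `∞` on the diagonal. -/
def newtonCap {d : ℕ} (β : ℝ) (K : Set (EuclideanSpace ℝ (Fin d))) : ℝ≥0∞ :=
  (⨅ (μ : ProbabilityMeasure (EuclideanSpace ℝ (Fin d)))
      (_ : (μ : Measure (EuclideanSpace ℝ (Fin d))) Kᶜ = 0),
    ∫⁻ x, ∫⁻ y, edist x y ^ (-β)
      ∂(μ : Measure (EuclideanSpace ℝ (Fin d))) ∂(μ : Measure (EuclideanSpace ℝ (Fin d))))⁻¹

/-- The dyadic cube of level `k` with index `z`: the translate of `[0, 2^{-k})^d` with lowest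
corner `-(1/2, …, 1/2) + 2^{-k} z`. The cubes with `z ∈ {0, …, 2^k - 1}^d` tile
`[-1/2, 1/2)^d`, and the cube `(k + 1, z)` lies in the cube `(k, ⌊z / 2⌋)`. -/
def cube {d : ℕ} (k : ℕ) (z : Fin d → ℕ) : Set (EuclideanSpace ℝ (Fin d)) :=
  {x | ∀ i, -(1 / 2) + (z i : ℝ) / 2 ^ k ≤ x i ∧ x i < -(1 / 2) + ((z i : ℝ) + 1) / 2 ^ k}

/-- The configurations of the percolation: the set of those (level, index) pairs whose cube is
kept at the moment at which it is examined. -/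
abbrev Config (d : ℕ) : Type := Set (ℕ × (Fin d → ℕ))

/-- The law of the percolation: every cube is kept independently with probability `p`. -/
def percLaw (d : ℕ) (p : I) : Measure (Config d) :=
  setBernoulli Set.univ p

/-- `Z_k`, the indices of the cubes of level `k` that remain after `k` steps. It starts with the
single cube `[-1/2, 1/2)^d`; a cube of level `k + 1` remains if its parent remains and it is
itself kept. -/
def remaining {d : ℕ} (ω : Config d) : ℕ → Set (Fin d → ℕ)
  | 0 => {0}
  | k + 1 => {z | (fun i => z i / 2) ∈ remaining ω k ∧ (k + 1, z) ∈ ω}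

/-- Discrete fractal percolation `Q_d(p; k)`: the lattice points in `⋃_{Q ∈ Z_k} 2^k Q`. -/
def discretePerc {d : ℕ} (k : ℕ) (ω : Config d) : Set (Fin d → ℤ) :=
  {x | latticePoint x ∈ ⋃ z ∈ remaining ω k, (2 ^ k : ℝ) • cube k z}

/-- Continuous fractal percolation `Q_d(p)`: the intersection over `n ≥ 1` of the unions of the
closures of the cubes in `Z_n`. -/
def continuousPerc {d : ℕ} (ω : Config d) : Set (EuclideanSpace ℝ (Fin d)) :=
  ⋂ n : ℕ, ⋂ _ : 1 ≤ n, ⋃ z ∈ remaining ω n, closure (cube n z)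

/-- The number `2^{b-a-d}` lies in `[0, 1]` when `b - a ≤ d`. -/
theorem two_rpow_mem {a b : ℝ} {d : ℕ} (ha : 0 < a) (hbd : b < d) :
    (2 : ℝ) ^ (b - a - d) ∈ I :=
  ⟨by positivity, Real.rpow_le_one_of_one_le_of_nonpos (by norm_num) (by linarith)⟩

end FractalPercolation

end

/-! Write p = 2^(b-a-d). Given that a leaf q of the cube tree is kept, a leaf q' that branches off n
generations above it is kept with probability p^n. A cube of side 2^i holds 2^(id) leaves, and p^i
2^(id) = 2^(i(b-a)). Summing over scales, the conditional expectation of the b-potential at x + q of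
the random set x' + Q is comparable to `percKern a b m x x'` (`sum_path_kern_le`,
`le_sum_path_kern`). The core of the proof is that the expected b-capacity of A + Q is comparable to
M R, where M = 2^(m(b-a)) is the expected number of kept leaves and R is the capacity of A for
`percKern`.

The bound from below (`rcap_percKern_le`) is a second moment argument: give each pair of a point x
and a kept leaf the mass ρ x, with ρ the equilibrium measure of A for `percKern`, and compare
expected mass and expected energy.

The bound from above (`bernE_rcap_le`) tests these weights against the random equilibrium measure e
of A + Q, scaled so that its mass and its energy both equal the capacity. Leaves are explored in
depth-first order. If e charges a pair, its leaf is kept, and every already explored ancestor of a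
later leaf is an ancestor of the current one; hence the conditional expectation of the later weight
is explicit. The value of e at each pair is replaced by its conditional expectation given the
exploration so far, which costs a factor 4 in energy (`bernE_pairing_adapt_le`). Cauchy-Schwarz for
a positive semidefinite kernel comparable to the Riesz kernel (`boxKern`) then applies, and the
reversed order treats the earlier leaves. Since the `percKern` potential of ρ is at least 1/R on A,
the outcome is (1/R) X ≲ sqrt(X M/R) for the expected capacity X, that is X ≲ M R.

Part (i) follows by comparing `percKern` with the a-kernel: it is always bounded by a constant times
that kernel, and on sets of diameter at most D ≥ 2^m the reverse holds up to a factor (D/2^m)^(b-a).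
For part (ii), Λ is rounded to the lattice at scale 2^(-m), where the diameter is at most 2^m in the
sup distance and the two bounds match. All powers of 2^m cancel, and m tends to infinity by weak
compactness of measures (`iInf_truncCap_le`) together with monotone convergence in the
configuration. -/

namespace FractalPercolation

/-! ### Finitely many Bernoulli coordinates, conditional expectation and adapted projection -/

section FiniteBernoulli

open Finset
open scoped Classical

variable {ι α : Type*}

/-- `f` is a function of the coordinates in `S`. -/
def OnlyOn (S : Set ι) (f : Finset ι → ℝ) : Prop :=
  ∀ T T', (∀ c ∈ S, c ∈ T ↔ c ∈ T') → f T = f T'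

theorem OnlyOn.mono {S S' : Set ι} {f : Finset ι → ℝ} (h : OnlyOn S f) (hS : S ⊆ S') :
    OnlyOn S' f := fun T T' hT => h T T' fun c hc => hT c (hS hc)

variable [DecidableEq ι]

/-- The Bernoulli weight of the configuration `T` on the finite index set `F`. -/
noncomputable def bernWt (F : Finset ι) (p : ℝ) (T : Finset ι) : ℝ :=
  ∏ c ∈ F, if c ∈ T then p else 1 - p

/-- Expectation over independent Bernoulli choices on a finite index set. -/
noncomputable def bernE (F : Finset ι) (p : ℝ) (f : Finset ι → ℝ) : ℝ :=
  ∑ T ∈ F.powerset, bernWt F p T * f T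

/-- The configuration that agrees with `T` on `S` and with `T'` off `S`. -/
noncomputable def mix (S : Set ι) (T T' : Finset ι) : Finset ι :=
  T.filter (· ∈ S) ∪ T'.filter (· ∉ S)

/-- Conditional expectation given the coordinates in `S`. -/
noncomputable def bernCond (F : Finset ι) (p : ℝ) (S : Set ι) (f : Finset ι → ℝ)
    (T : Finset ι) : ℝ :=
  bernE F p fun T' => f (mix S T T')

theorem mem_mix {S : Set ι} {T T' : Finset ι} {c : ι} :
    c ∈ mix S T T' ↔ (c ∈ S ∧ c ∈ T) ∨ (c ∉ S ∧ c ∈ T') := by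
  simp only [mix, mem_union, mem_filter]; tauto

theorem OnlyOn.mix {S : Set ι} {f : Finset ι → ℝ} (h : OnlyOn S f) (T T' : Finset ι) :
    f (mix S T T') = f T :=
  h _ _ fun c hc => by simp [mem_mix, hc]

theorem onlyOn_bernCond (F : Finset ι) (p : ℝ) (S : Set ι) (f : Finset ι → ℝ) :
    OnlyOn S (bernCond F p S f) := by
  intro T T' h
  unfold bernCond
  congr 1
  funext T''
  congr 1
  ext c
  simp only [mem_mix]
  by_cases hc : c ∈ S <;> simp [hc, h]

variable {F : Finset ι} {p : ℝ}

theorem bernWt_nonneg (hp0 : 0 ≤ p) (hp1 : p ≤ 1) (T : Finset ι) : 0 ≤ bernWt F p T :=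
  prod_nonneg fun c _ => by split_ifs <;> linarith

theorem bernE_mono (hp0 : 0 ≤ p) (hp1 : p ≤ 1) {f g : Finset ι → ℝ}
    (h : ∀ T ⊆ F, f T ≤ g T) : bernE F p f ≤ bernE F p g :=
  sum_le_sum fun T hT =>
    mul_le_mul_of_nonneg_left (h T (mem_powerset.1 hT)) (bernWt_nonneg hp0 hp1 T)

theorem bernE_nonneg (hp0 : 0 ≤ p) (hp1 : p ≤ 1) {f : Finset ι → ℝ}
    (h : ∀ T ⊆ F, 0 ≤ f T) : 0 ≤ bernE F p f :=
  sum_nonneg fun T hT => mul_nonneg (bernWt_nonneg hp0 hp1 T) (h T (mem_powerset.1 hT))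

theorem bernE_congr {f g : Finset ι → ℝ} (h : ∀ T ⊆ F, f T = g T) : bernE F p f = bernE F p g :=
  sum_congr rfl fun T hT => by rw [h T (mem_powerset.1 hT)]

theorem bernE_add (f g : Finset ι → ℝ) :
    bernE F p (fun T => f T + g T) = bernE F p f + bernE F p g := by
  simp [bernE, mul_add, sum_add_distrib]

theorem bernE_const_mul (c : ℝ) (f : Finset ι → ℝ) :
    bernE F p (fun T => c * f T) = c * bernE F p f := by
  simp only [bernE, mul_sum]; exact sum_congr rfl fun _ _ => by ring

theorem bernE_sum (J : Finset α) (f : α → Finset ι → ℝ) :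
    bernE F p (fun T => ∑ i ∈ J, f i T) = ∑ i ∈ J, bernE F p (f i) := by
  simp only [bernE, mul_sum]; exact sum_comm

theorem bernE_subset {G : Finset ι} (hG : G ⊆ F) :
    bernE F p (fun T => if G ⊆ T then 1 else 0) = p ^ #G := by
  have h1 : ∀ T ∈ F.powerset, bernWt F p T * (if G ⊆ T then (1 : ℝ) else 0) =
      (∏ _c ∈ T, p) * ∏ c ∈ F \ T, (if c ∈ G then 0 else 1 - p) := by
    intro T hT
    have hTF := mem_powerset.1 hT
    have h2 : bernWt F p T = (∏ _c ∈ T, p) * ∏ _c ∈ F \ T, (1 - p) := by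
      unfold bernWt
      rw [← prod_sdiff hTF, mul_comm]
      congr 1
      · exact prod_congr rfl fun c hc => by simp [hc]
      · exact prod_congr rfl fun c hc => by simp [(mem_sdiff.1 hc).2]
    rw [h2]
    split_ifs with hGT
    · rw [mul_one]
      congr 1
      exact prod_congr rfl fun c hc => by
        have : c ∉ G := fun h => (mem_sdiff.1 hc).2 (hGT h)
        simp [this]
    · obtain ⟨c, hc, hcT⟩ := not_subset.1 hGT
      rw [mul_zero, prod_eq_zero (i := c) (mem_sdiff.2 ⟨hG hc, hcT⟩) (by simp [hc]), mul_zero]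
  unfold bernE
  rw [sum_congr rfl h1, ← prod_add]
  rw [← prod_sdiff hG, prod_congr rfl (g := fun _ => (1 : ℝ)) fun c hc => by
      simp [(mem_sdiff.1 hc).2], prod_congr (s₁ := G) rfl (g := fun _ => p) fun c hc => by simp [hc]]
  simp

theorem bernE_const (c : ℝ) : bernE F p (fun _ => c) = c := by
  have := bernE_subset (F := F) (p := p) (empty_subset F)
  simp only [empty_subset, if_true, card_empty, pow_zero] at this
  simpa [this] using bernE_const_mul (F := F) (p := p) c (fun _ => 1)

theorem bernWt_mix_mul (S : Set ι) (T T' : Finset ι) :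
    bernWt F p (mix S T T') * bernWt F p (mix S T' T) = bernWt F p T * bernWt F p T' := by
  unfold bernWt
  rw [← prod_mul_distrib, ← prod_mul_distrib]
  refine prod_congr rfl fun c _ => ?_
  by_cases hc : c ∈ S
  · simp [mem_mix, hc]
  · simp [mem_mix, hc, mul_comm]

/-- Exchanging the coordinates off S between two independent configurations is an involution that
preserves the product weight, so `mix S T T'` has the law of T. The factor h does not see the
exchange. -/
theorem bernE_bernCond_mul {S : Set ι} {h : Finset ι → ℝ} (hh : OnlyOn S h) (f : Finset ι → ℝ) :
    bernE F p (fun T => bernCond F p S f T * h T) = bernE F p (fun T => f T * h T) := by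
  have e1 : bernE F p (fun T => bernCond F p S f T * h T) =
      ∑ x ∈ F.powerset ×ˢ F.powerset, bernWt F p (mix S x.1 x.2) * bernWt F p (mix S x.2 x.1) *
        (f (mix S x.1 x.2) * h (mix S x.1 x.2)) := by
    rw [sum_product]
    unfold bernE bernCond bernE
    refine sum_congr rfl fun T _ => ?_
    beta_reduce
    rw [sum_mul, mul_sum]
    refine sum_congr rfl fun T' _ => ?_
    rw [bernWt_mix_mul, hh.mix]; ring
  have e2 : ∑ x ∈ F.powerset ×ˢ F.powerset, bernWt F p (mix S x.1 x.2) *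
      bernWt F p (mix S x.2 x.1) * (f (mix S x.1 x.2) * h (mix S x.1 x.2)) =
      ∑ x ∈ F.powerset ×ˢ F.powerset, bernWt F p x.1 * bernWt F p x.2 * (f x.1 * h x.1) := by
    have hm : ∀ T ∈ F.powerset, ∀ T' ∈ F.powerset, mix S T T' ∈ F.powerset := by
      intro T hT T' hT'
      rw [mem_powerset] at *
      intro c hc
      rcases mem_mix.1 hc with h | h
      · exact hT h.2
      · exact hT' h.2
    have hmm : ∀ T T' : Finset ι, mix S (mix S T T') (mix S T' T) = T := by
      intro T T'
      ext c
      simp only [mem_mix]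
      tauto
    refine sum_nbij' (fun x => (mix S x.1 x.2, mix S x.2 x.1))
      (fun x => (mix S x.1 x.2, mix S x.2 x.1)) ?_ ?_ ?_ ?_ ?_
    · rintro ⟨T, T'⟩ hx
      rw [mem_product] at hx ⊢
      exact ⟨hm _ hx.1 _ hx.2, hm _ hx.2 _ hx.1⟩
    · rintro ⟨T, T'⟩ hx
      rw [mem_product] at hx ⊢
      exact ⟨hm _ hx.1 _ hx.2, hm _ hx.2 _ hx.1⟩
    · rintro ⟨T, T'⟩ _; simp [hmm]
    · rintro ⟨T, T'⟩ _; simp [hmm]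
    · rintro ⟨T, T'⟩ _; rfl
  rw [e1, e2, sum_product]
  unfold bernE
  refine sum_congr rfl fun T _ => ?_
  have := bernE_const (F := F) (p := p) (f T * h T)
  unfold bernE at this
  beta_reduce at this ⊢
  rw [← this, mul_sum]
  exact sum_congr rfl fun _ _ => by ring

theorem bernE_bernCond_mul_comm (S : Set ι) (f g : Finset ι → ℝ) :
    bernE F p (fun T => bernCond F p S f T * g T) =
      bernE F p (fun T => f T * bernCond F p S g T) := by
  rw [← bernE_bernCond_mul (onlyOn_bernCond F p S g) f]
  have := bernE_bernCond_mul (F := F) (p := p) (onlyOn_bernCond F p S f) g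
  simp only [mul_comm] at this ⊢
  exact this.symm

theorem bernCond_nonneg (hp0 : 0 ≤ p) (hp1 : p ≤ 1) {S : Set ι} {f : Finset ι → ℝ}
    (h : ∀ T, 0 ≤ f T) (T : Finset ι) : 0 ≤ bernCond F p S f T :=
  bernE_nonneg hp0 hp1 fun _ _ => h _

/-- The part of G seen by S is already known to be present, since it lies in H ⊆ T; only G \ H can
still fail, and its coordinates are resampled. -/
theorem pow_le_bernCond_subset (hp0 : 0 ≤ p) (hp1 : p ≤ 1) {S : Set ι} {G H T : Finset ι}
    (hG : G ⊆ F) (hHT : H ⊆ T) (hHS : ∀ c ∈ H, c ∈ S) (hGH : ∀ c ∈ G, c ∈ S → c ∈ H) :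
    p ^ #(G \ H) ≤ bernCond F p S (fun T => if G ⊆ T then 1 else 0) T := by
  calc p ^ #(G \ H) = bernE F p (fun T' => if G \ H ⊆ T' then 1 else 0) :=
        (bernE_subset (sdiff_subset.trans hG)).symm
    _ ≤ _ := by
        refine bernE_mono hp0 hp1 fun T' _ => ?_
        beta_reduce
        split_ifs with h1 h2 h2
        · exact le_rfl
        · refine absurd (fun c hc => mem_mix.2 ?_) h2
          by_cases hcS : c ∈ S
          · exact Or.inl ⟨hcS, hHT (hGH c hc hcS)⟩
          · exact Or.inr ⟨hcS, h1 (mem_sdiff.2 ⟨hc, fun h => hcS (hHS c h)⟩)⟩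
        · exact zero_le_one
        · exact le_rfl

/-- The bilinear form of a kernel on a finite set. -/
noncomputable def pairing (J : Finset α) (κ : α → α → ℝ) (f g : α → ℝ) : ℝ :=
  ∑ i ∈ J, ∑ j ∈ J, κ i j * (f i * g j)

theorem pairing_comm {J : Finset α} {κ : α → α → ℝ} (hs : ∀ i j, κ i j = κ j i) (f g : α → ℝ) :
    pairing J κ f g = pairing J κ g f := by
  unfold pairing
  rw [sum_comm]
  exact sum_congr rfl fun i _ => sum_congr rfl fun j _ => by rw [hs]; ring

/-- Cauchy-Schwarz with a free parameter, in additive form so that expectations can be taken: expand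
the form at s f - g and divide by s. -/
theorem two_mul_pairing_le {J : Finset α} {κ : α → α → ℝ} (hs : ∀ i j, κ i j = κ j i)
    (hpsd : ∀ f : α → ℝ, 0 ≤ pairing J κ f f) (f g : α → ℝ) {s : ℝ} (h0 : 0 < s) :
    2 * pairing J κ f g ≤ s * pairing J κ f f + s⁻¹ * pairing J κ g g := by
  have h := hpsd fun i => s * f i - g i
  have e : pairing J κ (fun i => s * f i - g i) (fun i => s * f i - g i) =
      s ^ 2 * pairing J κ f f - s * pairing J κ f g - s * pairing J κ g f + pairing J κ g g := by
    unfold pairing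
    simp only [mul_sum, ← sum_sub_distrib, ← sum_add_distrib]
    exact sum_congr rfl fun i _ => sum_congr rfl fun j _ => by ring
  rw [e, pairing_comm hs g f] at h
  have h2 := mul_nonneg (inv_nonneg.2 h0.le) h
  have h3 : s⁻¹ * (s ^ 2 * pairing J κ f f - s * pairing J κ f g - s * pairing J κ f g +
      pairing J κ g g) = s * pairing J κ f f + s⁻¹ * pairing J κ g g - 2 * pairing J κ f g := by
    field_simp
    ring
  linarith

/-- Expected pairing. -/
theorem bernE_pairing (J : Finset α) (κ : α → α → ℝ) (f g : Finset ι → α → ℝ) :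
    bernE F p (fun T => pairing J κ (f T) (g T)) =
      ∑ i ∈ J, ∑ j ∈ J, κ i j * bernE F p (fun T => f T i * g T j) := by
  unfold pairing
  rw [bernE_sum]
  refine sum_congr rfl fun i _ => ?_
  rw [bernE_sum]
  exact sum_congr rfl fun j _ => bernE_const_mul _ _

section Projection

variable {J : Finset α} {κ : α → α → ℝ} {t : α → ℤ} {S : α → Set ι} {e z : Finset ι → α → ℝ}

/-- The adapted projection of a process along an increasing family of coordinate sets. -/
noncomputable def adapt (F : Finset ι) (p : ℝ) (S : α → Set ι) (e : Finset ι → α → ℝ)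
    (T : Finset ι) (i : α) : ℝ :=
  bernCond F p (S i) (fun T => e T i) T

/-- Let η be the projection of e. For t i ≤ t j the variable η i is a function of S j, so E[η i η j]
= E[η i e j]. Summing over both orders gives E⟨η, η⟩ ≤ 2 E⟨η, e⟩ ≤ E⟨η, η⟩ / 2 + 2 E⟨e, e⟩, and the
first term is absorbed on the left. -/
theorem bernE_pairing_adapt_le (hp0 : 0 ≤ p) (hp1 : p ≤ 1) (hκ : ∀ i j, 0 ≤ κ i j)
    (hs : ∀ i j, κ i j = κ j i) (hpsd : ∀ f : α → ℝ, 0 ≤ pairing J κ f f)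
    (hS : ∀ i j, t i ≤ t j → S i ⊆ S j) (he : ∀ T i, 0 ≤ e T i) :
    bernE F p (fun T => pairing J κ (adapt F p S e T) (adapt F p S e T)) ≤
      4 * bernE F p (fun T => pairing J κ (e T) (e T)) := by
  have hη : ∀ T i, 0 ≤ adapt F p S e T i := fun T i => bernCond_nonneg hp0 hp1 (fun T => he T i) T
  have key : ∀ i j, bernE F p (fun T => adapt F p S e T i * adapt F p S e T j) ≤
      bernE F p (fun T => adapt F p S e T i * e T j) +
        bernE F p (fun T => e T i * adapt F p S e T j) := by
    have half : ∀ i j, t i ≤ t j → bernE F p (fun T => adapt F p S e T j * adapt F p S e T i) =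
        bernE F p (fun T => e T j * adapt F p S e T i) := fun i j hij =>
      bernE_bernCond_mul ((onlyOn_bernCond F p (S i) fun T => e T i).mono (hS i j hij)) _
    intro i j
    rcases le_total (t i) (t j) with h | h
    · have := half i j h
      simp only [mul_comm] at this ⊢
      rw [this]
      exact le_add_of_nonneg_right (bernE_nonneg hp0 hp1 fun T _ => mul_nonneg (he _ _) (hη _ _))
    · rw [half j i h]
      exact le_add_of_nonneg_left (bernE_nonneg hp0 hp1 fun T _ => mul_nonneg (hη _ _) (he _ _))
  set a := bernE F p (fun T => pairing J κ (adapt F p S e T) (adapt F p S e T))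
  set c := bernE F p (fun T => pairing J κ (e T) (e T))
  set m := bernE F p (fun T => pairing J κ (adapt F p S e T) (e T)) with hm
  have h1 : a ≤ 2 * m := by
    have e2 : m = bernE F p (fun T => pairing J κ (e T) (adapt F p S e T)) :=
      bernE_congr fun T _ => pairing_comm hs _ _
    have : a ≤ m + bernE F p (fun T => pairing J κ (e T) (adapt F p S e T)) := by
      simp only [a, hm, bernE_pairing, ← sum_add_distrib]
      refine sum_le_sum fun i _ => sum_le_sum fun j _ => ?_
      rw [← mul_add]
      exact mul_le_mul_of_nonneg_left (key i j) (hκ i j)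
    linarith
  have h2 : 2 * m ≤ 2⁻¹ * a + 2 * c := by
    simp only [a, c, hm, ← bernE_const_mul, ← bernE_add]
    refine bernE_mono hp0 hp1 fun T _ => ?_
    have := two_mul_pairing_le hs hpsd (adapt F p S e T) (e T) (s := 2⁻¹) (by norm_num)
    simpa using this
  linarith

/-- Conditional expectation is self-adjoint, so E[η i z j] = E[e i E(z j | S i)], and the last
factor is at least r i j wherever e i is nonzero. The pairing of η with z is then split by
Cauchy-Schwarz and the energy of η is bounded by four times that of e. -/
theorem sum_le_of_adapted (hp0 : 0 ≤ p) (hp1 : p ≤ 1) (hκ : ∀ i j, 0 ≤ κ i j)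
    (hs : ∀ i j, κ i j = κ j i) (hpsd : ∀ f : α → ℝ, 0 ≤ pairing J κ f f)
    (hS : ∀ i j, t i ≤ t j → S i ⊆ S j) (he : ∀ T i, 0 ≤ e T i) (hz : ∀ T i, 0 ≤ z T i)
    {r : α → α → ℝ}
    (hr : ∀ i ∈ J, ∀ j ∈ J, t i ≤ t j → ∀ T, e T i ≠ 0 →
      r i j ≤ bernCond F p (S i) (fun T => z T j) T) {s : ℝ} (h0 : 0 < s) :
    2 * ∑ i ∈ J, ∑ j ∈ J, (if t i ≤ t j then κ i j * r i j * bernE F p (fun T => e T i) else 0) ≤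
      s * (4 * bernE F p (fun T => pairing J κ (e T) (e T))) +
        s⁻¹ * bernE F p (fun T => pairing J κ (z T) (z T)) := by
  have hη : ∀ T i, 0 ≤ adapt F p S e T i := fun T i => bernCond_nonneg hp0 hp1 (fun T => he T i) T
  calc 2 * ∑ i ∈ J, ∑ j ∈ J,
        (if t i ≤ t j then κ i j * r i j * bernE F p (fun T => e T i) else 0)
      ≤ 2 * bernE F p (fun T => pairing J κ (adapt F p S e T) (z T)) := by
        rw [bernE_pairing]
        refine mul_le_mul_of_nonneg_left (sum_le_sum fun i hi => sum_le_sum fun j hj => ?_)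
          zero_le_two
        split_ifs with hij
        · rw [mul_assoc]
          refine mul_le_mul_of_nonneg_left ?_ (hκ i j)
          have := bernE_bernCond_mul_comm (F := F) (p := p) (S i) (fun T => e T i) (fun T => z T j)
          refine le_of_le_of_eq ?_ this.symm
          rw [← bernE_const_mul]
          refine bernE_mono hp0 hp1 fun T _ => ?_
          by_cases h : e T i = 0
          · simp [h]
          · rw [mul_comm]
            exact mul_le_mul_of_nonneg_left (hr i hi j hj hij T h) (he T i)
        · exact mul_nonneg (hκ i j)
            (bernE_nonneg hp0 hp1 fun T _ => mul_nonneg (hη _ _) (hz _ _))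
    _ ≤ s * bernE F p (fun T => pairing J κ (adapt F p S e T) (adapt F p S e T)) +
        s⁻¹ * bernE F p (fun T => pairing J κ (z T) (z T)) := by
        simp only [← bernE_const_mul, ← bernE_add]
        exact bernE_mono hp0 hp1 fun T _ => two_mul_pairing_le hs hpsd _ _ h0
    _ ≤ _ := by
        have := bernE_pairing_adapt_le (F := F) hp0 hp1 hκ hs hpsd hS he
        gcongr

end Projection

end FiniteBernoulli

end FractalPercolation

namespace FractalPercolation

/-! ### Equilibrium measures, a positive semidefinite Riesz kernel, and the percolation kernel -/

section Kernels

open Finset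

/-- A symmetric kernel on a finite set has an equilibrium measure. -/
theorem exists_equilibrium {α : Type*} {A : Finset α} (hA : A.Nonempty) {κ : α → α → ℝ}
    (hs : ∀ x y, κ x y = κ y x) :
    ∃ ρ : α → ℝ, (∀ x, 0 ≤ ρ x) ∧ (∀ x, x ∉ A → ρ x = 0) ∧ ∑ x ∈ A, ρ x = 1 ∧
      (∀ w : α → ℝ, (∀ x, 0 ≤ w x) → ∑ x ∈ A, w x = 1 → pairing A κ ρ ρ ≤ pairing A κ w w) ∧
      ∀ x ∈ A, pairing A κ ρ ρ ≤ ∑ y ∈ A, κ x y * ρ y := by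
  classical
  let ext : (A → ℝ) → α → ℝ := fun f x => if h : x ∈ A then f ⟨x, h⟩ else 0
  have hext : ∀ f (x : A), ext f x = f x := fun f x => by simp [ext]
  have hcont : ContinuousOn (fun f : A → ℝ => pairing A κ (ext f) (ext f)) (stdSimplex ℝ A) := by
    have : ∀ x, Continuous fun f : A → ℝ => ext f x := by
      intro x
      by_cases h : x ∈ A
      · simpa [ext, h] using continuous_apply (⟨x, h⟩ : A)
      · simpa [ext, h] using continuous_const
    unfold pairing
    fun_prop
  have hne : (stdSimplex ℝ A).Nonempty := by
    obtain ⟨x, hx⟩ := hA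
    exact ⟨_, single_mem_stdSimplex ℝ (⟨x, hx⟩ : A)⟩
  obtain ⟨f, hf, hmin⟩ := (isCompact_stdSimplex ℝ A).exists_isMinOn hne hcont
  have hρ0 : ∀ x, 0 ≤ ext f x := by
    intro x
    by_cases h : x ∈ A
    · simpa [ext, h] using hf.1 ⟨x, h⟩
    · simp [ext, h]
  have hρ1 : ∑ x ∈ A, ext f x = 1 := by
    rw [← sum_coe_sort, ← hf.2]
    exact sum_congr rfl fun x _ => hext f x
  have hmin' : ∀ w : α → ℝ, (∀ x, 0 ≤ w x) → ∑ x ∈ A, w x = 1 →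
      pairing A κ (ext f) (ext f) ≤ pairing A κ w w := by
    intro w hw0 hw1
    have hw : (fun x : A => w x) ∈ stdSimplex ℝ A :=
      ⟨fun x => hw0 x, (sum_coe_sort A w).trans hw1⟩
    have h := hmin hw
    refine h.trans (le_of_eq ?_)
    unfold pairing
    refine sum_congr rfl fun x hx => sum_congr rfl fun y hy => ?_
    simp [ext, hx, hy]
  refine ⟨ext f, hρ0, fun x hx => by simp [ext, hx], hρ1, hmin', fun x hx => ?_⟩
  -- First variation: moving mass t from the minimiser ρ to the point x cannot lower the energy,
  -- which forces the potential U at x to be at least W.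
  set ρ := ext f
  set W := pairing A κ ρ ρ with hI
  set U := ∑ y ∈ A, κ x y * ρ y with hU
  have hquad : ∀ t : ℝ, 0 ≤ t → t ≤ 1 → W ≤ (1 - t) ^ 2 * W + 2 * (t * (1 - t)) * U +
      t ^ 2 * κ x x := by
    intro t ht0 ht1
    have h := hmin' (fun y => (1 - t) * ρ y + t * (if y = x then 1 else 0)) (fun y => by
      have := hρ0 y
      have : 0 ≤ (1 - t) * ρ y := mul_nonneg (by linarith) this
      split_ifs <;> linarith) (by
      rw [sum_add_distrib, ← mul_sum, ← mul_sum, hρ1]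
      simp [hx])
    refine h.trans (le_of_eq ?_)
    have e : ∀ y z, κ y z * (((1 - t) * ρ y + t * (if y = x then 1 else 0)) *
        ((1 - t) * ρ z + t * (if z = x then 1 else 0))) =
        (1 - t) ^ 2 * (κ y z * (ρ y * ρ z)) +
          (if z = x then t * (1 - t) * (κ y z * ρ y) else 0) +
          (if y = x then t * (1 - t) * (κ y z * ρ z) else 0) +
          (if y = x then if z = x then t ^ 2 * κ y z else 0 else 0) := by
      intro y z
      split_ifs <;> ring
    unfold pairing
    simp only [e, sum_add_distrib]
    have e1 : ∑ y ∈ A, ∑ z ∈ A, (1 - t) ^ 2 * (κ y z * (ρ y * ρ z)) = (1 - t) ^ 2 * W := by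
      simp only [← mul_sum, hI, pairing]
    have e2 : ∑ y ∈ A, ∑ z ∈ A, (if z = x then t * (1 - t) * (κ y z * ρ y) else 0) =
        t * (1 - t) * U := by
      simp only [sum_ite_eq', hx, if_true, hU, ← mul_sum]
      congr 1
      exact sum_congr rfl fun y _ => by rw [hs]
    have e3 : ∑ y ∈ A, ∑ z ∈ A, (if y = x then t * (1 - t) * (κ y z * ρ z) else 0) =
        t * (1 - t) * U := by
      rw [sum_comm]
      simp only [sum_ite_eq', hx, if_true, hU, ← mul_sum]
    have e4 : ∑ y ∈ A, ∑ z ∈ A, (if y = x then if z = x then t ^ 2 * κ y z else 0 else 0) =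
        t ^ 2 * κ x x := by
      rw [sum_comm]
      simp [hx]
    rw [e1, e2, e3, e4]
    ring
  by_contra hlt
  push Not at hlt
  have hM : 0 < 1 + |W - 2 * U + κ x x| := by positivity
  have hδ : 0 < W - U := by linarith
  -- If U < W, `hquad` reads 2 (W - U) ≤ t (W - 2U + κ x x) after division by t; this t is small
  -- enough to make the right side at most W - U.
  set t := min 1 ((W - U) / (1 + |W - 2 * U + κ x x|)) with ht
  have ht0 : 0 < t := lt_min one_pos (div_pos hδ hM)
  have ht1 : t ≤ 1 := min_le_left _ _
  have ht2 : t * (1 + |W - 2 * U + κ x x|) ≤ W - U := by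
    rw [← le_div_iff₀ hM]; exact min_le_right _ _
  have h := hquad t ht0.le ht1
  have h2 : t * (2 * (W - U)) ≤ t * (t * (W - 2 * U + κ x x)) := by nlinarith
  have h3 := le_of_mul_le_mul_left h2 ht0
  have h4 : t * (W - 2 * U + κ x x) ≤ t * |W - 2 * U + κ x x| :=
    mul_le_mul_of_nonneg_left (le_abs_self _) ht0.le
  nlinarith

/-- The terms peak at the scale 2^i ≈ r and decay geometrically on both sides, so the bound depends
neither on r nor on the number of scales. -/
theorem sum_two_sided_geometric {s t : ℝ} (hs : 0 < s) (ht : 0 < t) :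
    ∃ C : ℝ, 0 < C ∧ ∀ r : ℝ, 1 ≤ r → ∀ N : ℕ,
      ∑ i ∈ range N, min (((2 : ℝ) ^ i / r) ^ s) (((2 : ℝ) ^ i / r) ^ (-t)) ≤ C := by
  set u : ℝ := 2 ^ (-s) with hu
  set v : ℝ := 2 ^ (-t) with hv
  have hu0 : 0 < u := by positivity
  have hv0 : 0 < v := by positivity
  have hu1 : u < 1 := Real.rpow_lt_one_of_one_lt_of_neg (by norm_num) (by linarith)
  have hv1 : v < 1 := Real.rpow_lt_one_of_one_lt_of_neg (by norm_num) (by linarith)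
  have hgeom : ∀ {x : ℝ}, 0 < x → x < 1 → ∀ N, ∑ i ∈ range N, x ^ i ≤ (1 - x)⁻¹ := by
    intro x hx0 hx1 N
    have := (summable_geometric_of_lt_one hx0.le hx1).sum_le_tsum (range N)
      (fun i _ => by positivity)
    rwa [tsum_geometric_of_lt_one hx0.le hx1] at this
  refine ⟨(1 - u)⁻¹ + (1 - v)⁻¹, by
    have := sub_pos.2 hu1; have := sub_pos.2 hv1; positivity, fun r hr N => ?_⟩
  obtain ⟨n, hn1, hn2⟩ := exists_nat_pow_near hr (one_lt_two : (1 : ℝ) < 2)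
  have hr0 : 0 < r := by linarith
  have hpow : ∀ (w : ℝ) (k : ℕ), ((2 : ℝ) ^ k) ^ (-w) = (2 ^ (-w)) ^ k := by
    intro w k
    rw [← Real.rpow_natCast, ← Real.rpow_natCast, ← Real.rpow_mul (by norm_num),
      ← Real.rpow_mul (by norm_num), mul_comm]
  have hlow : ∀ i ≤ n, min (((2 : ℝ) ^ i / r) ^ s) (((2 : ℝ) ^ i / r) ^ (-t)) ≤ u ^ (n - i) := by
    intro i hi
    refine (min_le_left _ _).trans ?_
    rw [hu, ← hpow, Real.rpow_neg (by positivity), ← Real.inv_rpow (by positivity)]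
    refine Real.rpow_le_rpow (by positivity) ?_ hs.le
    rw [div_le_iff₀ hr0]
    calc (2 : ℝ) ^ i = ((2 : ℝ) ^ (n - i))⁻¹ * 2 ^ n := by
          rw [eq_inv_mul_iff_mul_eq₀ (by positivity), ← pow_add]; congr 1; omega
      _ ≤ _ := by gcongr
  have hhigh : ∀ i, n < i → min (((2 : ℝ) ^ i / r) ^ s) (((2 : ℝ) ^ i / r) ^ (-t)) ≤
      v ^ (i - (n + 1)) := by
    intro i hi
    refine (min_le_right _ _).trans ?_
    rw [hv, ← hpow]
    refine Real.rpow_le_rpow_of_nonpos (by positivity) ?_ (by linarith)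
    rw [le_div_iff₀ hr0]
    calc (2 : ℝ) ^ (i - (n + 1)) * r ≤ (2 : ℝ) ^ (i - (n + 1)) * 2 ^ (n + 1) := by gcongr
      _ = 2 ^ i := by rw [← pow_add]; congr 1; omega
  have hnn : ∀ i : ℕ, 0 ≤ min (((2 : ℝ) ^ i / r) ^ s) (((2 : ℝ) ^ i / r) ^ (-t)) := fun i =>
    le_min (by positivity) (by positivity)
  calc _ ≤ ∑ i ∈ range (n + 1 + N),
        min (((2 : ℝ) ^ i / r) ^ s) (((2 : ℝ) ^ i / r) ^ (-t)) :=
        sum_le_sum_of_subset_of_nonneg (range_mono (by omega)) fun i _ _ => hnn i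
    _ ≤ ∑ i ∈ range (n + 1), u ^ i + ∑ i ∈ range N, v ^ i := by
        rw [sum_range_add]
        refine add_le_add ?_ (sum_le_sum fun i _ => ?_)
        · rw [← sum_range_reflect (fun i => u ^ i)]
          refine sum_le_sum fun i hi => ?_
          have := hlow i (by simpa [Nat.lt_succ_iff] using hi)
          simpa using this
        · simpa using hhigh (n + 1 + i) (by omega)
    _ ≤ _ := add_le_add (hgeom hu0 hu1 _) (hgeom hv0 hv1 _)

variable {d : ℕ}

/-- The Riesz kernel of the lattice for the sup distance, truncated at distance one. -/
noncomputable def kern (β : ℝ) (x y : Fin d → ℤ) : ℝ := max (dist x y) 1 ^ (-β)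

theorem kern_pos (β : ℝ) (x y : Fin d → ℤ) : 0 < kern β x y :=
  Real.rpow_pos_of_pos (lt_max_of_lt_right one_pos) _

theorem kern_comm (β : ℝ) (x y : Fin d → ℤ) : kern β x y = kern β y x := by
  rw [kern, kern, dist_comm]

/-- The indices of the overlapping dyadic boxes of scale `j` that contain `x`. -/
noncomputable def boxes (j : ℕ) (x : Fin d → ℤ) : Finset (Fin d → ℤ) :=
  Icc (fun i => x i / 2 ^ j - 1) (fun i => x i / 2 ^ j)

/-- A positive semidefinite kernel comparable to `kern β`. -/
noncomputable def boxKern (β : ℝ) (x y : Fin d → ℤ) : ℝ :=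
  ∑' j : ℕ, ((2 : ℝ) ^ (-β)) ^ j * #(boxes j x ∩ boxes j y)

theorem card_boxes (j : ℕ) (x : Fin d → ℤ) : #(boxes j x) = 2 ^ d := by
  simp [boxes, Pi.card_Icc]

theorem boxKern_summable {β : ℝ} (hβ : 0 < β) (x y : Fin d → ℤ) :
    Summable fun j : ℕ => ((2 : ℝ) ^ (-β)) ^ j * (#(boxes j x ∩ boxes j y) : ℝ) := by
  have h1 : (2 : ℝ) ^ (-β) < 1 := Real.rpow_lt_one_of_one_lt_of_neg (by norm_num) (by linarith)
  have h0 : 0 < (2 : ℝ) ^ (-β) := by positivity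
  refine Summable.of_nonneg_of_le (fun j => by positivity) (fun j => ?_)
    ((summable_geometric_of_lt_one h0.le h1).mul_right ((2 : ℝ) ^ d))
  refine mul_le_mul_of_nonneg_left ?_ (by positivity)
  have := card_le_card (inter_subset_left (s₁ := boxes j x) (s₂ := boxes j y))
  rw [card_boxes] at this
  exact_mod_cast this

theorem boxKern_comm (β : ℝ) (x y : Fin d → ℤ) : boxKern β x y = boxKern β y x := by
  simp only [boxKern, inter_comm]

theorem boxKern_nonneg (β : ℝ) (x y : Fin d → ℤ) : 0 ≤ boxKern β x y :=
  tsum_nonneg fun _ => by positivity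

/-- At each scale the number of common boxes is an inner product of indicator vectors, so the form
is a sum of squares over boxes, weighted by positive numbers. -/
theorem boxKern_posSemidef {α : Type*} {β : ℝ} (hβ : 0 < β) (J : Finset α)
    (u : α → Fin d → ℤ) (f : α → ℝ) :
    0 ≤ pairing J (fun i j => boxKern β (u i) (u j)) f f := by
  have hsum := boxKern_summable (d := d) hβ
  have e : pairing J (fun i j => boxKern β (u i) (u j)) f f =
      ∑' n : ℕ, ((2 : ℝ) ^ (-β)) ^ n *
        ∑ i ∈ J, ∑ j ∈ J, (#(boxes n (u i) ∩ boxes n (u j)) : ℝ) * (f i * f j) := by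
    unfold pairing boxKern
    simp only [← tsum_mul_right]
    have hs : ∀ i j, Summable fun n : ℕ => ((2 : ℝ) ^ (-β)) ^ n *
        (#(boxes n (u i) ∩ boxes n (u j)) : ℝ) * (f i * f j) := fun i j => (hsum _ _).mul_right _
    rw [sum_congr rfl fun i _ => (Summable.tsum_finsetSum fun j _ => hs i j).symm,
      (Summable.tsum_finsetSum fun i _ => summable_sum fun j _ => hs i j).symm]
    refine tsum_congr fun n => ?_
    simp only [mul_sum, mul_assoc]
  rw [e]
  refine tsum_nonneg fun n => mul_nonneg (by positivity) ?_
  have e2 : ∑ i ∈ J, ∑ j ∈ J, (#(boxes n (u i) ∩ boxes n (u j)) : ℝ) * (f i * f j) =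
      ∑ v ∈ J.biUnion fun i => boxes n (u i),
        (∑ i ∈ J, if v ∈ boxes n (u i) then f i else 0) ^ 2 := by
    simp only [sq, sum_mul_sum]
    rw [sum_comm]
    simp only [sum_comm (s := J.biUnion _)]
    rw [sum_comm]
    refine sum_congr rfl fun i hi => sum_congr rfl fun j _ => ?_
    have : ∀ v, (if v ∈ boxes n (u i) then f i else 0) * (if v ∈ boxes n (u j) then f j else 0) =
        if v ∈ boxes n (u i) ∩ boxes n (u j) then f i * f j else 0 := by
      intro v
      by_cases h1 : v ∈ boxes n (u i) <;> by_cases h2 : v ∈ boxes n (u j) <;> simp [h1, h2]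
    simp only [this]
    rw [← sum_filter, sum_const, nsmul_eq_mul]
    congr 3
    ext v
    simp only [mem_inter, mem_filter, mem_biUnion]
    constructor
    · intro h; exact ⟨⟨i, hi, h.1⟩, h⟩
    · intro h; exact h.2
  rw [e2]
  positivity

theorem two_pow_rpow (k : ℕ) (w : ℝ) : ((2 : ℝ) ^ k) ^ w = (2 ^ w) ^ k := by
  rw [← Real.rpow_natCast, ← Real.rpow_natCast, ← Real.rpow_mul (by norm_num),
    ← Real.rpow_mul (by norm_num), mul_comm]

/-- Boxes of side 2^(j+1) are placed at spacing 2^j, so points at distance at most 2^j always share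
one. A single scale, the first power of two above the distance, suffices. -/
theorem le_boxKern {β : ℝ} (hβ : 0 < β) (x y : Fin d → ℤ) :
    2 ^ (-β) * kern β x y ≤ boxKern β x y := by
  obtain ⟨n, hn1, hn2⟩ := exists_nat_pow_near (le_max_right (dist x y) 1)
    (one_lt_two : (1 : ℝ) < 2)
  have hint : 1 ≤ #(boxes (n + 1) x ∩ boxes (n + 1) y) := by
    rw [Nat.one_le_iff_ne_zero, ← pos_iff_ne_zero, card_pos]
    refine ⟨fun i => min (x i / 2 ^ (n + 1)) (y i / 2 ^ (n + 1)), ?_⟩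
    have hd : ∀ i, |x i - y i| ≤ 2 ^ (n + 1) := by
      intro i
      have h1 := (dist_le_pi_dist x y i).trans ((le_max_left _ _).trans hn2.le)
      rw [Int.dist_eq] at h1
      exact_mod_cast h1
    have hp : (0 : ℤ) < 2 ^ (n + 1) := by positivity
    have h2 : ∀ i, x i / 2 ^ (n + 1) - 1 ≤ y i / 2 ^ (n + 1) ∧
        y i / 2 ^ (n + 1) - 1 ≤ x i / 2 ^ (n + 1) := by
      intro i
      obtain ⟨h3, h4⟩ := abs_le.1 (hd i)
      constructor
      · rw [Int.le_ediv_iff_mul_le hp, sub_mul]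
        have := Int.ediv_mul_le (x i) hp.ne'
        linarith
      · rw [Int.le_ediv_iff_mul_le hp, sub_mul]
        have := Int.ediv_mul_le (y i) hp.ne'
        linarith
    simp only [boxes, mem_inter, mem_Icc, Pi.le_def]
    refine ⟨⟨fun i => ?_, fun i => ?_⟩, ⟨fun i => ?_, fun i => ?_⟩⟩ <;> have := h2 i <;> omega
  have hr : 0 < max (dist x y) 1 := lt_max_of_lt_right one_pos
  calc 2 ^ (-β) * kern β x y ≤ 2 ^ (-β) * ((2 : ℝ) ^ n) ^ (-β) := by
        unfold kern
        refine mul_le_mul_of_nonneg_left ?_ (by positivity)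
        exact Real.rpow_le_rpow_of_nonpos (by positivity) hn1 (by linarith)
    _ = ((2 : ℝ) ^ (-β)) ^ (n + 1) * 1 := by rw [two_pow_rpow, pow_succ]; ring
    _ ≤ ((2 : ℝ) ^ (-β)) ^ (n + 1) * #(boxes (n + 1) x ∩ boxes (n + 1) y) := by
        refine mul_le_mul_of_nonneg_left ?_ (by positivity)
        exact_mod_cast hint
    _ ≤ _ := (boxKern_summable hβ x y).le_tsum (n + 1) fun j _ => by positivity

/-- A shared box at scale j forces the distance to be at most 2^(j+1), so only scales from about
that of the distance upwards contribute, and these form a geometric tail. -/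
theorem boxKern_le {β : ℝ} (hβ : 0 < β) :
    ∃ C : ℝ, 0 < C ∧ ∀ x y : Fin d → ℤ, boxKern β x y ≤ C * kern β x y := by
  obtain ⟨C, hC, h⟩ := sum_two_sided_geometric (s := 1) (t := β) one_pos hβ
  refine ⟨2 ^ d * 2 ^ (β + 1) * C, by positivity, fun x y => ?_⟩
  refine Real.tsum_le_of_sum_range_le (fun _ => by positivity) fun N => ?_
  set r := max (dist x y) 1
  have hr1 : 1 ≤ r := le_max_right _ _
  have hr : 0 < r := by linarith
  have hk : 0 < kern β x y := kern_pos _ _ _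
  refine le_trans ?_ (mul_le_mul_of_nonneg_left (h r hr1 N)
    (by positivity : 0 ≤ 2 ^ d * 2 ^ (β + 1) * kern β x y) |>.trans_eq (by ring))
  rw [mul_sum]
  refine sum_le_sum fun j _ => ?_
  by_cases hj : (boxes j x ∩ boxes j y).Nonempty
  · obtain ⟨v, hv⟩ := hj
    simp only [boxes, mem_inter, mem_Icc, Pi.le_def] at hv
    have hd : r ≤ 2 ^ (j + 1) := by
      refine max_le ((dist_pi_le_iff (by positivity)).2 fun i => ?_) (one_le_pow₀ (by norm_num))
      rw [Int.dist_eq]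
      have hp : (0 : ℤ) < 2 ^ j := by positivity
      have h1 := hv.1.1 i
      have h2 := hv.1.2 i
      have h3 := hv.2.1 i
      have h4 := hv.2.2 i
      have h5 : |x i - y i| ≤ 2 ^ (j + 1) := by
        have a1 := Int.emod_add_mul_ediv (x i) (2 ^ j)
        have a2 := Int.emod_nonneg (x i) hp.ne'
        have a3 := Int.emod_lt_of_pos (x i) hp
        have b1 := Int.emod_add_mul_ediv (y i) (2 ^ j)
        have b2 := Int.emod_nonneg (y i) hp.ne'
        have b3 := Int.emod_lt_of_pos (y i) hp
        have c1 : (2 : ℤ) ^ j * (x i / 2 ^ j) ≤ 2 ^ j * (y i / 2 ^ j + 1) :=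
          mul_le_mul_of_nonneg_left (by omega) hp.le
        have c2 : (2 : ℤ) ^ j * (y i / 2 ^ j) ≤ 2 ^ j * (x i / 2 ^ j + 1) :=
          mul_le_mul_of_nonneg_left (by omega) hp.le
        rw [abs_le, pow_succ]
        constructor <;> linarith
      exact_mod_cast h5
    have hcard : (#(boxes j x ∩ boxes j y) : ℝ) ≤ 2 ^ d := by
      have := card_le_card (inter_subset_left (s₁ := boxes j x) (s₂ := boxes j y))
      rw [card_boxes] at this
      exact_mod_cast this
    set w := (2 : ℝ) ^ j / r with hw
    have hw0 : 0 < w := by positivity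
    have hw1 : 2⁻¹ ≤ w := by
      rw [hw, le_div_iff₀ hr]
      rw [pow_succ] at hd
      linarith
    have e : ((2 : ℝ) ^ (-β)) ^ j = kern β x y * w ^ (-β) := by
      rw [← two_pow_rpow, kern, ← Real.mul_rpow hr.le hw0.le, hw]
      congr 1
      field_simp
    -- Only w ≥ 1/2 occurs here, so the increasing branch w of the minimum costs no more than a
    -- constant; its exponent 1 is an arbitrary choice.
    have hmin : w ^ (-β) ≤ 2 ^ (β + 1) * min (w ^ (1 : ℝ)) (w ^ (-β)) := by
      have h2 : w ^ (-β) ≤ 2 ^ β := by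
        calc w ^ (-β) ≤ (2⁻¹ : ℝ) ^ (-β) :=
              Real.rpow_le_rpow_of_nonpos (by positivity) hw1 (by linarith)
          _ = 2 ^ β := by rw [Real.inv_rpow (by norm_num), Real.rpow_neg (by norm_num), inv_inv]
      rw [mul_min_of_nonneg _ _ (by positivity)]
      refine le_min (h2.trans ?_) ?_
      · rw [Real.rpow_one, Real.rpow_add (by norm_num), Real.rpow_one]
        have : (0 : ℝ) < 2 ^ β := by positivity
        nlinarith
      · have : (1 : ℝ) ≤ 2 ^ (β + 1) := Real.one_le_rpow (by norm_num) (by linarith)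
        exact le_mul_of_one_le_left (by positivity) this
    rw [e]
    calc kern β x y * w ^ (-β) * #(boxes j x ∩ boxes j y)
        ≤ kern β x y * (2 ^ (β + 1) * min (w ^ (1 : ℝ)) (w ^ (-β))) * 2 ^ d := by gcongr
      _ = _ := by ring
  · rw [not_nonempty_iff_eq_empty] at hj
    rw [hj]
    simp only [card_empty, Nat.cast_zero, mul_zero]
    have : 0 ≤ min (((2 : ℝ) ^ j / r) ^ (1 : ℝ)) (((2 : ℝ) ^ j / r) ^ (-β)) :=
      le_min (by positivity) (by positivity)
    positivity

theorem card_le_of_dist_le {B : Finset (Fin d → ℤ)} {x : Fin d → ℤ} {j : ℕ}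
    (h : ∀ y ∈ B, dist x y ≤ 2 ^ j) : (#B : ℝ) ≤ 4 ^ d * ((2 : ℝ) ^ j) ^ d := by
  have hsub : B ⊆ Icc (fun i => x i - 2 ^ j) (fun i => x i + 2 ^ j) := by
    intro y hy
    have hd : ∀ i, |x i - y i| ≤ 2 ^ j := by
      intro i
      have h1 := (dist_le_pi_dist x y i).trans (h y hy)
      rw [Int.dist_eq] at h1
      exact_mod_cast h1
    rw [mem_Icc]
    constructor <;> intro i <;> have := abs_le.1 (hd i) <;> simp only <;> linarith [this.1, this.2]
  have hc := card_le_card hsub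
  rw [Pi.card_Icc] at hc
  have h2 : ∀ i ∈ univ (α := Fin d), #(Icc (x i - 2 ^ j) (x i + 2 ^ j)) ≤ 4 * 2 ^ j := by
    intro i _
    rw [Int.card_Icc]
    have : (1 : ℤ) ≤ 2 ^ j := one_le_pow₀ (by norm_num)
    have e : x i + 2 ^ j + 1 - (x i - 2 ^ j) = 2 * 2 ^ j + 1 := by ring
    rw [e, Int.toNat_le]
    push_cast
    linarith
  have h3 := prod_le_prod' h2
  simp only [prod_const, card_univ, Fintype.card_fin] at h3
  rw [← mul_pow]
  exact_mod_cast hc.trans h3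

/-- Far from the ball the kernel is essentially constant on it. Near it, the contribution of
distances of order 2^j is at most of order 2^(j(d-b)), and since b < d the largest scale dominates.
-/
theorem sum_kern_le {b : ℝ} (hb : 0 < b) (hbd : b < d) :
    ∃ C : ℝ, 0 < C ∧ ∀ (i : ℕ) (B : Finset (Fin d → ℤ)) (x y₀ : Fin d → ℤ),
      (∀ y ∈ B, dist y₀ y ≤ 2 ^ i) →
        ∑ y ∈ B, kern b x y ≤ C * (((2 : ℝ) ^ i) ^ d * max (2 ^ i) (dist x y₀) ^ (-b)) := by
  obtain ⟨C, hC, h⟩ := sum_two_sided_geometric (s := d - b) (t := 1) (by linarith) one_pos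
  refine ⟨max (4 ^ d * 2 ^ b) (2 ^ b * (2 ^ b * 4 ^ d * (8 : ℝ) ^ (d - b) * C)), by positivity,
    fun i B x y₀ hB => ?_⟩
  have h2i : (1 : ℝ) ≤ 2 ^ i := one_le_pow₀ (by norm_num)
  have hM : 0 < max ((2 : ℝ) ^ i) (dist x y₀) := lt_max_of_lt_left (by positivity)
  rcases le_or_gt ((2 : ℝ) ^ (i + 1)) (dist x y₀) with hfar | hnear
  · have hmax : max ((2 : ℝ) ^ i) (dist x y₀) = dist x y₀ := by
      rw [pow_succ] at hfar
      exact max_eq_right (by linarith)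
    calc ∑ y ∈ B, kern b x y ≤ ∑ y ∈ B, 2 ^ b * max ((2 : ℝ) ^ i) (dist x y₀) ^ (-b) := by
          refine sum_le_sum fun y hy => ?_
          have h1 := hB y hy
          have h2 : dist x y₀ / 2 ≤ max (dist x y) 1 := by
            refine le_max_of_le_left ?_
            have := dist_triangle x y y₀
            rw [dist_comm y y₀] at this
            rw [pow_succ] at hfar
            linarith
          have hpos : 0 < dist x y₀ := by linarith [pow_pos (two_pos (α := ℝ)) (i + 1)]
          calc kern b x y ≤ (dist x y₀ / 2) ^ (-b) :=
                Real.rpow_le_rpow_of_nonpos (by positivity) h2 (by linarith)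
            _ = _ := by
                rw [hmax, Real.div_rpow hpos.le (by norm_num), Real.rpow_neg two_pos.le, div_inv_eq_mul,
                  mul_comm]
      _ = #B * (2 ^ b * max ((2 : ℝ) ^ i) (dist x y₀) ^ (-b)) := by rw [sum_const, nsmul_eq_mul]
      _ ≤ 4 ^ d * ((2 : ℝ) ^ i) ^ d * (2 ^ b * max ((2 : ℝ) ^ i) (dist x y₀) ^ (-b)) := by
          gcongr; exact card_le_of_dist_le hB
      _ = 4 ^ d * 2 ^ b * (((2 : ℝ) ^ i) ^ d * max (2 ^ i) (dist x y₀) ^ (-b)) := by ring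
      _ ≤ _ := by gcongr; exact le_max_left _ _
  · have hk : ∀ y ∈ B, kern b x y ≤ ∑ j ∈ range (i + 4),
        if dist x y ≤ 2 ^ j then 2 ^ b * ((2 : ℝ) ^ j) ^ (-b) else 0 := by
      intro y hy
      obtain ⟨n, hn1, hn2⟩ := exists_nat_pow_near (le_max_right (dist x y) 1)
        (one_lt_two : (1 : ℝ) < 2)
      have hd : max (dist x y) 1 < 2 ^ (i + 3) := by
        have := dist_triangle x y₀ y
        have := hB y hy
        rw [pow_succ] at hnear
        refine max_lt ?_ (one_lt_pow₀ (by norm_num) (by omega))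
        rw [pow_add]
        linarith
      have hn : n < i + 3 := (pow_lt_pow_iff_right₀ (one_lt_two (α := ℝ))).1 (hn1.trans_lt hd)
      have hmem : n + 1 ∈ range (i + 4) := by rw [mem_range]; omega
      refine le_trans ?_ (single_le_sum (f := fun j => if dist x y ≤ 2 ^ j then
        2 ^ b * ((2 : ℝ) ^ j) ^ (-b) else 0) (fun j _ => by split_ifs <;> positivity) hmem)
      simp only [(le_max_left _ _).trans hn2.le, if_true]
      calc kern b x y ≤ ((2 : ℝ) ^ n) ^ (-b) :=
            Real.rpow_le_rpow_of_nonpos (by positivity) hn1 (by linarith)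
        _ = _ := by
            rw [pow_succ, Real.mul_rpow (by positivity) (by norm_num), mul_left_comm,
              ← Real.rpow_add two_pos]
            simp
    have hterm : ∀ j, ∑ y ∈ B, (if dist x y ≤ 2 ^ j then 2 ^ b * ((2 : ℝ) ^ j) ^ (-b) else 0) ≤
        2 ^ b * 4 ^ d * ((2 : ℝ) ^ j) ^ (d - b) := by
      intro j
      rw [← sum_filter, sum_const, nsmul_eq_mul]
      have := card_le_of_dist_le (B := B.filter fun y => dist x y ≤ 2 ^ j) (x := x) (j := j)
        (fun y hy => (mem_filter.1 hy).2)
      calc _ ≤ 4 ^ d * ((2 : ℝ) ^ j) ^ d * (2 ^ b * ((2 : ℝ) ^ j) ^ (-b)) := by gcongr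
        _ = _ := by
          rw [sub_eq_add_neg, Real.rpow_add (by positivity), Real.rpow_natCast]; ring
    -- All scales are at most 2^(i+3), so with r = 2^(i+3) the minimum in `h` is always its
    -- increasing branch.
    have hgeo : ∑ j ∈ range (i + 4), ((2 : ℝ) ^ j) ^ (d - b) ≤
        C * ((2 : ℝ) ^ (i + 3)) ^ (d - b) := by
      have h1 := mul_le_mul_of_nonneg_right (h (2 ^ (i + 3)) (one_le_pow₀ (by norm_num)) (i + 4))
        (by positivity : 0 ≤ ((2 : ℝ) ^ (i + 3)) ^ (d - b))
      refine le_trans ?_ h1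
      rw [sum_mul]
      refine sum_le_sum fun j hj => ?_
      have hj' : (2 : ℝ) ^ j / 2 ^ (i + 3) ≤ 1 := by
        rw [div_le_one (by positivity)]
        exact pow_le_pow_right₀ (by norm_num) (by rw [mem_range] at hj; omega)
      have h0 : 0 < (2 : ℝ) ^ j / 2 ^ (i + 3) := by positivity
      rw [min_eq_left, ← Real.mul_rpow (by positivity) (by positivity)]
      · rw [div_mul_cancel₀ _ (by positivity)]
      · exact (Real.rpow_le_one h0.le hj' (by linarith)).trans
          (Real.one_le_rpow_of_pos_of_le_one_of_nonpos h0 hj' (by norm_num))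
    have hmax : ((2 : ℝ) ^ i) ^ (-b) ≤ 2 ^ b * max ((2 : ℝ) ^ i) (dist x y₀) ^ (-b) := by
      have h1 : max ((2 : ℝ) ^ i) (dist x y₀) ≤ 2 ^ i * 2 := by
        rw [pow_succ] at hnear
        exact max_le (by linarith) hnear.le
      have h2 := Real.rpow_le_rpow_of_nonpos hM h1 (z := -b) (by linarith)
      rw [Real.mul_rpow (by positivity) (by norm_num)] at h2
      calc ((2 : ℝ) ^ i) ^ (-b) = 2 ^ b * (((2 : ℝ) ^ i) ^ (-b) * 2 ^ (-b)) := by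
            rw [mul_left_comm, ← Real.rpow_add two_pos]; simp
        _ ≤ _ := by gcongr
    calc ∑ y ∈ B, kern b x y ≤ ∑ y ∈ B, ∑ j ∈ range (i + 4),
          (if dist x y ≤ 2 ^ j then 2 ^ b * ((2 : ℝ) ^ j) ^ (-b) else 0) := sum_le_sum hk
      _ ≤ ∑ j ∈ range (i + 4), 2 ^ b * 4 ^ d * ((2 : ℝ) ^ j) ^ (d - b) := by
          rw [sum_comm]; exact sum_le_sum fun j _ => hterm j
      _ ≤ 2 ^ b * 4 ^ d * (C * ((2 : ℝ) ^ (i + 3)) ^ (d - b)) := by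
          rw [← mul_sum]; gcongr
      _ = (2 ^ b * 4 ^ d * (8 : ℝ) ^ (d - b) * C) * (((2 : ℝ) ^ i) ^ d * ((2 : ℝ) ^ i) ^ (-b)) := by
          rw [pow_add, Real.mul_rpow (by positivity) (by positivity),
            show (2 : ℝ) ^ 3 = 8 by norm_num, sub_eq_add_neg (d : ℝ) b,
            Real.rpow_add (x := (2 : ℝ) ^ i) (by positivity), Real.rpow_natCast]
          ring
      _ ≤ (2 ^ b * 4 ^ d * (8 : ℝ) ^ (d - b) * C) *
          (((2 : ℝ) ^ i) ^ d * (2 ^ b * max ((2 : ℝ) ^ i) (dist x y₀) ^ (-b))) := by gcongr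
      _ = 2 ^ b * (2 ^ b * 4 ^ d * (8 : ℝ) ^ (d - b) * C) *
          (((2 : ℝ) ^ i) ^ d * max ((2 : ℝ) ^ i) (dist x y₀) ^ (-b)) := by ring
      _ ≤ _ := by gcongr; exact le_max_right _ _

/-- The kernel whose capacity is comparable to the expected capacity of a sum with percolation of
depth `m`. -/
noncomputable def percKern (a b : ℝ) (m : ℕ) (x y : Fin d → ℤ) : ℝ :=
  ∑ i ∈ range (m + 1), ((2 : ℝ) ^ i) ^ (b - a) * max (2 ^ i) (dist x y) ^ (-b)

theorem percKern_comm (a b : ℝ) (m : ℕ) (x y : Fin d → ℤ) :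
    percKern a b m x y = percKern a b m y x := by
  simp only [percKern, dist_comm]

theorem percKern_pos (a b : ℝ) (m : ℕ) (x y : Fin d → ℤ) : 0 < percKern a b m x y :=
  sum_pos (fun i _ => by
    have : 0 < max ((2 : ℝ) ^ i) (dist x y) := lt_max_of_lt_left (by positivity)
    positivity) (by simp)

/-- Relative to r^(-a), the term of scale 2^i is at most (2^i/r)^(b-a) and also at most
(2^i/r)^(-a), which is summable over all scales. -/
theorem percKern_le {a b : ℝ} (ha : 0 < a) (hab : a < b) :
    ∃ C : ℝ, 0 < C ∧ ∀ (m : ℕ) (x y : Fin d → ℤ), percKern a b m x y ≤ C * kern a x y := by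
  obtain ⟨C, hC, h⟩ := sum_two_sided_geometric (s := b - a) (t := a) (by linarith) ha
  refine ⟨C, hC, fun m x y => ?_⟩
  set r := max (dist x y) 1 with hr
  have hr1 : 1 ≤ r := le_max_right _ _
  have hr0 : 0 < r := by linarith
  refine le_trans ?_ (mul_le_mul_of_nonneg_right (h r hr1 (m + 1)) (kern_pos a x y).le)
  rw [percKern, sum_mul]
  refine sum_le_sum fun i _ => ?_
  have h2i : (1 : ℝ) ≤ 2 ^ i := one_le_pow₀ (by norm_num)
  have h1 : r ≤ max (2 ^ i) (dist x y) := max_le (le_max_right _ _) (le_max_of_le_left h2i)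
  have h2 : (2 : ℝ) ^ i ≤ max (2 ^ i) (dist x y) := le_max_left _ _
  have hkern : kern a x y = r ^ (-a) := rfl
  rw [hkern, min_mul_of_nonneg _ _ (by positivity)]
  refine le_min ?_ ?_
  · calc ((2 : ℝ) ^ i) ^ (b - a) * max (2 ^ i) (dist x y) ^ (-b)
        ≤ ((2 : ℝ) ^ i) ^ (b - a) * r ^ (-b) := by
          gcongr ?_ * ?_
          exact Real.rpow_le_rpow_of_nonpos hr0 h1 (by linarith)
      _ = _ := by
          rw [Real.div_rpow (by positivity) hr0.le, div_mul_eq_mul_div, mul_div_assoc,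
            ← Real.rpow_sub hr0]
          congr 2; ring
  · calc ((2 : ℝ) ^ i) ^ (b - a) * max (2 ^ i) (dist x y) ^ (-b)
        ≤ ((2 : ℝ) ^ i) ^ (b - a) * ((2 : ℝ) ^ i) ^ (-b) := by
          gcongr ?_ * ?_
          exact Real.rpow_le_rpow_of_nonpos (by positivity) h2 (by linarith)
      _ = _ := by
          rw [Real.div_rpow (by positivity) hr0.le, div_mul_cancel₀ _ (by positivity),
            ← Real.rpow_add (by positivity)]
          congr 1; ring

/-- One term is enough: the scale of the distance if it is at most 2^m, and the top scale m
otherwise. In the second case the term equals (r/2^m)^(a-b) r^(-a), and r ≤ D produces the loss. -/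
theorem le_percKern {a b : ℝ} (ha : 0 < a) (hab : a < b) (m : ℕ) {D : ℝ} (hD : 2 ^ m ≤ D)
    {x y : Fin d → ℤ} (hxy : dist x y ≤ D) :
    2 ^ (-b) * (D / 2 ^ m) ^ (a - b) * kern a x y ≤ percKern a b m x y := by
  have h2m : (0 : ℝ) < 2 ^ m := by positivity
  have hD0 : 0 < D := h2m.trans_le hD
  have hsingle : ∀ i ≤ m, ((2 : ℝ) ^ i) ^ (b - a) * max (2 ^ i) (dist x y) ^ (-b) ≤
      percKern a b m x y := fun i hi => by
    refine single_le_sum (f := fun i => ((2 : ℝ) ^ i) ^ (b - a) * max (2 ^ i) (dist x y) ^ (-b))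
      (fun j _ => ?_) (by rw [mem_range]; omega)
    have : 0 < max ((2 : ℝ) ^ j) (dist x y) := lt_max_of_lt_left (by positivity)
    positivity
  have h2b : (2 : ℝ) ^ (-b) ≤ 1 := Real.rpow_le_one_of_one_le_of_nonpos (by norm_num) (by linarith)
  set r := max (dist x y) 1 with hr
  have hr1 : 1 ≤ r := le_max_right _ _
  have hr0 : 0 < r := by linarith
  have hkern : kern a x y = r ^ (-a) := rfl
  rw [hkern]
  rcases le_or_gt r (2 ^ m) with hsmall | hbig
  · obtain ⟨n, hn1, hn2⟩ := exists_nat_pow_near hr1 (one_lt_two : (1 : ℝ) < 2)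
    have hn : n ≤ m := (pow_le_pow_iff_right₀ (one_lt_two (α := ℝ))).1 (hn1.trans hsmall)
    refine le_trans ?_ (hsingle n hn)
    have h1 : (D / 2 ^ m) ^ (a - b) ≤ 1 :=
      Real.rpow_le_one_of_one_le_of_nonpos ((one_le_div h2m).2 hD) (by linarith)
    have h2n : (0 : ℝ) < 2 ^ n := by positivity
    have h3 : max ((2 : ℝ) ^ n) (dist x y) ≤ 2 * 2 ^ n := by
      rw [pow_succ] at hn2
      exact max_le (by linarith) ((le_max_left _ _).trans (by linarith))
    calc 2 ^ (-b) * (D / 2 ^ m) ^ (a - b) * r ^ (-a) ≤ 2 ^ (-b) * 1 * (2 ^ n) ^ (-a) := by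
          gcongr ?_ * ?_ * ?_
          exact Real.rpow_le_rpow_of_nonpos h2n hn1 (by linarith)
      _ = ((2 : ℝ) ^ n) ^ (b - a) * (2 * 2 ^ n) ^ (-b) := by
          rw [Real.mul_rpow (by norm_num) h2n.le, mul_left_comm, ← Real.rpow_add h2n, mul_one]
          congr 2; ring
      _ ≤ _ := by
          gcongr ?_ * ?_
          exact Real.rpow_le_rpow_of_nonpos (lt_max_of_lt_left h2n) h3 (by linarith)
  · have hdist : dist x y = r := by
      rcases max_choice (dist x y) 1 with h | h
      · exact h.symm
      · rw [← hr] at h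
        have : (1 : ℝ) ≤ 2 ^ m := one_le_pow₀ (by norm_num)
        linarith
    refine le_trans ?_ (hsingle m le_rfl)
    rw [hdist, max_eq_right hbig.le]
    rw [hdist] at hxy
    calc 2 ^ (-b) * (D / 2 ^ m) ^ (a - b) * r ^ (-a) ≤ 1 * (D / 2 ^ m) ^ (a - b) * r ^ (-a) := by
          gcongr
      _ ≤ 1 * (r / 2 ^ m) ^ (a - b) * r ^ (-a) := by
          gcongr ?_ * ?_ * ?_
          exact Real.rpow_le_rpow_of_nonpos (by positivity) (by gcongr) (by linarith)
      _ = _ := by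
          rw [one_mul, Real.div_rpow hr0.le h2m.le, div_mul_eq_mul_div, ← Real.rpow_add hr0,
            show b - a = -(a - b) by ring, Real.rpow_neg h2m.le, div_eq_mul_inv, mul_comm]
          congr 2; ring

end Kernels

end FractalPercolation

namespace FractalPercolation

/-! ### The tree of dyadic cubes and its leaves -/

section Tree

open Finset
open scoped Classical

variable {d : ℕ}

/-- The indices of the dyadic cubes of level `m`. -/
noncomputable def leaves (d m : ℕ) : Finset (Fin d → ℕ) :=
  Fintype.piFinset fun _ => range (2 ^ m)

/-- The ancestor `i` generations above `z`. -/
def up (i : ℕ) (z : Fin d → ℕ) : Fin d → ℕ := fun j => z j / 2 ^ i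

/-- The path from level one to the cube `z` of level `m`. -/
noncomputable def anc (m : ℕ) (z : Fin d → ℕ) : Finset (ℕ × (Fin d → ℕ)) :=
  (range m).image fun i => (m - i, up i z)

/-- A finite set of cubes containing all paths to cubes of level `m`. -/
noncomputable def cubes (d m : ℕ) : Finset (ℕ × (Fin d → ℕ)) := Icc 1 m ×ˢ leaves d m

theorem mem_leaves {m : ℕ} {z : Fin d → ℕ} : z ∈ leaves d m ↔ ∀ j, z j < 2 ^ m := by
  simp [leaves]

theorem up_up (i k : ℕ) (z : Fin d → ℕ) : up i (up k z) = up (k + i) z := by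
  funext j; simp [up, Nat.div_div_eq_div_mul, pow_add]

theorem up_mem_leaves {m i : ℕ} {z : Fin d → ℕ} (hz : z ∈ leaves d m) (hi : i ≤ m) :
    up i z ∈ leaves d (m - i) := by
  rw [mem_leaves] at *
  intro j
  rw [up, Nat.div_lt_iff_lt_mul (by positivity), ← pow_add]
  rw [Nat.sub_add_cancel hi]
  exact hz j

theorem anc_subset_cubes {m : ℕ} {z : Fin d → ℕ} (hz : z ∈ leaves d m) : anc m z ⊆ cubes d m := by
  intro c hc
  obtain ⟨i, hi, rfl⟩ := mem_image.1 hc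
  rw [mem_range] at hi
  refine mem_product.2 ⟨mem_Icc.2 (by simp only; omega), mem_leaves.2 fun j => ?_⟩
  exact (Nat.div_le_self _ _).trans_lt (mem_leaves.1 hz j)

theorem mem_anc {m i : ℕ} (hi : i < m) {y z : Fin d → ℕ} : (m - i, y) ∈ anc m z ↔ y = up i z := by
  simp only [anc, mem_image, mem_range, Prod.mk.injEq]
  constructor
  · rintro ⟨k, hk, h1, rfl⟩
    rw [show k = i by omega]
  · rintro rfl
    exact ⟨i, hi, rfl, rfl⟩

theorem anc_succ (m : ℕ) (z : Fin d → ℕ) : anc (m + 1) z = insert (m + 1, z) (anc m (up 1 z)) := by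
  ext ⟨k, y⟩
  simp only [anc, mem_image, mem_range, mem_insert, Prod.mk.injEq, up_up]
  constructor
  · rintro ⟨i, hi, rfl, rfl⟩
    rcases i with _ | i
    · left; exact ⟨by omega, by funext j; simp [up]⟩
    · right; exact ⟨i, by omega, by omega, by rw [add_comm]⟩
  · rintro (⟨rfl, rfl⟩ | ⟨i, hi, rfl, rfl⟩)
    · exact ⟨0, by omega, by omega, by funext j; simp [up]⟩
    · exact ⟨i + 1, by omega, by omega, by rw [add_comm]⟩

theorem mem_remaining_iff (ω : Config d) (m : ℕ) (z : Fin d → ℕ) :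
    z ∈ remaining ω m ↔ z ∈ leaves d m ∧ ∀ c ∈ anc m z, c ∈ ω := by
  induction m generalizing z with
  | zero =>
    simp only [remaining, Set.mem_singleton_iff, mem_leaves, anc, range_zero, image_empty,
      notMem_empty, false_imp_iff, implies_true, and_true, pow_zero, Nat.lt_one_iff]
    exact ⟨fun h j => by simp [h], fun h => funext h⟩
  | succ m ih =>
    have e : (fun i => z i / 2) = up 1 z := by funext j; simp [up]
    simp only [remaining, Set.mem_ofPred_eq, e, ih, anc_succ, mem_insert, forall_eq_or_imp]
    have h2 : up 1 z ∈ leaves d m ↔ z ∈ leaves d (m + 1) := by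
      simp only [mem_leaves, up, pow_one]
      refine forall_congr' fun j => ?_
      rw [Nat.div_lt_iff_lt_mul (by norm_num), pow_succ]
    rw [h2]
    tauto

theorem card_anc (m : ℕ) (z : Fin d → ℕ) : #(anc m z) = m := by
  rw [anc, card_image_of_injOn, card_range]
  intro i hi k hk h
  simp only [Prod.mk.injEq, coe_range, Set.mem_Iio] at *
  omega

theorem up_eq_of_le {i k : ℕ} (hik : i ≤ k) {z z' : Fin d → ℕ} (h : up i z = up i z') :
    up k z = up k z' := by
  rw [← Nat.add_sub_cancel' hik, ← up_up, ← up_up, h]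

theorem anc_sdiff (m : ℕ) (q q' : Fin d → ℕ) :
    anc m q' \ anc m q =
      ((range m).filter fun i => up i q' ≠ up i q).image fun i => (m - i, up i q') := by
  ext ⟨k, y⟩
  simp only [mem_sdiff, mem_image, mem_filter, mem_range, Prod.mk.injEq]
  constructor
  · rintro ⟨h1, h2⟩
    obtain ⟨i, hi, h3⟩ := mem_image.1 h1
    simp only [Prod.mk.injEq] at h3
    obtain ⟨rfl, rfl⟩ := h3
    rw [mem_range] at hi
    exact ⟨i, ⟨hi, fun h => h2 ((mem_anc hi).2 h)⟩, rfl, rfl⟩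
  · rintro ⟨i, ⟨hi, hne⟩, rfl, rfl⟩
    exact ⟨(mem_anc hi).2 rfl, fun h => hne ((mem_anc hi).1 h)⟩

theorem card_anc_sdiff (m : ℕ) (q q' : Fin d → ℕ) :
    #(anc m q' \ anc m q) = #((range m).filter fun i => up i q' ≠ up i q) := by
  rw [anc_sdiff, card_image_of_injOn]
  intro i hi k hk h
  simp only [Prod.mk.injEq, coe_filter, mem_range, Set.mem_ofPred_eq] at *
  omega

/-- The unshared ancestors of q' are exactly those below the common one, so their number is the
height at which the two paths merge. -/
theorem card_anc_sdiff_le_iff {m i : ℕ} {q q' : Fin d → ℕ} (hq : q ∈ leaves d m)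
    (hq' : q' ∈ leaves d m) (hi : i ≤ m) : #(anc m q' \ anc m q) ≤ i ↔ up i q' = up i q := by
  rw [card_anc_sdiff]
  constructor
  · intro h
    by_contra hne
    -- At i = m both ancestors are the root; it is not listed in `anc` and needs its own argument.
    rcases hi.eq_or_lt with rfl | hlt
    · refine hne (funext fun j => ?_)
      rw [up, up, Nat.div_eq_of_lt (mem_leaves.1 hq j), Nat.div_eq_of_lt (mem_leaves.1 hq' j)]
    · have : range (i + 1) ⊆ (range m).filter fun i => up i q' ≠ up i q := by
        intro k hk
        rw [mem_range] at hk
        exact mem_filter.2 ⟨mem_range.2 (by omega), fun h => hne (up_eq_of_le (by omega) h)⟩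
      have := card_le_card this
      rw [card_range] at this
      omega
  · intro h
    calc _ ≤ #(range i) := card_le_card fun k hk => by
          rw [mem_filter] at hk
          rw [mem_range]
          by_contra hik
          exact hk.2 (up_eq_of_le (by omega) h)
      _ = i := card_range i

theorem card_anc_sdiff_le (m : ℕ) (q q' : Fin d → ℕ) : #(anc m q' \ anc m q) ≤ m :=
  (card_le_card sdiff_subset).trans (card_anc m q').le

theorem card_same_up {m i : ℕ} {q : Fin d → ℕ} (hq : q ∈ leaves d m) (hi : i ≤ m) :
    (2 ^ i) ^ d ≤ #((leaves d m).filter fun q' => up i q' = up i q) := by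
  have hsub : Fintype.piFinset (fun j => Ico (q j / 2 ^ i * 2 ^ i) (q j / 2 ^ i * 2 ^ i + 2 ^ i)) ⊆
      (leaves d m).filter fun q' => up i q' = up i q := by
    intro q' h
    simp only [Fintype.mem_piFinset, mem_Ico] at h
    have h1 : ∀ j, q' j / 2 ^ i = q j / 2 ^ i := by
      intro j
      rw [Nat.div_eq_iff (by positivity)]
      have := h j
      constructor
      · exact this.1
      · omega
    refine mem_filter.2 ⟨mem_leaves.2 fun j => ?_, funext h1⟩
    have h2 := up_mem_leaves hq hi
    have h3 := mem_leaves.1 h2 j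
    simp only [up, ← h1 j] at h3
    rw [Nat.div_lt_iff_lt_mul (by positivity), ← pow_add, Nat.sub_add_cancel hi] at h3
    exact h3
  refine le_trans (le_of_eq ?_) (card_le_card hsub)
  simp

/-- The lattice point of the cube `z` of level `m` after scaling by `2 ^ m`. -/
def pos (m : ℕ) (z : Fin d → ℕ) : Fin d → ℤ := fun j => (z j : ℤ) - 2 ^ (m - 1)

theorem pos_injective (m : ℕ) : Function.Injective (pos (d := d) m) := by
  intro z z' h
  funext j
  have := congr_fun h j
  simpa [pos] using this

theorem dist_pos_le {m i : ℕ} {q q' : Fin d → ℕ} (h : up i q' = up i q) :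
    dist (pos m q) (pos m q') ≤ 2 ^ i := by
  refine (dist_pi_le_iff (by positivity)).2 fun j => ?_
  rw [Int.dist_eq]
  have h1 := congr_fun h j
  simp only [up] at h1
  have a1 := Nat.div_add_mod (q j) (2 ^ i)
  have a2 := Nat.mod_lt (q j) (show 0 < 2 ^ i by positivity)
  have b1 := Nat.div_add_mod (q' j) (2 ^ i)
  have b2 := Nat.mod_lt (q' j) (show 0 < 2 ^ i by positivity)
  rw [h1] at b1
  have h2 : |(q j : ℤ) - q' j| ≤ 2 ^ i := by
    rw [abs_le]
    zify at *
    constructor <;> linarith [Int.emod_nonneg (q j : ℤ) (show (2 : ℤ) ^ i ≠ 0 by positivity),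
      Int.emod_nonneg (q' j : ℤ) (show (2 : ℤ) ^ i ≠ 0 by positivity)]
  have h3 : (((|(q j : ℤ) - q' j| : ℤ)) : ℝ) ≤ ((2 ^ i : ℤ) : ℝ) := by exact_mod_cast h2
  simpa [pos] using h3

theorem discretePerc_eq {m : ℕ} (hm : 1 ≤ m) (ω : Config d) :
    discretePerc m ω = pos m '' remaining ω m := by
  have h2 : (0 : ℝ) < 2 ^ m := by positivity
  have hhalf : (2 : ℝ) ^ m * (1 / 2) = 2 ^ (m - 1) := by
    obtain ⟨k, rfl⟩ := Nat.exists_eq_add_of_le hm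
    rw [Nat.add_sub_cancel_left, pow_add]; ring
  have key : ∀ (x : Fin d → ℤ) (z : Fin d → ℕ),
      latticePoint x ∈ (2 ^ m : ℝ) • cube m z ↔ pos m z = x := by
    intro x z
    rw [Set.mem_smul_set_iff_inv_smul_mem₀ h2.ne', cube, Set.mem_ofPred_eq, funext_iff]
    refine forall_congr' fun i => ?_
    have e : ((2 ^ m : ℝ)⁻¹ • latticePoint x) i = x i / 2 ^ m := by
      simp [latticePoint, div_eq_inv_mul]
    rw [e, le_div_iff₀ h2, div_lt_iff₀ h2, add_mul, add_mul, div_mul_cancel₀ _ h2.ne',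
      div_mul_cancel₀ _ h2.ne', neg_mul, mul_comm (1 / 2 : ℝ), hhalf, pos]
    constructor
    · rintro ⟨h1, h3⟩
      have h1' : -(2 : ℤ) ^ (m - 1) + z i ≤ x i := by exact_mod_cast h1
      have h3' : x i < -(2 : ℤ) ^ (m - 1) + (z i + 1) := by exact_mod_cast h3
      linarith
    · intro h
      rw [← h]
      push_cast
      constructor <;> linarith
  ext x
  simp only [discretePerc, Set.mem_ofPred_eq, Set.mem_iUnion, key, Set.mem_image, exists_prop]

/-! ### Depth-first order of the leaves -/

section Order

/-- The number of siblings in the tree of dyadic cubes. -/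
noncomputable def arity (d : ℕ) : ℕ := Fintype.card (Fin d → Fin 2)

/-- The rank of a cube among its siblings. -/
noncomputable def digit (z : Fin d → ℕ) : ℕ :=
  Fintype.equivFin (Fin d → Fin 2) fun j => ⟨z j % 2, Nat.mod_lt _ two_pos⟩

/-- The rank of a cube of level `k` in depth-first order. -/
noncomputable def code : ℕ → (Fin d → ℕ) → ℕ
  | 0, _ => 0
  | k + 1, z => arity d * code k (up 1 z) + digit z

theorem digit_lt (z : Fin d → ℕ) : digit z < arity d := Fin.is_lt _

theorem arity_pos : 0 < arity d := (digit_lt fun _ => 0).trans_le' (Nat.zero_le _)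

theorem code_succ_div (k : ℕ) (z : Fin d → ℕ) : code (k + 1) z / arity d = code k (up 1 z) := by
  rw [code, Nat.mul_add_div arity_pos, Nat.div_eq_of_lt (digit_lt z), add_zero]

theorem code_up (k i : ℕ) (z : Fin d → ℕ) : code k (up i z) = code (k + i) z / arity d ^ i := by
  induction i generalizing z with
  | zero =>
    have : up 0 z = z := by funext j; simp [up]
    simp [this]
  | succ i ih =>
    rw [add_comm i 1, ← up_up, ih, pow_add, pow_one, ← Nat.div_div_eq_div_mul, ← code_succ_div]
    congr 3
    omega

theorem code_injOn (k : ℕ) : Set.InjOn (code (d := d) k) (leaves d k) := by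
  induction k with
  | zero =>
    intro z hz z' hz' _
    have h1 := mem_leaves.1 (mem_coe.1 hz)
    have h2 := mem_leaves.1 (mem_coe.1 hz')
    funext j
    have := h1 j
    have := h2 j
    simp only [pow_zero] at *
    omega
  | succ k ih =>
    intro z hz z' hz' h
    have hup : ∀ {y : Fin d → ℕ}, y ∈ leaves d (k + 1) → up 1 y ∈ leaves d k := fun hy => by
      have := up_mem_leaves hy (show 1 ≤ k + 1 by omega)
      rwa [Nat.add_sub_cancel] at this
    have h1 : up 1 z = up 1 z' :=
      ih (mem_coe.2 (hup (mem_coe.1 hz))) (mem_coe.2 (hup (mem_coe.1 hz')))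
        (by rw [← code_succ_div, ← code_succ_div, h])
    have h2 : digit z = digit z' := by
      have h' := h
      simp only [code, h1] at h'
      omega
    have h3 := (Fintype.equivFin (Fin d → Fin 2)).injective (Fin.ext h2)
    funext j
    have e1 := congr_fun h1 j
    have e2 := congr_fun h3 j
    simp only [up, pow_one, Fin.mk.injEq] at e1 e2
    omega

/-- The cubes that are examined up to the leaf `q` in depth-first order. -/
def before (m : ℕ) (q : Fin d → ℕ) : Set (ℕ × (Fin d → ℕ)) :=
  {c | ∃ i < m, c.1 = m - i ∧ code (m - i) c.2 ≤ code (m - i) (up i q)}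

/-- The cubes that are examined up to the leaf `q` in reversed depth-first order. -/
def after (m : ℕ) (q : Fin d → ℕ) : Set (ℕ × (Fin d → ℕ)) :=
  {c | ∃ i < m, c.1 = m - i ∧ code (m - i) (up i q) ≤ code (m - i) c.2}

theorem code_up_mono {m i : ℕ} (hi : i < m) {q q' : Fin d → ℕ} (h : code m q ≤ code m q') :
    code (m - i) (up i q) ≤ code (m - i) (up i q') := by
  rw [code_up, code_up, Nat.sub_add_cancel hi.le]
  exact Nat.div_le_div_right h

theorem before_mono {m : ℕ} {q q' : Fin d → ℕ} (h : code m q ≤ code m q') :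
    before m q ⊆ before m q' := by
  rintro c ⟨i, hi, h1, h2⟩
  exact ⟨i, hi, h1, h2.trans (code_up_mono hi h)⟩

theorem after_mono {m : ℕ} {q q' : Fin d → ℕ} (h : code m q' ≤ code m q) :
    after m q ⊆ after m q' := by
  rintro c ⟨i, hi, h1, h2⟩
  exact ⟨i, hi, h1, (code_up_mono hi h).trans h2⟩

theorem anc_subset_before (m : ℕ) (q : Fin d → ℕ) : ∀ c ∈ anc m q, c ∈ before m q := by
  intro c hc
  obtain ⟨i, hi, rfl⟩ := mem_image.1 hc
  exact ⟨i, mem_range.1 hi, rfl, le_rfl⟩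

theorem anc_subset_after (m : ℕ) (q : Fin d → ℕ) : ∀ c ∈ anc m q, c ∈ after m q := by
  intro c hc
  obtain ⟨i, hi, rfl⟩ := mem_image.1 hc
  exact ⟨i, mem_range.1 hi, rfl, le_rfl⟩

/-- An ancestor of a later leaf q' has code at least that of the ancestor of q on its level; if it
has been explored by q the codes agree, and `code` is injective on each level. Thus the exploration
up to q reveals nothing about the path to q' below the branching point. -/
theorem mem_anc_of_mem_before {m : ℕ} {q q' : Fin d → ℕ} (hq : q ∈ leaves d m)
    (hq' : q' ∈ leaves d m) (h : code m q ≤ code m q') :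
    ∀ c ∈ anc m q', c ∈ before m q → c ∈ anc m q := by
  rintro c hc ⟨k, hk, h1, h2⟩
  obtain ⟨i, hi, rfl⟩ := mem_image.1 hc
  rw [mem_range] at hi
  obtain rfl : i = k := by simp only at h1; omega
  rw [mem_anc hi]
  exact code_injOn _ (mem_coe.2 (up_mem_leaves hq' hi.le)) (mem_coe.2 (up_mem_leaves hq hi.le))
    (h2.antisymm (code_up_mono hi h))

theorem mem_anc_of_mem_after {m : ℕ} {q q' : Fin d → ℕ} (hq : q ∈ leaves d m)
    (hq' : q' ∈ leaves d m) (h : code m q' ≤ code m q) :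
    ∀ c ∈ anc m q', c ∈ after m q → c ∈ anc m q := by
  rintro c hc ⟨k, hk, h1, h2⟩
  obtain ⟨i, hi, rfl⟩ := mem_image.1 hc
  rw [mem_range] at hi
  obtain rfl : i = k := by simp only at h1; omega
  rw [mem_anc hi]
  exact code_injOn _ (mem_coe.2 (up_mem_leaves hq' hi.le)) (mem_coe.2 (up_mem_leaves hq hi.le))
    ((code_up_mono hi h).antisymm h2)

end Order

/-! ### Conditional expectation of the potential of the kept leaves -/

section PathSums

variable {a b : ℝ}

/-- This identity fixes the retention probability: the expected number of kept descendants i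
generations down is 2^(i(b-a)). -/
theorem pow_mul_pow_eq (i : ℕ) :
    ((2 : ℝ) ^ (b - a - d)) ^ i * ((2 : ℝ) ^ i) ^ d = ((2 : ℝ) ^ i) ^ (b - a) := by
  rw [← two_pow_rpow, ← Real.rpow_natCast (2 ^ i) d, ← Real.rpow_add (by positivity)]
  congr 1; ring

/-- Bound p^n, with n the branching height, by the sum of p^i over all i at which the ancestors of q
and q' agree. For fixed i the leaves q' lie within 2^i of q, where `sum_kern_le` applies. -/
theorem sum_path_kern_le (ha : 0 < a) (hab : a < b) (hbd : b < d) :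
    ∃ C : ℝ, 0 < C ∧ ∀ (m : ℕ) (x x' : Fin d → ℤ), ∀ q ∈ leaves d m,
      ∑ q' ∈ leaves d m, ((2 : ℝ) ^ (b - a - d)) ^ #(anc m q' \ anc m q) *
        kern b (x + pos m q) (x' + pos m q') ≤ C * percKern a b m x x' := by
  obtain ⟨C, hC, h⟩ := sum_kern_le (d := d) (ha.trans hab) hbd
  refine ⟨C, hC, fun m x x' q hq => ?_⟩
  set p := (2 : ℝ) ^ (b - a - d) with hp
  have hp0 : 0 < p := by positivity
  have h1 : ∀ q' ∈ leaves d m, p ^ #(anc m q' \ anc m q) *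
      kern b (x + pos m q) (x' + pos m q') ≤ ∑ i ∈ range (m + 1),
        if up i q' = up i q then p ^ i * kern b (x + pos m q) (x' + pos m q') else 0 := by
    intro q' hq'
    have hle := card_anc_sdiff_le m q q'
    have hup := (card_anc_sdiff_le_iff hq hq' hle).1 le_rfl
    have := single_le_sum (f := fun i => if up i q' = up i q then
      p ^ i * kern b (x + pos m q) (x' + pos m q') else 0) (s := range (m + 1))
      (fun i _ => by
        have := kern_pos b (x + pos m q) (x' + pos m q')
        split_ifs <;> positivity) (mem_range.2 (Nat.lt_succ_of_le hle))
    simpa only [hup, if_true] using this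
  refine (sum_le_sum h1).trans ?_
  rw [sum_comm, percKern, mul_sum]
  refine sum_le_sum fun i _ => ?_
  rw [← sum_filter, ← mul_sum]
  have h2 := h i (((leaves d m).filter fun q' => up i q' = up i q).image fun q' => x' + pos m q')
    (x + pos m q) (x' + pos m q) (by
      intro y hy
      obtain ⟨q', hq', rfl⟩ := mem_image.1 hy
      rw [dist_add_left]
      exact dist_pos_le (mem_filter.1 hq').2)
  rw [sum_image fun z _ z' _ hzz => pos_injective m (add_left_cancel hzz), dist_add_right] at h2
  calc _ ≤ p ^ i * (C * (((2 : ℝ) ^ i) ^ d * max (2 ^ i) (dist x x') ^ (-b))) := by gcongr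
    _ = C * (p ^ i * ((2 : ℝ) ^ i) ^ d * max (2 ^ i) (dist x x') ^ (-b)) := by ring
    _ = _ := by rw [hp, pow_mul_pow_eq]

/-- Conversely (1-p) times the sum of p^i over n ≤ i ≤ m is p^n - p^(m+1) ≤ p^n. For each i there
are at least 2^(id) leaves sharing the ancestor, all within 2 max(2^i, dist x x') after translation.
-/
theorem le_sum_path_kern (ha : 0 < a) (hab : a < b) (hbd : b < d) :
    ∃ c : ℝ, 0 < c ∧ ∀ (m : ℕ) (x x' : Fin d → ℤ), ∀ q ∈ leaves d m,
      c * percKern a b m x x' ≤ ∑ q' ∈ leaves d m,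
        ((2 : ℝ) ^ (b - a - d)) ^ #(anc m q' \ anc m q) *
          kern b (x + pos m q) (x' + pos m q') := by
  set p := (2 : ℝ) ^ (b - a - d) with hp
  have hp0 : 0 < p := by positivity
  have hp1 : p < 1 := Real.rpow_lt_one_of_one_lt_of_neg (by norm_num) (by linarith)
  refine ⟨(1 - p) * 2 ^ (-b), mul_pos (by linarith) (by positivity), fun m x x' q hq => ?_⟩
  have h1 : ∀ q' ∈ leaves d m, (1 - p) * ∑ i ∈ range (m + 1),
        (if up i q' = up i q then p ^ i * kern b (x + pos m q) (x' + pos m q') else 0) ≤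
      p ^ #(anc m q' \ anc m q) * kern b (x + pos m q) (x' + pos m q') := by
    intro q' hq'
    have hk := kern_pos b (x + pos m q) (x' + pos m q')
    set n := #(anc m q' \ anc m q) with hn
    have hle : n ≤ m := card_anc_sdiff_le m q q'
    have h2 : ∑ i ∈ range (m + 1), (if up i q' = up i q then
        p ^ i * kern b (x + pos m q) (x' + pos m q') else 0) =
        (∑ i ∈ Ico n (m + 1), p ^ i) * kern b (x + pos m q) (x' + pos m q') := by
      rw [← sum_filter, sum_mul]
      refine sum_congr ?_ fun _ _ => rfl
      ext i
      simp only [mem_filter, mem_range, mem_Ico]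
      constructor
      · rintro ⟨hi, h⟩
        exact ⟨(card_anc_sdiff_le_iff hq hq' (by omega)).2 h, hi⟩
      · rintro ⟨h, hi⟩
        exact ⟨hi, (card_anc_sdiff_le_iff hq hq' (by omega)).1 h⟩
    rw [h2, ← mul_assoc]
    refine mul_le_mul_of_nonneg_right ?_ hk.le
    rw [geom_sum_Ico hp1.ne (by omega), ← neg_sub (p ^ n), ← neg_sub 1 p, neg_div_neg_eq,
      mul_div_cancel₀ _ (sub_pos.2 hp1).ne']
    have : 0 < p ^ (m + 1) := by positivity
    linarith
  refine le_trans ?_ (sum_le_sum h1)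
  rw [← mul_sum, sum_comm, mul_assoc]
  refine mul_le_mul_of_nonneg_left ?_ (by linarith)
  rw [percKern, mul_sum]
  refine sum_le_sum fun i hi => ?_
  have hi' : i ≤ m := by rw [mem_range] at hi; omega
  rw [← sum_filter]
  have hM : 0 < max ((2 : ℝ) ^ i) (dist x x') := lt_max_of_lt_left (by positivity)
  have h3 : ∀ q' ∈ (leaves d m).filter fun q' => up i q' = up i q,
      p ^ i * (2 ^ (-b) * max (2 ^ i) (dist x x') ^ (-b)) ≤
        p ^ i * kern b (x + pos m q) (x' + pos m q') := by
    intro q' hq'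
    refine mul_le_mul_of_nonneg_left ?_ (by positivity)
    rw [← Real.mul_rpow (by norm_num) hM.le]
    refine Real.rpow_le_rpow_of_nonpos (lt_max_of_lt_right one_pos) ?_ (by linarith)
    have h4 := dist_pos_le (m := m) (mem_filter.1 hq').2
    have h5 : dist (x + pos m q) (x' + pos m q') ≤ dist x x' + dist (pos m q) (pos m q') :=
      dist_add_add_le _ _ _ _
    have h6 : (1 : ℝ) ≤ 2 ^ i := one_le_pow₀ (by norm_num)
    have h7 := le_max_left ((2 : ℝ) ^ i) (dist x x')
    have h8 := le_max_right ((2 : ℝ) ^ i) (dist x x')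
    exact max_le (by linarith) (by linarith)
  refine le_trans ?_ (sum_le_sum h3)
  rw [sum_const, nsmul_eq_mul]
  have h9 : ((2 : ℝ) ^ i) ^ d ≤ #((leaves d m).filter fun q' => up i q' = up i q) := by
    exact_mod_cast card_same_up hq hi'
  calc 2 ^ (-b) * (((2 : ℝ) ^ i) ^ (b - a) * max (2 ^ i) (dist x x') ^ (-b))
      = ((2 : ℝ) ^ i) ^ d * (p ^ i * (2 ^ (-b) * max (2 ^ i) (dist x x') ^ (-b))) := by
        rw [← pow_mul_pow_eq (d := d)]; ring
    _ ≤ _ := by gcongr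

end PathSums

end Tree

end FractalPercolation

namespace FractalPercolation

/-! ### Capacities of finite sets as real numbers -/

section RealCapacity

open Finset
open scoped Classical

variable {α V : Type*}

theorem pairing_nonneg {J : Finset α} {κ : α → α → ℝ} (hκ : ∀ i j, 0 ≤ κ i j) {f g : α → ℝ}
    (hf : ∀ i, 0 ≤ f i) (hg : ∀ i, 0 ≤ g i) : 0 ≤ pairing J κ f g :=
  sum_nonneg fun i _ => sum_nonneg fun j _ => mul_nonneg (hκ i j) (mul_nonneg (hf i) (hg j))

theorem pairing_mono {J : Finset α} {κ κ' : α → α → ℝ} (h : ∀ i ∈ J, ∀ j ∈ J, κ i j ≤ κ' i j)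
    {f g : α → ℝ} (hf : ∀ i, 0 ≤ f i) (hg : ∀ i, 0 ≤ g i) :
    pairing J κ f g ≤ pairing J κ' f g :=
  sum_le_sum fun i hi => sum_le_sum fun j hj =>
    mul_le_mul_of_nonneg_right (h i hi j hj) (mul_nonneg (hf i) (hg j))

theorem pairing_const_mul (J : Finset α) (κ : α → α → ℝ) (f g : α → ℝ) (c : ℝ) :
    pairing J (fun i j => c * κ i j) f g = c * pairing J κ f g := by
  simp only [pairing, mul_sum, mul_assoc]

theorem pairing_pos {J : Finset α} {κ : α → α → ℝ} (hκ : ∀ i j, 0 < κ i j) {f : α → ℝ}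
    (hf : ∀ i, 0 ≤ f i) (hf1 : 0 < ∑ i ∈ J, f i) : 0 < pairing J κ f f := by
  obtain ⟨i, hi, hne⟩ := exists_ne_zero_of_sum_ne_zero hf1.ne'
  have hpos : 0 < f i := lt_of_le_of_ne (hf i) hne.symm
  refine sum_pos' (fun i _ => sum_nonneg fun j _ =>
    mul_nonneg (hκ i j).le (mul_nonneg (hf i) (hf j))) ⟨i, hi, ?_⟩
  exact sum_pos' (fun j _ => mul_nonneg (hκ i j).le (mul_nonneg (hf i) (hf j)))
    ⟨i, hi, mul_pos (hκ i i) (mul_pos hpos hpos)⟩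

/-- The capacity of a finite set with respect to a kernel. -/
noncomputable def rcap (κ : V → V → ℝ) (B : Finset V) : ℝ :=
  if h : B.Nonempty ∧ ∀ x y, κ x y = κ y x then
    (pairing B κ (exists_equilibrium h.1 h.2).choose (exists_equilibrium h.1 h.2).choose)⁻¹ else 0

theorem rcap_empty (κ : V → V → ℝ) : rcap κ ∅ = 0 := by simp [rcap]

variable {κ κ' : V → V → ℝ} {B : Finset V}

theorem exists_equilibrium_rcap (hκ : ∀ x y, 0 < κ x y) (hs : ∀ x y, κ x y = κ y x)
    (hB : B.Nonempty) :
    0 < rcap κ B ∧ ∃ ρ : V → ℝ, (∀ x, 0 ≤ ρ x) ∧ (∀ x, x ∉ B → ρ x = 0) ∧ ∑ x ∈ B, ρ x = 1 ∧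
      pairing B κ ρ ρ = (rcap κ B)⁻¹ ∧
      (∀ w : V → ℝ, (∀ x, 0 ≤ w x) → ∑ x ∈ B, w x = 1 → (rcap κ B)⁻¹ ≤ pairing B κ w w) ∧
      ∀ x ∈ B, (rcap κ B)⁻¹ ≤ ∑ y ∈ B, κ x y * ρ y := by
  have hρ := (exists_equilibrium hB hs).choose_spec
  set ρ := (exists_equilibrium hB hs).choose with hρdef
  have e : rcap κ B = (pairing B κ ρ ρ)⁻¹ := by
    rw [rcap, dif_pos ⟨hB, hs⟩]
  have hpos : 0 < pairing B κ ρ ρ := pairing_pos hκ hρ.1 (by rw [hρ.2.2.1]; exact one_pos)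
  rw [e, inv_inv]
  exact ⟨inv_pos.2 hpos, ρ, hρ.1, hρ.2.1, hρ.2.2.1, rfl, hρ.2.2.2.1, hρ.2.2.2.2⟩

theorem rcap_nonneg (hκ : ∀ x y, 0 < κ x y) (hs : ∀ x y, κ x y = κ y x) (B : Finset V) :
    0 ≤ rcap κ B := by
  rcases B.eq_empty_or_nonempty with rfl | hB
  · rw [rcap_empty]
  · exact (exists_equilibrium_rcap hκ hs hB).1.le

/-- Homogeneous form of the minimality of the equilibrium energy: normalise w to mass one. -/
theorem sq_sum_le_rcap_mul (hκ : ∀ x y, 0 < κ x y) (hs : ∀ x y, κ x y = κ y x) {w : V → ℝ}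
    (hw : ∀ x, 0 ≤ w x) : (∑ x ∈ B, w x) ^ 2 ≤ rcap κ B * pairing B κ w w := by
  rcases (sum_nonneg fun x (_ : x ∈ B) => hw x).eq_or_lt with h0 | hpos
  · rw [← h0]
    have := mul_nonneg (rcap_nonneg hκ hs B) (pairing_nonneg (fun i j => (hκ i j).le) hw hw
      (J := B))
    simpa using this
  · set M := ∑ x ∈ B, w x with hM
    have hB : B.Nonempty := by
      obtain ⟨x, hx, _⟩ := exists_ne_zero_of_sum_ne_zero hpos.ne'
      exact ⟨x, hx⟩
    obtain ⟨hc, ρ, -, -, -, -, hmin, -⟩ := exists_equilibrium_rcap hκ hs hB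
    have h := hmin (fun x => M⁻¹ * w x) (fun x => mul_nonneg (inv_nonneg.2 hpos.le) (hw x))
      (by rw [← mul_sum, ← hM, inv_mul_cancel₀ hpos.ne'])
    have e : pairing B κ (fun x => M⁻¹ * w x) (fun x => M⁻¹ * w x) =
        (M ^ 2)⁻¹ * pairing B κ w w := by
      simp only [pairing, mul_sum]
      exact sum_congr rfl fun _ _ => sum_congr rfl fun _ _ => by field_simp
    rw [e, inv_le_iff_one_le_mul₀ hc] at h
    have hM2 : 0 < M ^ 2 := by positivity
    calc M ^ 2 = M ^ 2 * 1 := (mul_one _).symm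
      _ ≤ M ^ 2 * ((M ^ 2)⁻¹ * pairing B κ w w * rcap κ B) := by gcongr
      _ = _ := by field_simp

theorem rcap_le_of_kernel_le (hκ : ∀ x y, 0 < κ x y) (hs : ∀ x y, κ x y = κ y x)
    (hκ' : ∀ x y, 0 < κ' x y) (hs' : ∀ x y, κ' x y = κ' y x) {C : ℝ}
    (h : ∀ x ∈ B, ∀ y ∈ B, κ x y ≤ C * κ' x y) : rcap κ' B ≤ C * rcap κ B := by
  rcases B.eq_empty_or_nonempty with rfl | hB
  · simp [rcap_empty]
  · obtain ⟨hc, -⟩ := exists_equilibrium_rcap hκ hs hB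
    obtain ⟨hc', ρ, h0, -, h1, h2, -, -⟩ := exists_equilibrium_rcap hκ' hs' hB
    have h3 := sq_sum_le_rcap_mul hκ hs h0 (B := B)
    rw [h1, one_pow] at h3
    have h4 : pairing B κ ρ ρ ≤ C * (rcap κ' B)⁻¹ := by
      rw [← h2, ← pairing_const_mul]
      exact pairing_mono h h0 h0
    have h5 : 1 ≤ rcap κ B * (C * (rcap κ' B)⁻¹) := h3.trans (by gcongr)
    calc rcap κ' B = rcap κ' B * 1 := (mul_one _).symm
      _ ≤ rcap κ' B * (rcap κ B * (C * (rcap κ' B)⁻¹)) := by gcongr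
      _ = _ := by field_simp

/-- Push f forward along u; mass and energy are preserved. Injectivity cannot be asked, since
different pairs of a point and a leaf may have the same sum. -/
theorem sq_sum_le_rcap_mul_of_map (hκ : ∀ x y, 0 < κ x y) (hs : ∀ x y, κ x y = κ y x)
    {J : Finset α} {u : α → V} {f : α → ℝ} (hf : ∀ i, 0 ≤ f i)
    (hfB : ∀ i ∈ J, f i ≠ 0 → u i ∈ B) :
    (∑ i ∈ J, f i) ^ 2 ≤ rcap κ B * pairing J (fun i j => κ (u i) (u j)) f f := by
  set w : V → ℝ := fun v => ∑ i ∈ J, if u i = v then f i else 0 with hw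
  have hpush : ∀ g : V → ℝ, ∑ v ∈ B, w v * g v = ∑ i ∈ J, f i * g (u i) := by
    intro g
    simp only [hw, sum_mul]
    rw [sum_comm]
    refine sum_congr rfl fun i hi => ?_
    simp only [ite_mul, zero_mul, sum_ite_eq]
    split_ifs with h
    · rfl
    · have : f i = 0 := by by_contra hne; exact h (hfB i hi hne)
      simp [this]
  have h := sq_sum_le_rcap_mul hκ hs (B := B) (w := w) fun v => sum_nonneg fun i _ => by
    split_ifs
    · exact hf i
    · exact le_rfl
  have e1 := hpush fun _ => 1
  simp only [mul_one] at e1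
  have e2 : pairing B κ w w = pairing J (fun i j => κ (u i) (u j)) f f := by
    have a1 : ∀ v, ∑ v' ∈ B, κ v v' * (w v * w v') = w v * ∑ j ∈ J, f j * κ v (u j) := by
      intro v
      rw [← hpush, mul_sum]
      exact sum_congr rfl fun _ _ => by ring
    unfold pairing
    simp only [a1]
    rw [hpush]
    refine sum_congr rfl fun i _ => ?_
    rw [mul_sum]
    exact sum_congr rfl fun _ _ => by ring
  rwa [e1, e2] at h

/-- Split the mass at each point equally over its fibre. This transfers a measure on A + Q to pairs,
where the tree structure is visible. -/
theorem exists_lift [DecidableEq V] (J : Finset α) (u : α → V) {w : V → ℝ} (hw : ∀ v, 0 ≤ w v) :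
    ∃ f : α → ℝ, (∀ i, 0 ≤ f i) ∧ (∀ i, i ∉ J → f i = 0) ∧
      ∀ g : V → ℝ, ∑ i ∈ J, f i * g (u i) = ∑ v ∈ J.image u, w v * g v := by
  refine ⟨fun i => if i ∈ J then w (u i) / #(J.filter fun j => u j = u i) else 0, fun i => ?_,
    fun i hi => if_neg hi, fun g => ?_⟩
  · beta_reduce
    split_ifs
    · exact div_nonneg (hw _) (Nat.cast_nonneg _)
    · exact le_rfl
  · rw [sum_congr rfl fun i hi => show _ = w (u i) / #(J.filter fun j => u j = u i) * g (u i) by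
      beta_reduce; rw [if_pos hi], sum_comp (fun v => w v / #(J.filter fun j => u j = v) * g v) u]
    refine sum_congr rfl fun v hv => ?_
    obtain ⟨i, hi, hiv⟩ := mem_image.1 hv
    have : (#(J.filter fun j => u j = v) : ℝ) ≠ 0 :=
      Nat.cast_ne_zero.2 (card_ne_zero_of_mem (mem_filter.2 ⟨hi, hiv⟩))
    rw [nsmul_eq_mul]
    field_simp

/-! ### Expected capacity of the sum with percolation, up to constants -/

section Percolation

variable {d : ℕ} {a b : ℝ}

/-- The sum of `A` and the lattice percolation of depth `m` in the configuration `T`. -/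
noncomputable def percSum (A : Finset (Fin d → ℤ)) (m : ℕ) (T : Finset (ℕ × (Fin d → ℕ))) :
    Finset (Fin d → ℤ) :=
  ((A ×ˢ leaves d m).filter fun i => anc m i.2 ⊆ T).image fun i => i.1 + pos m i.2

/-- The random weight that puts mass `ρ x` on each pair of `x` and a retained leaf. -/
noncomputable def leafWeight (ρ : (Fin d → ℤ) → ℝ) (m : ℕ) (T : Finset (ℕ × (Fin d → ℕ)))
    (i : (Fin d → ℤ) × (Fin d → ℕ)) : ℝ :=
  ρ i.1 * if anc m i.2 ⊆ T then 1 else 0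

theorem leafWeight_nonneg {ρ : (Fin d → ℤ) → ℝ} (hρ : ∀ x, 0 ≤ ρ x) (m : ℕ)
    (T : Finset (ℕ × (Fin d → ℕ))) (i : (Fin d → ℤ) × (Fin d → ℕ)) : 0 ≤ leafWeight ρ m T i :=
  mul_nonneg (hρ _) (by split_ifs <;> norm_num)

theorem card_leaves_mul_pow (a b : ℝ) (m : ℕ) :
    (#(leaves d m) : ℝ) * ((2 : ℝ) ^ (b - a - d)) ^ m = ((2 : ℝ) ^ m) ^ (b - a) := by
  rw [← pow_mul_pow_eq (d := d), mul_comm]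
  simp [leaves]

theorem two_rpow_neg_mem (ha : 0 < a) (hbd : b < d) :
    0 ≤ (2 : ℝ) ^ (b - a - d) ∧ (2 : ℝ) ^ (b - a - d) ≤ 1 :=
  ⟨by positivity, Real.rpow_le_one_of_one_le_of_nonpos (by norm_num) (by linarith)⟩

/-- Leaves q and q' are kept together with probability p^m p^n, where n is the number of ancestors
of q' not shared with q. Summing over q' gives `percKern`, and summing over q gives the expected
number of kept leaves. -/
theorem bernE_leafWeight_energy_le (ha : 0 < a) (hab : a < b) (hbd : b < d) :
    ∃ C : ℝ, 0 < C ∧ ∀ (m : ℕ) (A : Finset (Fin d → ℤ)) (ρ : (Fin d → ℤ) → ℝ), (∀ x, 0 ≤ ρ x) →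
      bernE (cubes d m) ((2 : ℝ) ^ (b - a - d)) (fun T => pairing (A ×ˢ leaves d m)
        (fun i j => kern b (i.1 + pos m i.2) (j.1 + pos m j.2))
        (leafWeight ρ m T) (leafWeight ρ m T)) ≤
      C * (((2 : ℝ) ^ m) ^ (b - a) * pairing A (percKern a b m) ρ ρ) := by
  obtain ⟨C, hC, h⟩ := sum_path_kern_le (d := d) ha hab hbd
  refine ⟨C, hC, fun m A ρ hρ => ?_⟩
  set p := (2 : ℝ) ^ (b - a - d) with hp
  have hp0 : 0 < p := by positivity
  have hE : ∀ i ∈ A ×ˢ leaves d m, ∀ j ∈ A ×ˢ leaves d m, bernE (cubes d m) p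
      (fun T => leafWeight ρ m T i * leafWeight ρ m T j) =
      ρ i.1 * ρ j.1 * (p ^ m * p ^ #(anc m j.2 \ anc m i.2)) := by
    intro i hi j hj
    have e : ∀ T, leafWeight ρ m T i * leafWeight ρ m T j =
        ρ i.1 * ρ j.1 * if anc m i.2 ∪ anc m j.2 ⊆ T then 1 else 0 := by
      intro T
      simp only [leafWeight, union_subset_iff]
      by_cases h1 : anc m i.2 ⊆ T <;> by_cases h2 : anc m j.2 ⊆ T <;> simp [h1, h2]
    simp only [e]
    rw [bernE_const_mul, bernE_subset (union_subset (anc_subset_cubes (mem_product.1 hi).2)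
      (anc_subset_cubes (mem_product.1 hj).2)), ← pow_add, ← union_sdiff_self_eq_union,
      card_union_of_disjoint disjoint_sdiff, card_anc]
  rw [bernE_pairing, sum_congr rfl fun i hi => sum_congr rfl fun j hj => by rw [hE i hi j hj]]
  simp only [sum_product]
  have h1 : ∀ x ∈ A, ∀ q ∈ leaves d m, ∑ x' ∈ A, ∑ q' ∈ leaves d m,
      kern b (x + pos m q) (x' + pos m q') *
        (ρ x * ρ x' * (p ^ m * p ^ #(anc m q' \ anc m q))) ≤
      p ^ m * (C * ∑ x' ∈ A, percKern a b m x x' * (ρ x * ρ x')) := by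
    intro x _ q hq
    rw [mul_sum, mul_sum]
    refine sum_le_sum fun x' _ => ?_
    have := h m x x' q hq
    calc _ = p ^ m * (ρ x * ρ x') * ∑ q' ∈ leaves d m, p ^ #(anc m q' \ anc m q) *
          kern b (x + pos m q) (x' + pos m q') := by
            rw [mul_sum]; exact sum_congr rfl fun _ _ => by ring
      _ ≤ p ^ m * (ρ x * ρ x') * (C * percKern a b m x x') := by
            have := hρ x; have := hρ x'; gcongr
      _ = _ := by ring
  calc _ ≤ ∑ x ∈ A, ∑ _q ∈ leaves d m,
        p ^ m * (C * ∑ x' ∈ A, percKern a b m x x' * (ρ x * ρ x')) :=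
        sum_le_sum fun x hx => sum_le_sum fun q hq => h1 x hx q hq
    _ = _ := by
        simp only [sum_const, nsmul_eq_mul, ← mul_sum]
        rw [← card_leaves_mul_pow (d := d), pairing]
        ring

/-- Second moment method: for every configuration mass² ≤ capacity · energy. The weights have
expected mass M and expected energy at most C M / R. -/
theorem rcap_percKern_le (ha : 0 < a) (hab : a < b) (hbd : b < d) :
    ∃ C : ℝ, 0 < C ∧ ∀ (m : ℕ) (A : Finset (Fin d → ℤ)), A.Nonempty →
      ((2 : ℝ) ^ m) ^ (b - a) * rcap (percKern a b m) A ≤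
        C * bernE (cubes d m) ((2 : ℝ) ^ (b - a - d)) (fun T => rcap (kern b) (percSum A m T)) := by
  obtain ⟨C, hC, h⟩ := bernE_leafWeight_energy_le (d := d) ha hab hbd
  refine ⟨C, hC, fun m A hA => ?_⟩
  obtain ⟨hp0, hp1⟩ := two_rpow_neg_mem (d := d) (a := a) ha hbd
  have hEs := fun f => bernE_const_mul (F := cubes d m) (p := (2 : ℝ) ^ (b - a - d)) f
  have hEsub := fun G hG => bernE_subset (F := cubes d m) (p := (2 : ℝ) ^ (b - a - d)) (G := G) hG
  set p := (2 : ℝ) ^ (b - a - d) with hp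
  obtain ⟨hc, ρ, hρ0, -, hρ1, hρ, -, -⟩ :=
    exists_equilibrium_rcap (percKern_pos a b m) (percKern_comm a b m) hA
  have hE := h m A ρ hρ0
  rw [hρ] at hE
  set R := rcap (percKern a b m) A with hR
  set M := ((2 : ℝ) ^ m) ^ (b - a) with hM
  have hM0 : 0 < M := by positivity
  set u : (Fin d → ℤ) × (Fin d → ℕ) → Fin d → ℤ := fun i => i.1 + pos m i.2
  set J := A ×ˢ leaves d m with hJ
  -- With this s the energy term has expectation at most M, half of the 2 M on the left.
  set s := C * R⁻¹ with hs
  have hs0 : 0 < s := by positivity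
  have hpt : ∀ T, 2 * ∑ i ∈ J, leafWeight ρ m T i ≤ s * rcap (kern b) (percSum A m T) +
      s⁻¹ * pairing J (fun i j => kern b (u i) (u j)) (leafWeight ρ m T) (leafWeight ρ m T) := by
    intro T
    have h1 := sq_sum_le_rcap_mul_of_map (kern_pos b) (kern_comm b) (J := J) (u := u)
      (B := percSum A m T) (leafWeight_nonneg hρ0 m T) (fun i hi hne => by
        refine mem_image_of_mem _ (mem_filter.2 ⟨hi, ?_⟩)
        by_contra hT
        exact hne (by simp [leafWeight, hT]))
    set x := rcap (kern b) (percSum A m T)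
    set y := pairing J (fun i j => kern b (u i) (u j)) (leafWeight ρ m T) (leafWeight ρ m T)
    have hx : 0 ≤ x := rcap_nonneg (kern_pos b) (kern_comm b) _
    have hy : 0 ≤ y := pairing_nonneg (fun i j => (kern_pos b _ _).le)
      (leafWeight_nonneg hρ0 m T) (leafWeight_nonneg hρ0 m T)
    refine abs_le_of_sq_le_sq' (b := s * x + s⁻¹ * y) ?_ (by positivity) |>.2
    have h2 : x * y = (s * x) * (s⁻¹ * y) := by field_simp
    nlinarith [sq_nonneg (s * x - s⁻¹ * y)]
  have hEM : bernE (cubes d m) p (fun T => ∑ i ∈ J, leafWeight ρ m T i) = M := by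
    rw [bernE_sum]
    have e : ∀ i ∈ J, bernE (cubes d m) p (fun T => leafWeight ρ m T i) = ρ i.1 * p ^ m := by
      intro i hi
      unfold leafWeight
      rw [hEs, hEsub _ (anc_subset_cubes (mem_product.1 hi).2), card_anc]
    rw [sum_congr rfl e, hJ, sum_product, hM, ← card_leaves_mul_pow (d := d)]
    simp only [sum_const, nsmul_eq_mul]
    rw [← mul_sum, ← sum_mul, hρ1, one_mul]
  have h3 : 2 * M ≤ s * bernE (cubes d m) p (fun T => rcap (kern b) (percSum A m T)) +
      s⁻¹ * (C * (M * R⁻¹)) := by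
    refine le_trans ?_ (add_le_add_right (mul_le_mul_of_nonneg_left hE (by positivity)) _)
    rw [← hEM, ← hEs, ← hEs, ← hEs, ← bernE_add]
    exact bernE_mono hp0 hp1 fun T _ => hpt T
  have h4 : s⁻¹ * (C * (M * R⁻¹)) = M := by
    rw [hs]; field_simp
  rw [h4, hs] at h3
  have h5 : M ≤ C * R⁻¹ * bernE (cubes d m) p (fun T => rcap (kern b) (percSum A m T)) := by
    linarith
  calc M * R ≤ C * R⁻¹ * bernE (cubes d m) p (fun T => rcap (kern b) (percSum A m T)) * R := by
        gcongr
    _ = _ := by field_simp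

/-- The potential of ρ is at least 1/R at every point of A, so the conditional expectation of the
potential of the weights is at least of order 1/R at any kept leaf. Testing the random equilibrium
measure against the weights thus gives at least X/R, up to a constant, while energy bounds limit the
same quantity from above. -/
theorem bernE_rcap_le (ha : 0 < a) (hab : a < b) (hbd : b < d) :
    ∃ C : ℝ, 0 < C ∧ ∀ (m : ℕ) (A : Finset (Fin d → ℤ)), A.Nonempty →
      bernE (cubes d m) ((2 : ℝ) ^ (b - a - d)) (fun T => rcap (kern b) (percSum A m T)) ≤
        C * (((2 : ℝ) ^ m) ^ (b - a) * rcap (percKern a b m) A) := by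
  obtain ⟨C₂, hC₂, hup⟩ := bernE_leafWeight_energy_le (d := d) ha hab hbd
  obtain ⟨c₁, hc₁, hlow⟩ := le_sum_path_kern (d := d) ha hab hbd
  obtain ⟨C₁, hC₁, hbox⟩ := boxKern_le (d := d) (ha.trans hab)
  have hbox' := le_boxKern (d := d) (ha.trans hab)
  set c := 2 ^ (-b) * c₁ with hc
  have hc0 : 0 < c := by positivity
  refine ⟨16 * C₁ ^ 2 * C₂ / c ^ 2, by positivity, fun m A hA => ?_⟩
  obtain ⟨hp0, hp1⟩ := two_rpow_neg_mem (d := d) (a := a) ha hbd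
  have hEs := fun f => bernE_const_mul (F := cubes d m) (p := (2 : ℝ) ^ (b - a - d)) f
  set p := (2 : ℝ) ^ (b - a - d) with hp
  obtain ⟨hR, ρ, hρ0, -, hρ1, hρ, -, hpot⟩ :=
    exists_equilibrium_rcap (percKern_pos a b m) (percKern_comm a b m) hA
  have hE := hup m A ρ hρ0
  rw [hρ] at hE
  set R := rcap (percKern a b m) A with hRdef
  set M := ((2 : ℝ) ^ m) ^ (b - a) with hM
  have hM0 : 0 < M := by positivity
  set u : (Fin d → ℤ) × (Fin d → ℕ) → Fin d → ℤ := fun i => i.1 + pos m i.2 with hu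
  set J := A ×ˢ leaves d m with hJ
  -- The equilibrium probability measure multiplied by the capacity: its mass and its energy both
  -- equal the capacity. It is lifted to pairs whose leaf is kept.
  have hex : ∀ T, ∃ e : (Fin d → ℤ) × (Fin d → ℕ) → ℝ, (∀ i, 0 ≤ e i) ∧
      (∀ i, e i ≠ 0 → anc m i.2 ⊆ T) ∧ ∑ i ∈ J, e i = rcap (kern b) (percSum A m T) ∧
      pairing J (fun i j => kern b (u i) (u j)) e e = rcap (kern b) (percSum A m T) := by
    intro T
    rcases (percSum A m T).eq_empty_or_nonempty with hB | hB
    · exact ⟨fun _ => 0, fun _ => le_rfl, fun _ h => absurd rfl h, by simp [hB, rcap_empty],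
        by simp [hB, rcap_empty, pairing]⟩
    obtain ⟨hX, w, hw0, -, hw1, hw, -, -⟩ :=
      exists_equilibrium_rcap (kern_pos b) (kern_comm b) hB
    set X := rcap (kern b) (percSum A m T)
    obtain ⟨f, hf0, hfJ, hf⟩ := exists_lift (J.filter fun i => anc m i.2 ⊆ T) u
      (w := fun v => X * w v) fun v => mul_nonneg hX.le (hw0 v)
    have hf' : ∀ g : (Fin d → ℤ) → ℝ, ∑ i ∈ J, f i * g (u i) =
        ∑ v ∈ percSum A m T, X * w v * g v := by
      intro g
      rw [percSum, ← hJ, ← hu, ← hf g]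
      refine (sum_subset (filter_subset _ _) fun i _ hi => ?_).symm
      rw [hfJ i hi, zero_mul]
    refine ⟨f, hf0, fun i hi => ?_, ?_, ?_⟩
    · by_contra h
      exact hi (hfJ i fun h' => h (mem_filter.1 h').2)
    · have := hf' fun _ => 1
      simpa only [mul_one, ← mul_sum, hw1] using this
    · have a1 : ∀ v, ∑ j ∈ J, kern b v (u j) * f j =
          ∑ v' ∈ percSum A m T, X * w v' * kern b v v' := by
        intro v
        rw [← hf']
        exact sum_congr rfl fun _ _ => mul_comm _ _
      calc pairing J (fun i j => kern b (u i) (u j)) f f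
          = ∑ i ∈ J, f i * ∑ j ∈ J, kern b (u i) (u j) * f j := by
            unfold pairing
            refine sum_congr rfl fun i _ => ?_
            rw [mul_sum]
            exact sum_congr rfl fun _ _ => by ring
        _ = X ^ 2 * pairing (percSum A m T) (kern b) w w := by
            simp only [a1]
            rw [hf' fun v => ∑ v' ∈ percSum A m T, X * w v' * kern b v v', pairing, mul_sum]
            refine sum_congr rfl fun v _ => ?_
            rw [mul_sum, mul_sum]
            exact sum_congr rfl fun _ _ => by ring
        _ = X := by rw [hw]; field_simp
  choose e he0 heT he1 heE using hex
  set X := bernE (cubes d m) p (fun T => rcap (kern b) (percSum A m T)) with hXdef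
  have hX0 : 0 ≤ X := bernE_nonneg hp0 hp1 fun T _ => rcap_nonneg (kern_pos b) (kern_comm b) _
  set κ : (Fin d → ℤ) × (Fin d → ℕ) → (Fin d → ℤ) × (Fin d → ℕ) → ℝ :=
    fun i j => boxKern b (u i) (u j) with hκ
  have hκ0 : ∀ i j, 0 ≤ κ i j := fun i j => boxKern_nonneg b _ _
  have hκs : ∀ i j, κ i j = κ j i := fun i j => boxKern_comm b _ _
  have hκC : ∀ i j, κ i j ≤ C₁ * kern b (u i) (u j) := fun i j => hbox _ _
  have hpsd : ∀ f, 0 ≤ pairing J κ f f := boxKern_posSemidef (ha.trans hab) J u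
  have hz0 := leafWeight_nonneg hρ0 m
  set r : (Fin d → ℤ) × (Fin d → ℕ) → (Fin d → ℤ) × (Fin d → ℕ) → ℝ :=
    fun i j => ρ j.1 * p ^ #(anc m j.2 \ anc m i.2) with hr
  have hr0 : ∀ i j, 0 ≤ r i j := fun i j => mul_nonneg (hρ0 _) (by positivity)
  have hcond : ∀ (S : Set (ℕ × (Fin d → ℕ))) (i j : (Fin d → ℤ) × (Fin d → ℕ)), j ∈ J →
      (∀ c ∈ anc m i.2, c ∈ S) → (∀ c ∈ anc m j.2, c ∈ S → c ∈ anc m i.2) → ∀ T, e T i ≠ 0 →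
      r i j ≤ bernCond (cubes d m) p S (fun T => leafWeight ρ m T j) T := by
    intro S i j hj h1 h2 T hT
    have h3 := pow_le_bernCond_subset hp0 hp1 (anc_subset_cubes (mem_product.1 hj).2)
      (heT T i hT) h1 h2
    unfold leafWeight bernCond
    rw [hEs]
    exact mul_le_mul_of_nonneg_left h3 (hρ0 _)
  -- Depth-first exploration controls the pairs whose second leaf comes later; the reversed
  -- exploration `hbwd` controls the others. Ties are counted in both, which is harmless because the
  -- terms are nonnegative.
  have hfwd := fun s => sum_le_of_adapted (J := J) (κ := κ) (F := cubes d m) hp0 hp1 hκ0 hκs hpsd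
    (t := fun i => (code m i.2 : ℤ)) (S := fun i => before m i.2) (e := e)
    (z := leafWeight ρ m) (r := r) (fun i j h => before_mono (by exact_mod_cast h)) he0 hz0
    (fun i hi j hj hij => hcond _ i j hj (anc_subset_before m i.2)
      (mem_anc_of_mem_before (mem_product.1 hi).2 (mem_product.1 hj).2 (by exact_mod_cast hij)))
    (s := s)
  have hbwd := fun s => sum_le_of_adapted (J := J) (κ := κ) (F := cubes d m) hp0 hp1 hκ0 hκs hpsd
    (t := fun i => -(code m i.2 : ℤ)) (S := fun i => after m i.2) (e := e)
    (z := leafWeight ρ m) (r := r)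
    (fun i j h => after_mono (by exact_mod_cast neg_le_neg_iff.1 h)) he0 hz0
    (fun i hi j hj hij => hcond _ i j hj (anc_subset_after m i.2)
      (mem_anc_of_mem_after (mem_product.1 hi).2 (mem_product.1 hj).2
        (by exact_mod_cast neg_le_neg_iff.1 hij)))
    (s := s)
  have hEe : bernE (cubes d m) p (fun T => pairing J κ (e T) (e T)) ≤ C₁ * X := by
    rw [hXdef, ← hEs]
    refine bernE_mono hp0 hp1 fun T _ => ?_
    rw [← heE T, ← pairing_const_mul]
    exact pairing_mono (fun i _ j _ => hκC i j) (he0 T) (he0 T)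
  have hEz : bernE (cubes d m) p (fun T => pairing J κ (leafWeight ρ m T) (leafWeight ρ m T)) ≤
      C₁ * (C₂ * (M * R⁻¹)) := by
    refine le_trans ?_ (mul_le_mul_of_nonneg_left hE hC₁.le)
    rw [← hEs]
    refine bernE_mono hp0 hp1 fun T _ => ?_
    rw [← pairing_const_mul]
    exact pairing_mono (fun i _ j _ => hκC i j) (hz0 T) (hz0 T)
  set ε : (Fin d → ℤ) × (Fin d → ℕ) → ℝ := fun i => bernE (cubes d m) p (fun T => e T i) with hε
  have hε0 : ∀ i, 0 ≤ ε i := fun i => bernE_nonneg hp0 hp1 fun T _ => he0 T i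
  have hεX : ∑ i ∈ J, ε i = X := by
    rw [hε, ← bernE_sum]
    exact bernE_congr fun T _ => he1 T
  have hL : c * R⁻¹ * X ≤ ∑ i ∈ J, ∑ j ∈ J, κ i j * r i j * ε i := by
    rw [← hεX, mul_sum]
    refine sum_le_sum fun i hi => ?_
    rw [← sum_mul]
    refine mul_le_mul_of_nonneg_right ?_ (hε0 i)
    have hi' := mem_product.1 hi
    have h1 := hpot i.1 hi'.1
    calc c * R⁻¹ ≤ c * ∑ y ∈ A, percKern a b m i.1 y * ρ y := by gcongr
      _ = ∑ y ∈ A, 2 ^ (-b) * ρ y * (c₁ * percKern a b m i.1 y) := by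
          rw [mul_sum]; exact sum_congr rfl fun _ _ => by rw [hc]; ring
      _ ≤ ∑ y ∈ A, 2 ^ (-b) * ρ y * ∑ q' ∈ leaves d m, p ^ #(anc m q' \ anc m i.2) *
            kern b (i.1 + pos m i.2) (y + pos m q') := by
          refine sum_le_sum fun y _ => mul_le_mul_of_nonneg_left (hlow m i.1 y i.2 hi'.2) ?_
          exact mul_nonneg (by positivity) (hρ0 y)
      _ ≤ ∑ y ∈ A, ∑ q' ∈ leaves d m, κ i (y, q') * r i (y, q') := by
          refine sum_le_sum fun y _ => ?_
          rw [mul_sum]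
          refine sum_le_sum fun q' _ => ?_
          calc _ = 2 ^ (-b) * kern b (i.1 + pos m i.2) (y + pos m q') *
                (ρ y * p ^ #(anc m q' \ anc m i.2)) := by ring
            _ ≤ _ := mul_le_mul_of_nonneg_right (hbox' _ _) (hr0 i (y, q'))
      _ = _ := by rw [hJ, sum_product]
  have hsplit : ∑ i ∈ J, ∑ j ∈ J, κ i j * r i j * ε i ≤
      ∑ i ∈ J, ∑ j ∈ J, (if (code m i.2 : ℤ) ≤ code m j.2 then κ i j * r i j * ε i else 0) +
      ∑ i ∈ J, ∑ j ∈ J, (if -(code m i.2 : ℤ) ≤ -(code m j.2 : ℤ) then κ i j * r i j * ε i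
        else 0) := by
    simp only [← sum_add_distrib]
    refine sum_le_sum fun i _ => sum_le_sum fun j _ => ?_
    have h0 : 0 ≤ κ i j * r i j * ε i := mul_nonneg (mul_nonneg (hκ0 i j) (hr0 i j)) (hε0 i)
    split_ifs with h1 h2 h2
    · linarith
    · linarith
    · linarith
    · omega
  have hmain : ∀ s : ℝ, 0 < s → c * R⁻¹ * X ≤ 4 * s * (C₁ * X) + s⁻¹ * (C₁ * (C₂ * (M * R⁻¹))) := by
    intro s hs
    have h1 := hfwd s hs
    have h2 := hbwd s hs
    have h3 := mul_le_mul_of_nonneg_left hEe hs.le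
    have h4 := mul_le_mul_of_nonneg_left hEz (inv_nonneg.2 hs.le)
    linarith
  -- Chosen so that the X term on the right is exactly half of the left side and can be absorbed.
  have h := hmain (c * R⁻¹ / (8 * C₁)) (by positivity)
  have e1 : 4 * (c * R⁻¹ / (8 * C₁)) * (C₁ * X) = c * R⁻¹ * X / 2 := by field_simp; ring
  have e2 : (c * R⁻¹ / (8 * C₁))⁻¹ * (C₁ * (C₂ * (M * R⁻¹))) = 8 * C₁ ^ 2 * C₂ / c * M := by
    field_simp
  rw [e1, e2] at h
  have h5 : c * R⁻¹ * X ≤ 16 * C₁ ^ 2 * C₂ / c * M := by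
    have e3 : 16 * C₁ ^ 2 * C₂ / c * M = 2 * (8 * C₁ ^ 2 * C₂ / c * M) := by ring
    rw [e3]; linarith
  calc X = (R / c) * (c * R⁻¹ * X) := by field_simp
    _ ≤ (R / c) * (16 * C₁ ^ 2 * C₂ / c * M) := by gcongr
    _ = _ := by field_simp

end Percolation

end RealCapacity

end FractalPercolation

namespace FractalPercolation

/-! ### The percolation law restricted to finitely many cubes -/

section Law

open Finset
open scoped Classical

variable {ι : Type*}

theorem setBernoulli_inter_eq [DecidableEq ι] (F T : Finset ι) (p : I) :
    setBernoulli (Set.univ : Set ι) p {ω | ∀ c ∈ F, c ∈ ω ↔ c ∈ T} =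
      ENNReal.ofReal (bernWt F p T) := by
  have e : (fun q : ι → Prop => {i | q i}) ⁻¹' {ω : Set ι | ∀ c ∈ F, c ∈ ω ↔ c ∈ T} =
      Set.pi (F : Set ι) fun c => {P : Prop | P ↔ c ∈ T} := by
    ext q
    simp
  rw [setBernoulli_apply', e, Measure.infinitePi_pi _ (fun _ _ => MeasurableSet.of_discrete),
    bernWt, ENNReal.ofReal_prod_of_nonneg]
  · refine prod_congr rfl fun c _ => ?_
    have hp : ((unitInterval.toNNReal p : NNReal) : ℝ≥0∞) = ENNReal.ofReal p := by
      rw [ENNReal.ofReal, Real.toNNReal_of_nonneg p.2.1]; rfl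
    have hq : ((unitInterval.toNNReal (σ p) : NNReal) : ℝ≥0∞) = ENNReal.ofReal (1 - p) := by
      rw [ENNReal.ofReal, Real.toNNReal_of_nonneg (sub_nonneg.2 p.2.2)]; rfl
    simp only [Measure.coe_add, Pi.add_apply, Measure.smul_apply, Measure.dirac_apply,
      ENNReal.smul_def, smul_eq_mul, hp, hq]
    by_cases hc : c ∈ T <;> simp [hc]
  · intro c _
    have h0 := p.2.1
    have h1 := p.2.2
    split_ifs <;> linarith

theorem measurableSet_inter_eq (F T : Finset ι) :
    MeasurableSet {ω : Set ι | ∀ c ∈ F, c ∈ ω ↔ c ∈ T} := by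
  have : {ω : Set ι | ∀ c ∈ F, c ∈ ω ↔ c ∈ T} = ⋂ c ∈ F, {ω | c ∈ ω ↔ c ∈ T} := by
    ext; simp
  rw [this]
  refine Finset.measurableSet_biInter _ fun c _ => ?_
  by_cases hc : c ∈ T
  · simpa [hc] using measurable_set_mem c
  · simpa [hc] using (measurable_set_mem c).not

theorem apply_filter_eq_sum (F : Finset ι) (f : Finset ι → ℝ≥0∞) (ω : Set ι) :
    f (F.filter (· ∈ ω)) = ∑ T ∈ F.powerset,
      {ω : Set ι | ∀ c ∈ F, c ∈ ω ↔ c ∈ T}.indicator (fun _ => f T) ω := by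
  rw [sum_eq_single (F.filter (· ∈ ω))]
  · rw [Set.indicator_of_mem]
    intro c hc
    simp [hc]
  · intro T hT hne
    refine Set.indicator_of_notMem (fun h => hne ?_) _
    ext c
    rw [mem_filter]
    constructor
    · intro hc
      exact ⟨mem_powerset.1 hT hc, (h c (mem_powerset.1 hT hc)).2 hc⟩
    · intro hc
      exact (h c hc.1).1 hc.2
  · intro h
    exact absurd (mem_powerset.2 (filter_subset _ _)) h

theorem measurable_apply_filter (F : Finset ι) (f : Finset ι → ℝ≥0∞) :
    Measurable fun ω : Set ι => f (F.filter (· ∈ ω)) := by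
  simp only [apply_filter_eq_sum F f]
  exact Finset.measurable_sum _ fun T _ => measurable_const.indicator (measurableSet_inter_eq F T)

theorem lintegral_setBernoulli [DecidableEq ι] (F : Finset ι) (p : I) {f : Finset ι → ℝ} (hf : ∀ T, 0 ≤ f T) :
    ∫⁻ ω, ENNReal.ofReal (f (F.filter (· ∈ ω))) ∂(setBernoulli (Set.univ : Set ι) p) =
      ENNReal.ofReal (bernE F p f) := by
  simp only [apply_filter_eq_sum F fun T => ENNReal.ofReal (f T)]
  rw [lintegral_finsetSum _ fun T _ => measurable_const.indicator (measurableSet_inter_eq F T),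
    bernE, ENNReal.ofReal_sum_of_nonneg fun T _ => mul_nonneg (bernWt_nonneg p.2.1 p.2.2 T) (hf T)]
  refine sum_congr rfl fun T _ => ?_
  rw [lintegral_indicator_const (measurableSet_inter_eq F T), setBernoulli_inter_eq, mul_comm,
    ENNReal.ofReal_mul (bernWt_nonneg p.2.1 p.2.2 T)]

end Law

/-! ### Identification of the lattice capacity with the finite real capacity -/

section LatticeCapacity

open Finset

variable {d : ℕ}

/-- The truncated Riesz kernel of the lattice for the Euclidean distance. -/
noncomputable def euclKern (β : ℝ) (x y : Fin d → ℤ) : ℝ :=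
  max (dist (latticePoint x) (latticePoint y)) 1 ^ (-β)

theorem euclKern_pos (β : ℝ) (x y : Fin d → ℤ) : 0 < euclKern β x y :=
  Real.rpow_pos_of_pos (lt_max_of_lt_right one_pos) _

theorem euclKern_comm (β : ℝ) (x y : Fin d → ℤ) : euclKern β x y = euclKern β y x := by
  rw [euclKern, euclKern, dist_comm]

theorem ofReal_euclKern (β : ℝ) (x y : Fin d → ℤ) :
    max (edist (latticePoint x) (latticePoint y)) 1 ^ (-β) = ENNReal.ofReal (euclKern β x y) := by
  rw [euclKern, ← ENNReal.ofReal_rpow_of_pos (lt_max_of_lt_right one_pos), ENNReal.ofReal_max,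
    ENNReal.ofReal_one, edist_dist]

theorem dist_latticePoint_coord (x y : Fin d → ℤ) (i : Fin d) :
    dist ((latticePoint x) i) ((latticePoint y) i) = dist (x i) (y i) := by
  simp [latticePoint, Int.dist_eq, Real.dist_eq]

theorem dist_le_dist_latticePoint (x y : Fin d → ℤ) :
    dist x y ≤ dist (latticePoint x) (latticePoint y) := by
  refine (dist_pi_le_iff dist_nonneg).2 fun i => ?_
  rw [← dist_latticePoint_coord, EuclideanSpace.dist_eq]
  refine Real.le_sqrt_of_sq_le ?_
  exact single_le_sum (f := fun i => dist ((latticePoint x) i) ((latticePoint y) i) ^ 2)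
    (fun _ _ => sq_nonneg _) (mem_univ i)

theorem dist_latticePoint_le (x y : Fin d → ℤ) :
    dist (latticePoint x) (latticePoint y) ≤ (d + 1) * dist x y := by
  rw [EuclideanSpace.dist_eq]
  refine Real.sqrt_le_iff.2 ⟨by positivity, ?_⟩
  calc ∑ i, dist ((latticePoint x) i) ((latticePoint y) i) ^ 2 ≤ ∑ _i : Fin d, dist x y ^ 2 := by
        refine sum_le_sum fun i _ => ?_
        rw [dist_latticePoint_coord]
        exact pow_le_pow_left₀ dist_nonneg (dist_le_pi_dist x y i) 2
    _ = d * dist x y ^ 2 := by simp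
    _ ≤ (d + 1) ^ 2 * dist x y ^ 2 := by
        have : (0 : ℝ) ≤ d := Nat.cast_nonneg d
        gcongr
        nlinarith
    _ = _ := by ring

theorem euclKern_le {β : ℝ} (hβ : 0 < β) (x y : Fin d → ℤ) : euclKern β x y ≤ kern β x y :=
  Real.rpow_le_rpow_of_nonpos (lt_max_of_lt_right one_pos)
    (max_le_max (dist_le_dist_latticePoint x y) le_rfl) (by linarith)

theorem kern_le_euclKern {β : ℝ} (hβ : 0 < β) (x y : Fin d → ℤ) :
    kern β x y ≤ ((d : ℝ) + 1) ^ β * euclKern β x y := by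
  have hd : (1 : ℝ) ≤ d + 1 := by linarith [(Nat.cast_nonneg d : (0 : ℝ) ≤ d)]
  have h1 : 0 < max (dist x y) 1 := lt_max_of_lt_right one_pos
  have h2 : max (dist (latticePoint x) (latticePoint y)) 1 ≤ ((d : ℝ) + 1) * max (dist x y) 1 := by
    refine max_le ((dist_latticePoint_le x y).trans ?_) ?_
    · gcongr; exact le_max_left _ _
    · have := le_max_right (dist x y) 1
      nlinarith
  have h3 := Real.rpow_le_rpow_of_nonpos (z := -β) (lt_max_of_lt_right one_pos) h2 (by linarith)
  rw [Real.mul_rpow (by linarith) h1.le, Real.rpow_neg (by linarith)] at h3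
  have h4 : (0 : ℝ) < (d + 1) ^ β := by positivity
  rw [inv_mul_le_iff₀ h4] at h3
  exact h3

theorem rcap_kern_le {β : ℝ} (hβ : 0 < β) (B : Finset (Fin d → ℤ)) :
    rcap (kern β) B ≤ rcap (euclKern β) B := by
  simpa using rcap_le_of_kernel_le (euclKern_pos β) (euclKern_comm β) (kern_pos β) (kern_comm β)
    (C := 1) (B := B) fun x _ y _ => by simpa using euclKern_le hβ x y

theorem rcap_euclKern_le {β : ℝ} (hβ : 0 < β) (B : Finset (Fin d → ℤ)) :
    rcap (euclKern β) B ≤ ((d : ℝ) + 1) ^ β * rcap (kern β) B :=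
  rcap_le_of_kernel_le (kern_pos β) (kern_comm β) (euclKern_pos β) (euclKern_comm β)
    fun x _ y _ => kern_le_euclKern hβ x y

theorem lattice_energy_eq (β : ℝ) {B : Finset (Fin d → ℤ)} {μ : (Fin d → ℤ) → ℝ≥0∞}
    {w : (Fin d → ℤ) → ℝ} (hw : ∀ x, 0 ≤ w x) (hB : ∀ x ∉ B, w x = 0)
    (hμ : ∀ x, μ x = ENNReal.ofReal (w x)) :
    ∑' x, ∑' y, μ x * μ y * max (edist (latticePoint x) (latticePoint y)) 1 ^ (-β) =
      ENNReal.ofReal (pairing B (euclKern β) w w) := by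
  have hzero : ∀ x ∉ B, μ x = 0 := fun x hx => by rw [hμ, hB x hx, ENNReal.ofReal_zero]
  rw [tsum_eq_sum (s := B) fun x hx => by simp [hzero x hx], pairing,
    ENNReal.ofReal_sum_of_nonneg fun x _ => sum_nonneg fun y _ =>
      mul_nonneg (euclKern_pos β x y).le (mul_nonneg (hw x) (hw y))]
  refine sum_congr rfl fun x _ => ?_
  rw [tsum_eq_sum (s := B) fun y hy => by simp [hzero y hy],
    ENNReal.ofReal_sum_of_nonneg fun y _ =>
      mul_nonneg (euclKern_pos β x y).le (mul_nonneg (hw x) (hw y))]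
  refine sum_congr rfl fun y _ => ?_
  rw [ofReal_euclKern, hμ, hμ, ← ENNReal.ofReal_mul (hw x),
    ← ENNReal.ofReal_mul (mul_nonneg (hw x) (hw y)), mul_comm]

/-- Probability mass functions supported in B correspond to nonnegative weights of sum one on B,
with the same energy, and the equilibrium weight attains the infimum. -/
theorem latticeCap_coe (β : ℝ) (B : Finset (Fin d → ℤ)) :
    latticeCap β (B : Set (Fin d → ℤ)) = ENNReal.ofReal (rcap (euclKern β) B) := by
  rcases B.eq_empty_or_nonempty with rfl | hB
  · have : ∀ μ : PMF (Fin d → ℤ), ¬ μ.support ⊆ ∅ := fun μ h =>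
      μ.support_nonempty.ne_empty (Set.subset_empty_iff.1 h)
    simp [latticeCap, this, rcap_empty]
  · obtain ⟨hc, ρ, h0, hsupp, h1, hρ, hmin, -⟩ :=
      exists_equilibrium_rcap (euclKern_pos β) (euclKern_comm β) hB
    rw [latticeCap, ← inv_inv (ENNReal.ofReal _), ← ENNReal.ofReal_inv_of_pos hc]
    congr 1
    refine le_antisymm ?_ (le_iInf₂ fun μ hμ => ?_)
    · have hsum : ∑ x ∈ B, ENNReal.ofReal (ρ x) = 1 := by
        rw [← ENNReal.ofReal_sum_of_nonneg fun x _ => h0 x, h1, ENNReal.ofReal_one]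
      refine (iInf₂_le (PMF.ofFinset (fun x => ENNReal.ofReal (ρ x)) B hsum
        fun x hx => by simp [hsupp x hx]) ?_).trans ?_
      · intro x hx
        by_contra h
        rw [PMF.mem_support_iff] at hx
        exact hx (PMF.ofFinset_apply_of_notMem _ _ h)
      · rw [lattice_energy_eq β h0 hsupp fun x => PMF.ofFinset_apply _ _ x, hρ]
    · have hz : ∀ x ∉ B, μ x = 0 := fun x hx => by
        by_contra h
        exact hx (mem_coe.1 (hμ ((PMF.mem_support_iff _ _).2 h)))
      have hsum : ∑ x ∈ B, (μ x).toReal = 1 := by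
        rw [← ENNReal.toReal_sum fun x _ => μ.apply_ne_top x, ← tsum_eq_sum (L := .unconditional _) fun x hx => hz x hx,
          μ.tsum_coe, ENNReal.toReal_one]
      rw [lattice_energy_eq β (B := B) (w := fun x => (μ x).toReal) (fun x => ENNReal.toReal_nonneg)
        (fun x hx => by simp [hz x hx]) fun x => (ENNReal.ofReal_toReal (μ.apply_ne_top x)).symm]
      exact ENNReal.ofReal_le_ofReal (hmin _ (fun x => ENNReal.toReal_nonneg) hsum)

end LatticeCapacity

/-! ### The discrete estimates -/

section Discrete

open Finset
open scoped Classical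

variable {d : ℕ} {a b : ℝ}

theorem coe_percSum {m : ℕ} (hm : 1 ≤ m) (A : Finset (Fin d → ℤ)) (ω : Config d) :
    (percSum A m ((cubes d m).filter (· ∈ ω)) : Set (Fin d → ℤ)) = ↑A + discretePerc m ω := by
  rw [discretePerc_eq hm]
  ext v
  simp only [percSum, coe_image, coe_filter, mem_product, Set.mem_image, Set.mem_ofPred_eq,
    Set.mem_add, mem_coe, Prod.exists, mem_remaining_iff]
  constructor
  · rintro ⟨x, q, ⟨⟨hx, hq⟩, h⟩, rfl⟩
    exact ⟨x, hx, _, ⟨q, ⟨hq, fun c hc => (mem_filter.1 (h hc)).2⟩, rfl⟩, rfl⟩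
  · rintro ⟨x, hx, _, ⟨q, ⟨hq, h⟩, rfl⟩, rfl⟩
    exact ⟨x, q, ⟨⟨hx, hq⟩, fun c hc => mem_filter.2 ⟨anc_subset_cubes hq hc, h c hc⟩⟩, rfl⟩

theorem lintegral_latticeCap (ha : 0 < a) (hbd : b < d) {m : ℕ} (hm : 1 ≤ m)
    (A : Finset (Fin d → ℤ)) :
    ∫⁻ ω, latticeCap b ((A : Set (Fin d → ℤ)) + discretePerc m ω)
        ∂(percLaw d ⟨2 ^ (b - a - d), two_rpow_mem ha hbd⟩) =
      ENNReal.ofReal (bernE (cubes d m) (2 ^ (b - a - d))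
        fun T => rcap (euclKern b) (percSum A m T)) := by
  simp only [← coe_percSum hm, latticeCap_coe]
  exact lintegral_setBernoulli (cubes d m) ⟨2 ^ (b - a - d), two_rpow_mem ha hbd⟩
    (f := fun T => rcap (euclKern b) (percSum A m T))
    fun T => rcap_nonneg (euclKern_pos b) (euclKern_comm b) _

theorem latticeCap_pos_lt_top (β : ℝ) {A : Set (Fin d → ℤ)} (hA : A.Finite) (hne : A.Nonempty) :
    latticeCap β A ≠ 0 ∧ latticeCap β A ≠ ⊤ := by
  lift A to Finset (Fin d → ℤ) using hA
  rw [latticeCap_coe]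
  exact ⟨(ENNReal.ofReal_pos.2 (exists_equilibrium_rcap (euclKern_pos β) (euclKern_comm β)
    (coe_nonempty.1 hne)).1).ne', ENNReal.ofReal_ne_top⟩

theorem latticeCap_le_lintegral (ha : 0 < a) (hab : a < b) (hbd : b < d) :
    ∃ C : ℝ, 0 < C ∧ ∀ A : Set (Fin d → ℤ), A.Finite → A.Nonempty → ∀ m : ℕ, 1 ≤ m →
      latticeCap a A ≤ ENNReal.ofReal (C * 2 ^ ((a - b) * (m : ℝ))) *
        ∫⁻ ω, latticeCap b (A + discretePerc m ω)
          ∂(percLaw d ⟨2 ^ (b - a - d), two_rpow_mem ha hbd⟩) := by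
  obtain ⟨C, hC, h⟩ := rcap_percKern_le (d := d) ha hab hbd
  obtain ⟨C', hC', h'⟩ := percKern_le (d := d) ha hab
  obtain ⟨hp0, hp1⟩ := two_rpow_neg_mem (d := d) (a := a) ha hbd
  refine ⟨((d : ℝ) + 1) ^ a * C' * C, by positivity, fun A hA hne m hm => ?_⟩
  lift A to Finset (Fin d → ℤ) using hA
  rw [lintegral_latticeCap ha hbd hm, latticeCap_coe, ← ENNReal.ofReal_mul (by positivity)]
  refine ENNReal.ofReal_le_ofReal ?_
  have h1 := rcap_euclKern_le ha A
  have h2 := rcap_le_of_kernel_le (percKern_pos a b m) (percKern_comm a b m) (kern_pos a)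
    (kern_comm a) (C := C') (B := A) fun x _ y _ => h' m x y
  have h3 := h m A (coe_nonempty.1 hne)
  have h4 : bernE (cubes d m) (2 ^ (b - a - d)) (fun T => rcap (kern b) (percSum A m T)) ≤
      bernE (cubes d m) (2 ^ (b - a - d)) (fun T => rcap (euclKern b) (percSum A m T)) :=
    bernE_mono hp0 hp1 fun T _ => rcap_kern_le (ha.trans hab) _
  have e : (2 : ℝ) ^ ((a - b) * (m : ℝ)) * ((2 : ℝ) ^ m) ^ (b - a) = 1 := by
    rw [two_pow_rpow, ← Real.rpow_natCast, ← Real.rpow_mul (by norm_num),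
      ← Real.rpow_add (by norm_num)]
    ring_nf
    simp
  set E := bernE (cubes d m) (2 ^ (b - a - d)) (fun T => rcap (euclKern b) (percSum A m T))
  set R := rcap (percKern a b m) A
  calc rcap (euclKern a) A ≤ ((d : ℝ) + 1) ^ a * (C' * R) := h1.trans (by gcongr)
    _ = ((d : ℝ) + 1) ^ a * C' * (2 ^ ((a - b) * (m : ℝ)) * (((2 : ℝ) ^ m) ^ (b - a) * R)) := by
        rw [← mul_assoc (2 ^ _), e]; ring
    _ ≤ ((d : ℝ) + 1) ^ a * C' * (2 ^ ((a - b) * (m : ℝ)) * (C * E)) := by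
        refine mul_le_mul_of_nonneg_left (mul_le_mul_of_nonneg_left ?_ (by positivity))
          (by positivity)
        exact h3.trans (mul_le_mul_of_nonneg_left h4 hC.le)
    _ = _ := by ring

/-- The factor (D/2^m)^(b-a) lost between kernels combines with M = (2^m)^(b-a) to D^(b-a). Using
any sup-distance bound D, rather than the Euclidean diameter, lets the continuum argument take D =
2^m. -/
theorem lintegral_latticeCap_le (ha : 0 < a) (hab : a < b) (hbd : b < d) :
    ∃ C : ℝ, 0 < C ∧ ∀ A : Set (Fin d → ℤ), A.Finite → A.Nonempty → ∀ m : ℕ, 1 ≤ m →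
      ∀ D : ℝ, 2 ^ m ≤ D → (∀ x ∈ A, ∀ y ∈ A, dist x y ≤ D) →
        ∫⁻ ω, latticeCap b (A + discretePerc m ω)
          ∂(percLaw d ⟨2 ^ (b - a - d), two_rpow_mem ha hbd⟩) ≤
            ENNReal.ofReal (C * D ^ (b - a)) * latticeCap a A := by
  obtain ⟨C, hC, h⟩ := bernE_rcap_le (d := d) ha hab hbd
  obtain ⟨hp0, hp1⟩ := two_rpow_neg_mem (d := d) (a := a) ha hbd
  refine ⟨((d : ℝ) + 1) ^ b * C * 2 ^ b, by positivity, fun A hA hne m hm D hD hAD => ?_⟩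
  lift A to Finset (Fin d → ℤ) using hA
  have h2m : (0 : ℝ) < 2 ^ m := by positivity
  have hD0 : 0 < D := h2m.trans_le hD
  rw [lintegral_latticeCap ha hbd hm, latticeCap_coe, ← ENNReal.ofReal_mul (by positivity)]
  refine ENNReal.ofReal_le_ofReal ?_
  have h1 := rcap_kern_le ha A
  have h2 := rcap_le_of_kernel_le (kern_pos a) (kern_comm a) (percKern_pos a b m)
    (percKern_comm a b m) (C := 2 ^ b * (D / 2 ^ m) ^ (b - a)) (B := A) fun x hx y hy => by
      have h5 := le_percKern ha hab m hD (hAD x hx y hy)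
      rw [Real.rpow_neg (by norm_num), ← neg_sub b a, Real.rpow_neg (by positivity),
        ← mul_inv, inv_mul_le_iff₀ (by positivity)] at h5
      exact h5
  have h3 := h m A (coe_nonempty.1 hne)
  have h4 : bernE (cubes d m) (2 ^ (b - a - d)) (fun T => rcap (euclKern b) (percSum A m T)) ≤
      ((d : ℝ) + 1) ^ b *
        bernE (cubes d m) (2 ^ (b - a - d)) (fun T => rcap (kern b) (percSum A m T)) := by
    rw [← bernE_const_mul]
    exact bernE_mono hp0 hp1 fun T _ => rcap_euclKern_le (ha.trans hab) _
  have e : ((2 : ℝ) ^ m) ^ (b - a) * (D / 2 ^ m) ^ (b - a) = D ^ (b - a) := by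
    rw [← Real.mul_rpow h2m.le (by positivity), mul_div_cancel₀ _ h2m.ne']
  calc _ ≤ ((d : ℝ) + 1) ^ b * (C * (((2 : ℝ) ^ m) ^ (b - a) *
        (2 ^ b * (D / 2 ^ m) ^ (b - a) * rcap (euclKern a) A))) := by
        refine h4.trans ?_
        gcongr
        refine h3.trans ?_
        gcongr
        exact h2.trans (by gcongr)
    _ = ((d : ℝ) + 1) ^ b * C * 2 ^ b * (((2 : ℝ) ^ m) ^ (b - a) * (D / 2 ^ m) ^ (b - a)) *
        rcap (euclKern a) A := by ring
    _ = _ := by rw [e]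

theorem latticeDiam_rpow (A : Set (Fin d → ℤ)) (m : ℕ) (s : ℝ) :
    (2 : ℝ) ^ (s * max (m : ℝ) (Real.logb 2 (latticeDiam A))) =
      max (2 ^ m) (latticeDiam A) ^ s := by
  have h0 : 0 ≤ latticeDiam A := Metric.diam_nonneg
  rw [mul_comm, Real.rpow_mul (by norm_num)]
  congr 1
  rcases h0.eq_or_lt with h | h
  -- For diameter zero the default value `Real.logb 2 0 = 0` agrees with the convention that the
  -- maximum is m.
  · rw [← h, Real.logb_zero, max_eq_left (Nat.cast_nonneg m), max_eq_left (by positivity),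
      Real.rpow_natCast]
  · have hmono : Monotone fun t : ℝ => (2 : ℝ) ^ t := Real.monotone_rpow_of_base_ge_one (by norm_num)
    rw [hmono.map_max]
    simp only [Real.rpow_natCast]
    rw [Real.rpow_logb (by norm_num) (by norm_num) h]

theorem discrete_bounds (ha : 0 < a) (hab : a < b) (hbd : b < d) :
    ∃ c C : ℝ, 0 < c ∧ 0 < C ∧
      ∀ (A : Set (Fin d → ℤ)), A.Finite → A.Nonempty → ∀ m : ℕ, 1 ≤ m →
        ENNReal.ofReal (c * 2 ^ ((a - b) * max (m : ℝ) (Real.logb 2 (latticeDiam A)))) ≤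
            latticeCap a A /
              ∫⁻ ω, latticeCap b (A + discretePerc m ω)
                ∂(percLaw d ⟨2 ^ (b - a - d), two_rpow_mem ha hbd⟩) ∧
        latticeCap a A /
              ∫⁻ ω, latticeCap b (A + discretePerc m ω)
                ∂(percLaw d ⟨2 ^ (b - a - d), two_rpow_mem ha hbd⟩) ≤
            ENNReal.ofReal (C * 2 ^ ((a - b) * (m : ℝ))) := by
  obtain ⟨C₁, hC₁, h₁⟩ := lintegral_latticeCap_le (d := d) ha hab hbd
  obtain ⟨C₂, hC₂, h₂⟩ := latticeCap_le_lintegral (d := d) ha hab hbd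
  refine ⟨C₁⁻¹, C₂, inv_pos.2 hC₁, hC₂, fun A hA hne m hm => ?_⟩
  set D := max (2 ^ m) (latticeDiam A) with hD
  have hD0 : 0 < D := lt_max_of_lt_left (by positivity)
  have hlow := h₂ A hA hne m hm
  have hup := h₁ A hA hne m hm D (le_max_left _ _) fun x hx y hy =>
    (dist_le_dist_latticePoint x y).trans ((Metric.dist_le_diam_of_mem (hA.image _).isBounded
      (Set.mem_image_of_mem _ hx) (Set.mem_image_of_mem _ hy)).trans (le_max_right _ _))
  obtain ⟨hL0, hLt⟩ := latticeCap_pos_lt_top a hA hne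
  set E := ∫⁻ ω, latticeCap b (A + discretePerc m ω)
    ∂(percLaw d ⟨2 ^ (b - a - d), two_rpow_mem ha hbd⟩)
  have hE0 : E ≠ 0 := fun h => hL0 (by simpa [h] using hlow)
  have hEt : E ≠ ⊤ := (hup.trans_lt (ENNReal.mul_lt_top ENNReal.ofReal_lt_top hLt.lt_top)).ne
  constructor
  · rw [latticeDiam_rpow, ENNReal.le_div_iff_mul_le (Or.inl hE0) (Or.inl hEt)]
    calc _ ≤ ENNReal.ofReal (C₁⁻¹ * D ^ (a - b)) *
          (ENNReal.ofReal (C₁ * D ^ (b - a)) * latticeCap a A) := by gcongr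
      _ = latticeCap a A := by
          rw [← mul_assoc, ← ENNReal.ofReal_mul (by positivity)]
          have : C₁⁻¹ * D ^ (a - b) * (C₁ * D ^ (b - a)) = 1 := by
            rw [← neg_sub b a, Real.rpow_neg hD0.le]
            field_simp
          rw [this, ENNReal.ofReal_one, one_mul]
  · exact ENNReal.div_le_of_le_mul hlow

end Discrete

end FractalPercolation

namespace FractalPercolation

/-! ### Truncated kernels and capacities of decreasing compact sets -/

section Continuum

open Filter Topology

variable {d : ℕ}

/-- The Riesz kernel truncated at distance `2 ^ (-m)`. -/
noncomputable def truncKern (m : ℕ) (β : ℝ) (x y : EuclideanSpace ℝ (Fin d)) : ℝ≥0∞ :=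
  max (edist x y) (2 ^ m)⁻¹ ^ (-β)

/-- The energy for the truncated Riesz kernel. -/
noncomputable def truncEnergy (m : ℕ) (β : ℝ) (μ : Measure (EuclideanSpace ℝ (Fin d))) : ℝ≥0∞ :=
  ∫⁻ x, ∫⁻ y, truncKern m β x y ∂μ ∂μ

/-- The capacity for the truncated Riesz kernel. -/
noncomputable def truncCap (m : ℕ) (β : ℝ) (K : Set (EuclideanSpace ℝ (Fin d))) : ℝ≥0∞ :=
  (⨅ (μ : ProbabilityMeasure (EuclideanSpace ℝ (Fin d)))
      (_ : (μ : Measure (EuclideanSpace ℝ (Fin d))) Kᶜ = 0),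
    truncEnergy m β (μ : Measure (EuclideanSpace ℝ (Fin d))))⁻¹

theorem rpow_neg_anti {β : ℝ} (hβ : 0 < β) {s t : ℝ≥0∞} (h : s ≤ t) : t ^ (-β) ≤ s ^ (-β) := by
  rw [ENNReal.rpow_neg, ENNReal.rpow_neg, ENNReal.inv_le_inv]
  exact ENNReal.rpow_le_rpow h hβ.le

theorem truncKern_mono {β : ℝ} (hβ : 0 < β) {m n : ℕ} (h : m ≤ n)
    (x y : EuclideanSpace ℝ (Fin d)) : truncKern m β x y ≤ truncKern n β x y := by
  refine rpow_neg_anti hβ (max_le_max le_rfl ?_)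
  rw [ENNReal.inv_le_inv]
  exact pow_le_pow_right₀ one_le_two h

theorem truncCap_anti {β : ℝ} (hβ : 0 < β) {m n : ℕ} (h : m ≤ n)
    {K K' : Set (EuclideanSpace ℝ (Fin d))} (hK : K' ⊆ K) :
    truncCap n β K' ≤ truncCap m β K := by
  rw [truncCap, truncCap, ENNReal.inv_le_inv]
  refine le_iInf₂ fun μ hμ => (iInf₂_le μ ?_).trans
    (lintegral_mono fun x => lintegral_mono fun y => truncKern_mono hβ h x y)
  exact measure_mono_null (Set.compl_subset_compl.2 hK) hμ

theorem newtonCap_mono (β : ℝ) {K K' : Set (EuclideanSpace ℝ (Fin d))} (hK : K' ⊆ K) :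
    newtonCap β K' ≤ newtonCap β K := by
  rw [newtonCap, newtonCap, ENNReal.inv_le_inv]
  exact le_iInf₂ fun μ hμ => iInf₂_le μ (measure_mono_null (Set.compl_subset_compl.2 hK) hμ)

theorem truncCap_lt_top {β : ℝ} (hβ : 0 < β) (m : ℕ) {K : Set (EuclideanSpace ℝ (Fin d))}
    (hK : Bornology.IsBounded K) : truncCap m β K < ⊤ := by
  set t : ℝ≥0∞ := max (Metric.ediam K) (2 ^ m)⁻¹ with ht
  have htop : t ≠ ⊤ := by
    refine (max_lt hK.ediam_ne_top.lt_top ?_).ne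
    exact ENNReal.inv_lt_top.2 (by positivity)
  have hpos : t ^ (-β) ≠ 0 := by
    rw [ENNReal.rpow_neg, ENNReal.inv_ne_zero]
    exact ENNReal.rpow_ne_top_of_nonneg hβ.le htop
  rw [truncCap, ENNReal.inv_lt_top]
  refine (pos_iff_ne_zero.2 hpos).trans_le (le_iInf₂ fun μ hμ => ?_)
  have hae : ∀ᵐ x ∂(μ : Measure (EuclideanSpace ℝ (Fin d))), x ∈ K := by
    rw [ae_iff]; exact hμ
  calc t ^ (-β) = ∫⁻ _x, ∫⁻ _y, t ^ (-β) ∂(μ : Measure (EuclideanSpace ℝ (Fin d)))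
        ∂(μ : Measure (EuclideanSpace ℝ (Fin d))) := by simp
    _ ≤ _ := by
        refine lintegral_mono_ae ?_
        filter_upwards [hae] with x hx
        refine lintegral_mono_ae ?_
        filter_upwards [hae] with y hy
        exact rpow_neg_anti hβ (max_le_max (Metric.edist_le_ediam_of_mem hx hy) le_rfl)

theorem measurable_truncKern (m : ℕ) (β : ℝ) : Measurable fun z : EuclideanSpace ℝ (Fin d) ×
    EuclideanSpace ℝ (Fin d) => truncKern m β z.1 z.2 := by
  unfold truncKern
  fun_prop

/-- Truncation makes the kernel bounded and continuous, and μ ↦ μ × μ is weakly continuous. -/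
theorem continuous_truncEnergy {β : ℝ} (hβ : 0 < β) (m : ℕ) :
    Continuous fun μ : ProbabilityMeasure (EuclideanSpace ℝ (Fin d)) =>
      truncEnergy m β (μ : Measure (EuclideanSpace ℝ (Fin d))) := by
  set s : NNReal := (2 ^ m)⁻¹ with hs
  have hs0 : 0 < s := by positivity
  have hpos : ∀ z : EuclideanSpace ℝ (Fin d) × EuclideanSpace ℝ (Fin d),
      0 < max (nndist z.1 z.2) s := fun z => lt_max_of_lt_right hs0
  let g : EuclideanSpace ℝ (Fin d) × EuclideanSpace ℝ (Fin d) → NNReal :=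
    fun z => max (nndist z.1 z.2) s ^ (-β)
  have hg : Continuous g := by
    refine continuous_iff_continuousAt.2 fun z => ?_
    have hc : Continuous fun z : EuclideanSpace ℝ (Fin d) × EuclideanSpace ℝ (Fin d) =>
        max (nndist z.1 z.2) s := by fun_prop
    exact ContinuousAt.comp (f := fun z : EuclideanSpace ℝ (Fin d) × EuclideanSpace ℝ (Fin d) =>
      max (nndist z.1 z.2) s) (NNReal.continuousAt_rpow_const (Or.inl (hpos z).ne'))
      hc.continuousAt
  have hle : ∀ z, g z ≤ s ^ (-β) := by
    intro z
    simp only [g, NNReal.rpow_neg]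
    gcongr
    exact le_max_right _ _
  let f : BoundedContinuousFunction (EuclideanSpace ℝ (Fin d) × EuclideanSpace ℝ (Fin d)) NNReal :=
    BoundedContinuousFunction.mkOfBound ⟨g, hg⟩ (s ^ (-β) : NNReal) fun x y => by
      rw [NNReal.dist_eq]
      refine abs_sub_le_of_nonneg_of_le (NNReal.coe_nonneg _) ?_ (NNReal.coe_nonneg _) ?_
      · exact_mod_cast hle x
      · exact_mod_cast hle y
  have hf : ∀ x y, truncKern m β x y = (f (x, y) : ℝ≥0∞) := by
    intro x y
    have h1 : ((2 : ℝ≥0∞) ^ m)⁻¹ = (s : ℝ≥0∞) := by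
      rw [hs, ENNReal.coe_inv (by positivity)]; simp
    have h2 : (f (x, y) : ℝ≥0∞) = ((max (nndist x y) s ^ (-β) : NNReal) : ℝ≥0∞) := rfl
    rw [truncKern, edist_nndist, h1, h2, ENNReal.coe_rpow_of_ne_zero (hpos (x, y)).ne',
      ENNReal.coe_max]
  have hcont : Continuous fun μ : ProbabilityMeasure (EuclideanSpace ℝ (Fin d)) => μ.prod μ := by
    fun_prop
  have h := ProbabilityMeasure.continuous_iff_forall_continuous_lintegral.1 hcont f
  refine h.congr fun μ => ?_
  rw [ProbabilityMeasure.toMeasure_prod, lintegral_prod _ (by fun_prop)]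
  simp only [truncEnergy, hf]

theorem iSup_truncKern {β : ℝ} (hβ : 0 < β) (x y : EuclideanSpace ℝ (Fin d)) :
    ⨆ m, truncKern (m + 1) β x y = edist x y ^ (-β) := by
  have hmono : Monotone fun m => truncKern (m + 1) β x y := fun m n h =>
    truncKern_mono hβ (by omega) x y
  refine tendsto_nhds_unique (tendsto_atTop_iSup hmono) ?_
  have h1 : Tendsto (fun m : ℕ => ((2 : ℝ≥0∞) ^ (m + 1))⁻¹) atTop (𝓝 0) := by
    have := ENNReal.tendsto_pow_atTop_nhds_zero_of_lt_one (r := 2⁻¹)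
      (by rw [ENNReal.inv_lt_one]; exact ENNReal.one_lt_two)
    simpa only [ENNReal.inv_pow, Function.comp_def] using this.comp (tendsto_add_atTop_nat 1)
  have h2 : Tendsto (fun m : ℕ => max (edist x y) ((2 : ℝ≥0∞) ^ (m + 1))⁻¹) atTop
      (𝓝 (edist x y)) := by
    have := (tendsto_const_nhds (x := edist x y)).max h1
    rwa [max_eq_left zero_le] at this
  exact (ENNReal.continuous_rpow_const.tendsto _).comp h2

theorem iSup_truncEnergy {β : ℝ} (hβ : 0 < β) (μ : Measure (EuclideanSpace ℝ (Fin d)))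
    [SFinite μ] : ⨆ m, truncEnergy (m + 1) β μ = ∫⁻ x, ∫⁻ y, edist x y ^ (-β) ∂μ ∂μ := by
  have hm : ∀ m, Measurable fun z : EuclideanSpace ℝ (Fin d) × EuclideanSpace ℝ (Fin d) =>
      truncKern (m + 1) β z.1 z.2 := fun m => measurable_truncKern (m + 1) β
  have hmono : ∀ x y : EuclideanSpace ℝ (Fin d), Monotone fun m => truncKern (m + 1) β x y :=
    fun x y m n h => truncKern_mono hβ (by omega) x y
  have e : ∀ x : EuclideanSpace ℝ (Fin d), ∫⁻ y, edist x y ^ (-β) ∂μ =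
      ⨆ m, ∫⁻ y, truncKern (m + 1) β x y ∂μ := by
    intro x
    have h1 : ∀ m, Measurable fun y => truncKern (m + 1) β x y := fun m => by
      unfold truncKern
      fun_prop
    have h2 : Monotone fun m y => truncKern (m + 1) β x y := fun m n h y => hmono x y h
    exact (lintegral_congr fun y => (iSup_truncKern hβ x y).symm).trans
      (lintegral_iSup (f := fun m y => truncKern (m + 1) β x y) h1 h2)
  have h3 : ∀ m, Measurable fun x => ∫⁻ y, truncKern (m + 1) β x y ∂μ := fun m =>
    (hm m).lintegral_prod_right'
  have h4 : Monotone fun m x => ∫⁻ y, truncKern (m + 1) β x y ∂μ := fun m n h x =>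
    lintegral_mono fun y => hmono x y h
  exact ((lintegral_congr e).trans (lintegral_iSup
    (f := fun m x => ∫⁻ y, truncKern (m + 1) β x y ∂μ) h3 h4)).symm

/-- Tightness criterion with the constant compact set K and no allowed escaping mass. -/
theorem isCompact_setOf_compl_null {K : Set (EuclideanSpace ℝ (Fin d))} (hK : IsCompact K) :
    IsCompact {μ : ProbabilityMeasure (EuclideanSpace ℝ (Fin d)) |
      (μ : Measure (EuclideanSpace ℝ (Fin d))) Kᶜ = 0} := by
  have h := isCompact_setOfPred_probabilityMeasure_mass_eq_compl_isCompact_le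
    (E := EuclideanSpace ℝ (Fin d)) (u := fun _ => 0) (K := fun _ => K) tendsto_const_nhds
    (fun _ => hK) (Or.inl inferInstance)
  convert h using 1
  ext μ
  simp [ProbabilityMeasure.null_iff_toMeasure_null]

/-- Capacity of a decreasing sequence of compact sets. -/
theorem iInf_truncCap_le {β : ℝ} (hβ : 0 < β) {K : ℕ → Set (EuclideanSpace ℝ (Fin d))}
    (hK : ∀ m, IsCompact (K m)) (hanti : ∀ m, K (m + 1) ⊆ K m) :
    ⨅ m, truncCap (m + 1) β (K m) ≤ newtonCap β (⋂ m, K m) := by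
  by_contra hlt
  push Not at hlt
  obtain ⟨M, hM1, hM2⟩ := exists_between hlt
  -- If the claim failed, these sets would be nonempty, compact and decreasing. A common element
  -- lives on the intersection of the K m and, by monotone convergence of the truncated kernels, has
  -- full energy at most M⁻¹.
  let D : ℕ → Set (ProbabilityMeasure (EuclideanSpace ℝ (Fin d))) := fun m =>
    {μ | (μ : Measure (EuclideanSpace ℝ (Fin d))) (K m)ᶜ = 0} ∩
      {μ | truncEnergy (m + 1) β (μ : Measure (EuclideanSpace ℝ (Fin d))) ≤ M⁻¹}
  have hclosed : ∀ m, IsClosed {μ : ProbabilityMeasure (EuclideanSpace ℝ (Fin d)) |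
      truncEnergy (m + 1) β (μ : Measure (EuclideanSpace ℝ (Fin d))) ≤ M⁻¹} := fun m =>
    isClosed_le (continuous_truncEnergy hβ (m + 1)) continuous_const
  have hDne : ∀ m, (D m).Nonempty := by
    intro m
    have h1 : M < truncCap (m + 1) β (K m) := hM2.trans_le (iInf_le _ m)
    rw [truncCap, ENNReal.lt_inv_iff_lt_inv] at h1
    simp only [iInf_lt_iff] at h1
    obtain ⟨μ, hμ, h2⟩ := h1
    exact ⟨μ, hμ, h2.le⟩
  obtain ⟨μ, hμ⟩ := IsCompact.nonempty_iInter_of_sequence_nonempty_isCompact_isClosed D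
    (fun m μ hμ => ⟨measure_mono_null (Set.compl_subset_compl.2 (hanti m)) hμ.1,
      (lintegral_mono fun x => lintegral_mono fun y => truncKern_mono hβ (by omega) x y).trans
        hμ.2⟩) hDne ((isCompact_setOf_compl_null (hK 0)).inter_right (hclosed 0))
    (fun m => (isCompact_setOf_compl_null (hK m)).isClosed.inter (hclosed m))
  rw [Set.mem_iInter] at hμ
  refine absurd hM1 (not_lt.2 ?_)
  rw [newtonCap, ← inv_inv M, ENNReal.inv_le_inv]
  refine (iInf₂_le μ ?_).trans ?_
  · rw [Set.compl_iInter, measure_iUnion_null_iff]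
    exact fun m => (hμ m).1
  · rw [← iSup_truncEnergy hβ]
    exact iSup_le fun m => (hμ m).2

theorem inv_le_mul_inv {s x y : ℝ≥0∞} (hs0 : s ≠ 0) (hs : s ≠ ⊤) (h : y ≤ s * x) :
    x⁻¹ ≤ s * y⁻¹ := by
  calc x⁻¹ = s * (s * x)⁻¹ := by
        rw [ENNReal.mul_inv (Or.inl hs0) (Or.inl hs), ← mul_assoc, ENNReal.mul_inv_cancel hs0 hs,
          one_mul]
    _ ≤ s * y⁻¹ := by gcongr

end Continuum

end FractalPercolation

namespace FractalPercolation

/-! ### Comparison of lattice and continuum capacities at scale 2^(-m) -/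

section Discretization

variable {d : ℕ}

theorem ofReal_two_pow (m : ℕ) : ENNReal.ofReal ((2 : ℝ) ^ m) = 2 ^ m := by
  rw [ENNReal.ofReal_pow (by norm_num), ENNReal.ofReal_ofNat]

theorem truncKern_smul_latticePoint {β : ℝ} (hβ : 0 < β) (m : ℕ) (x y : Fin d → ℤ) :
    truncKern m β ((2 ^ m : ℝ)⁻¹ • latticePoint x) ((2 ^ m : ℝ)⁻¹ • latticePoint y) =
      ENNReal.ofReal (((2 : ℝ) ^ m) ^ β) *
        max (edist (latticePoint x) (latticePoint y)) 1 ^ (-β) := by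
  have h2 : (0 : ℝ) < 2 ^ m := by positivity
  have h1 : edist ((2 ^ m : ℝ)⁻¹ • latticePoint x) ((2 ^ m : ℝ)⁻¹ • latticePoint y) =
      (2 ^ m)⁻¹ * edist (latticePoint x) (latticePoint y) := by
    rw [edist_dist, dist_smul₀, ENNReal.ofReal_mul (norm_nonneg _), ← edist_dist, norm_inv,
      Real.norm_of_nonneg h2.le, ENNReal.ofReal_inv_of_pos h2, ofReal_two_pow]
  have h3 : max ((2 ^ m)⁻¹ * edist (latticePoint x) (latticePoint y)) ((2 : ℝ≥0∞) ^ m)⁻¹ =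
      (2 ^ m)⁻¹ * max (edist (latticePoint x) (latticePoint y)) 1 := by
    have hmono : Monotone fun t : ℝ≥0∞ => (2 ^ m)⁻¹ * t := fun _ _ h => by
      dsimp only
      gcongr
    rw [hmono.map_max, mul_one]
  rw [truncKern, h1, h3, ENNReal.rpow_neg, ENNReal.mul_rpow_of_nonneg _ _ hβ.le,
    ENNReal.inv_rpow, ENNReal.mul_inv, inv_inv, ← ENNReal.rpow_neg,
    ← ENNReal.ofReal_rpow_of_pos h2, ofReal_two_pow]
  · left
    rw [ENNReal.inv_ne_zero]
    exact ENNReal.rpow_ne_top_of_nonneg hβ.le (by finiteness)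
  · left
    rw [ENNReal.inv_ne_top]
    simp

theorem inv_le_mul_inv_of_inv_mul_le {s x y : ℝ≥0∞} (hs0 : s ≠ 0) (hs : s ≠ ⊤)
    (h : s⁻¹ * y ≤ x) : x⁻¹ ≤ s * y⁻¹ := by
  refine inv_le_mul_inv hs0 hs ?_
  calc y = s * (s⁻¹ * y) := by rw [← mul_assoc, ENNReal.mul_inv_cancel hs0 hs, one_mul]
    _ ≤ s * x := by gcongr

/-- Rescaled atoms are admissible because the kernel is truncated exactly at the lattice spacing
2^(-m); scaling multiplies the energy by 2^(mβ). -/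
theorem latticeCap_le_truncCap {β : ℝ} (hβ : 0 < β) (m : ℕ) {B : Set (Fin d → ℤ)}
    {K : Set (EuclideanSpace ℝ (Fin d))} (hBK : ∀ x ∈ B, (2 ^ m : ℝ)⁻¹ • latticePoint x ∈ K) :
    latticeCap β B ≤ ENNReal.ofReal (((2 : ℝ) ^ m) ^ β) * truncCap m β K := by
  have hs : 0 < ((2 : ℝ) ^ m) ^ β := by positivity
  set s := ENNReal.ofReal (((2 : ℝ) ^ m) ^ β) with hsdef
  have hs0 : s ≠ 0 := (ENNReal.ofReal_pos.2 hs).ne'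
  have hst : s ≠ ⊤ := ENNReal.ofReal_ne_top
  refine inv_le_mul_inv_of_inv_mul_le hs0 hst (le_iInf₂ fun μ hμ => ?_)
  let φ : (Fin d → ℤ) → EuclideanSpace ℝ (Fin d) := fun x => (2 ^ m : ℝ)⁻¹ • latticePoint x
  let ν : Measure (EuclideanSpace ℝ (Fin d)) := Measure.sum fun x => μ x • Measure.dirac (φ x)
  have hint : ∀ f : EuclideanSpace ℝ (Fin d) → ℝ≥0∞, ∫⁻ u, f u ∂ν = ∑' x, μ x * f (φ x) := by
    intro f
    simp only [ν, lintegral_sum_measure, lintegral_smul_measure, lintegral_dirac, smul_eq_mul]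
  have hν : IsProbabilityMeasure ν := ⟨by
    have := hint fun _ => 1
    simpa [μ.tsum_coe] using this⟩
  have hK : ν Kᶜ = 0 := by
    refine measure_mono_null (t := {u | ¬ u ∈ Set.range fun x : μ.support => φ x}) ?_ ?_
    · intro u hu hu'
      obtain ⟨x, rfl⟩ := hu'
      exact hu (hBK x (hμ x.2))
    · have hmeas : MeasurableSet {u | ¬ u ∈ Set.range fun x : μ.support => φ x} :=
        (Set.countable_range _).measurableSet.compl
      simp only [ν]
      rw [Measure.sum_apply _ hmeas, ENNReal.tsum_eq_zero]
      intro x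
      rw [Measure.smul_apply, Measure.dirac_apply' _ hmeas, smul_eq_mul, mul_eq_zero]
      by_cases hx : μ x = 0
      · exact Or.inl hx
      · have hx' : φ x ∈ Set.range fun x : μ.support => φ x :=
          ⟨⟨x, (PMF.mem_support_iff _ _).2 hx⟩, rfl⟩
        exact Or.inr (Set.indicator_of_notMem (not_not.2 hx') _)
  have hle : (⨅ (μ : ProbabilityMeasure (EuclideanSpace ℝ (Fin d)))
      (_ : (μ : Measure (EuclideanSpace ℝ (Fin d))) Kᶜ = 0),
      truncEnergy m β (μ : Measure (EuclideanSpace ℝ (Fin d)))) ≤ truncEnergy m β ν :=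
    iInf₂_le (⟨ν, hν⟩ : ProbabilityMeasure (EuclideanSpace ℝ (Fin d))) hK
  have henergy : truncEnergy m β ν = s * ∑' x, ∑' y, μ x * μ y *
      max (edist (latticePoint x) (latticePoint y)) 1 ^ (-β) := by
    simp only [truncEnergy, hint, ← ENNReal.tsum_mul_left]
    refine tsum_congr fun x => tsum_congr fun y => ?_
    rw [truncKern_smul_latticePoint hβ, ← hsdef]
    ring
  calc s⁻¹ * _ ≤ s⁻¹ * truncEnergy m β ν := by gcongr
    _ = _ := by
      rw [henergy, ← mul_assoc, ENNReal.inv_mul_cancel hs0 hst, one_mul]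

/-- Nearest point projection after scaling; enumerating the finite set B settles ties measurably. -/
theorem exists_measurable_selection {B : Set (Fin d → ℤ)} (hB : B.Finite) (hne : B.Nonempty)
    (m : ℕ) : ∃ f : EuclideanSpace ℝ (Fin d) → Fin d → ℤ, Measurable f ∧
      ∀ u, ∀ v ∈ B, f u ∈ B ∧ dist ((2 ^ m : ℝ) • u) (latticePoint (f u)) ≤
        dist ((2 ^ m : ℝ) • u) (latticePoint v) := by
  obtain ⟨e, he⟩ := hB.countable.exists_eq_range hne
  have hN : ∃ N, ∀ v ∈ B, ∃ k ≤ N, e k = v := by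
    have hex : ∀ v ∈ B, ∃ k, e k = v := fun v hv => by rw [he] at hv; exact hv
    choose! k hk using hex
    refine ⟨hB.toFinset.sup k, fun v hv => ⟨k v, ?_, hk v hv⟩⟩
    exact Finset.le_sup (f := k) (hB.mem_toFinset.2 hv)
  obtain ⟨N, hN⟩ := hN
  let g := SimpleFunc.nearestPtInd (fun k => latticePoint (e k)) N
  refine ⟨fun u => e (g ((2 ^ m : ℝ) • u)), ?_, fun u v hv => ⟨?_, ?_⟩⟩
  · have h1 : Measurable fun u : EuclideanSpace ℝ (Fin d) => g ((2 ^ m : ℝ) • u) :=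
      g.measurable.comp (measurable_const_smul _)
    exact Measurable.of_discrete.comp h1
  · rw [he]; exact ⟨_, rfl⟩
  · obtain ⟨k, hk, rfl⟩ := hN v hv
    have h := SimpleFunc.edist_nearestPt_le (fun k => latticePoint (e k)) ((2 ^ m : ℝ) • u) hk
    have h2 : SimpleFunc.nearestPt (fun k => latticePoint (e k)) N ((2 ^ m : ℝ) • u) =
        latticePoint (e (g ((2 ^ m : ℝ) • u))) := rfl
    rw [h2, edist_dist, edist_dist, ENNReal.ofReal_le_ofReal_iff dist_nonneg] at h
    rwa [dist_comm, dist_comm _ (latticePoint (e k))]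

/-- Push a measure on K to the nearest points f of B. Then 2^m |u - u'| ≤ |f u - f u'| + 2R ≤ (2R +
1) (|f u - f u'| ∨ 1), which compares the kernels. -/
theorem newtonCap_le_latticeCap {β : ℝ} (hβ : 0 < β) (m : ℕ) {R : ℝ} (hR : 0 ≤ R)
    {B : Set (Fin d → ℤ)} (hB : B.Finite) {K : Set (EuclideanSpace ℝ (Fin d))}
    (hKB : ∀ u ∈ K, ∃ v ∈ B, dist ((2 ^ m : ℝ) • u) (latticePoint v) ≤ R) :
    newtonCap β K ≤ ENNReal.ofReal (((2 * R + 1) / 2 ^ m) ^ β) * latticeCap β B := by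
  have h2 : (0 : ℝ) < 2 ^ m := by positivity
  have hs : 0 < ((2 * R + 1) / 2 ^ m) ^ β := by positivity
  set s := ENNReal.ofReal (((2 * R + 1) / 2 ^ m) ^ β) with hsdef
  have hs0 : s ≠ 0 := (ENNReal.ofReal_pos.2 hs).ne'
  have hst : s ≠ ⊤ := ENNReal.ofReal_ne_top
  refine inv_le_mul_inv_of_inv_mul_le hs0 hst (le_iInf₂ fun ν hν => ?_)
  have hae : ∀ᵐ x ∂(ν : Measure (EuclideanSpace ℝ (Fin d))), x ∈ K := by
    rw [ae_iff]; exact hν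
  have hBne : B.Nonempty := by
    obtain ⟨u, hu⟩ := hae.exists
    obtain ⟨v, hv, -⟩ := hKB u hu
    exact ⟨v, hv⟩
  obtain ⟨f, hf, hfB⟩ := exists_measurable_selection hB hBne m
  obtain ⟨v₀, hv₀⟩ := hBne
  set ν' : Measure (EuclideanSpace ℝ (Fin d)) := (ν : Measure (EuclideanSpace ℝ (Fin d)))
  have hprob : IsProbabilityMeasure (ν'.map f) := Measure.isProbabilityMeasure_map hf.aemeasurable
  have hker : ∀ u ∈ K, ∀ u' ∈ K,
      max (edist (latticePoint (f u)) (latticePoint (f u'))) 1 ^ (-β) ≤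
        s * edist u u' ^ (-β) := by
    intro u hu u' hu'
    obtain ⟨v, hv, hvR⟩ := hKB u hu
    obtain ⟨v', hv', hvR'⟩ := hKB u' hu'
    have h3 := (hfB u v hv).2.trans hvR
    have h4 := (hfB u' v' hv').2.trans hvR'
    have h5 : 2 ^ m / (2 * R + 1) * dist u u' ≤
        max (dist (latticePoint (f u)) (latticePoint (f u'))) 1 := by
      have h6 : dist ((2 ^ m : ℝ) • u) ((2 ^ m : ℝ) • u') = 2 ^ m * dist u u' := by
        rw [dist_smul₀, Real.norm_of_nonneg h2.le]
      have h7 := dist_triangle4 ((2 ^ m : ℝ) • u) (latticePoint (f u)) (latticePoint (f u'))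
        ((2 ^ m : ℝ) • u')
      rw [h6, dist_comm (latticePoint (f u'))] at h7
      have h8 := le_max_left (dist (latticePoint (f u)) (latticePoint (f u'))) 1
      have h9 := le_max_right (dist (latticePoint (f u)) (latticePoint (f u'))) 1
      rw [div_mul_eq_mul_div, div_le_iff₀ (by positivity)]
      nlinarith
    have h6 : ENNReal.ofReal (2 ^ m / (2 * R + 1)) * edist u u' ≤
        max (edist (latticePoint (f u)) (latticePoint (f u'))) 1 := by
      rw [edist_dist, edist_dist, ← ENNReal.ofReal_mul (by positivity), ← ENNReal.ofReal_one,
        ← ENNReal.ofReal_max]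
      exact ENNReal.ofReal_le_ofReal h5
    refine (rpow_neg_anti hβ h6).trans (le_of_eq ?_)
    have hq : 0 < 2 ^ m / (2 * R + 1) := by positivity
    rw [ENNReal.rpow_neg, ENNReal.mul_rpow_of_nonneg _ _ hβ.le,
      ENNReal.ofReal_rpow_of_pos hq, ENNReal.mul_inv
        (Or.inl (ENNReal.ofReal_pos.2 (by positivity)).ne') (Or.inl ENNReal.ofReal_ne_top),
      ← ENNReal.rpow_neg, ← ENNReal.ofReal_inv_of_pos (by positivity),
      ← Real.inv_rpow hq.le, inv_div]
  have hmain : (⨅ (μ : PMF (Fin d → ℤ)) (_ : μ.support ⊆ B),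
      ∑' x, ∑' y, μ x * μ y * max (edist (latticePoint x) (latticePoint y)) 1 ^ (-β)) ≤
      s * ∫⁻ x, ∫⁻ y, edist x y ^ (-β) ∂ν' ∂ν' := by
    refine (iInf₂_le (ν'.map f).toPMF ?_).trans ?_
    · intro x hx
      rw [PMF.mem_support_iff, Measure.toPMF_apply, Measure.map_apply hf (.of_discrete)] at hx
      obtain ⟨u, hu⟩ := nonempty_of_measure_ne_zero hx
      rw [Set.mem_preimage, Set.mem_singleton_iff] at hu
      rw [← hu]
      exact (hfB u v₀ hv₀).1
    · have e : ∑' x, ∑' y, (ν'.map f).toPMF x * (ν'.map f).toPMF y *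
          max (edist (latticePoint x) (latticePoint y)) 1 ^ (-β) =
          ∫⁻ u, ∫⁻ u', max (edist (latticePoint (f u)) (latticePoint (f u'))) 1 ^ (-β)
            ∂ν' ∂ν' := by
        have e1 : ∀ g : (Fin d → ℤ) → ℝ≥0∞, ∫⁻ u, g (f u) ∂ν' =
            ∑' x, g x * (ν'.map f).toPMF x := by
          intro g
          rw [← lintegral_map (Measurable.of_discrete (f := g)) hf, lintegral_countable']
          simp only [Measure.toPMF_apply]
        rw [e1 fun x => ∫⁻ u', max (edist (latticePoint x) (latticePoint (f u'))) 1 ^ (-β) ∂ν']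
        refine tsum_congr fun x => ?_
        rw [e1 fun y => max (edist (latticePoint x) (latticePoint y)) 1 ^ (-β),
          ← ENNReal.tsum_mul_right]
        exact tsum_congr fun y => by ring
      rw [e, ← lintegral_const_mul' _ _ hst]
      refine lintegral_mono_ae ?_
      filter_upwards [hae] with u hu
      rw [← lintegral_const_mul' _ _ hst]
      refine lintegral_mono_ae ?_
      filter_upwards [hae] with u' hu'
      exact hker u hu u' hu'
  calc s⁻¹ * _ ≤ s⁻¹ * (s * ∫⁻ x, ∫⁻ y, edist x y ^ (-β) ∂ν' ∂ν') := by gcongr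
    _ = _ := by rw [← mul_assoc, ENNReal.inv_mul_cancel hs0 hst, one_mul]

end Discretization

end FractalPercolation

namespace FractalPercolation

/-! ### Discretising Λ and passing to the limit -/

section Scaling

open Filter Topology

variable {d : ℕ} {a b : ℝ}

theorem dist_le_of_coord_le {u v : EuclideanSpace ℝ (Fin d)} {r : ℝ} (hr : 0 ≤ r)
    (h : ∀ i, |u i - v i| ≤ r) : dist u v ≤ (d + 1) * r := by
  rw [EuclideanSpace.dist_eq]
  refine Real.sqrt_le_iff.2 ⟨by positivity, ?_⟩
  calc ∑ i, dist (u i) (v i) ^ 2 ≤ ∑ _i : Fin d, r ^ 2 := by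
        refine Finset.sum_le_sum fun i _ => ?_
        rw [Real.dist_eq]
        exact pow_le_pow_left₀ (abs_nonneg _) (h i) 2
    _ = d * r ^ 2 := by simp
    _ ≤ ((d + 1) * r) ^ 2 := by
        have hd : (0 : ℝ) ≤ d := d.cast_nonneg
        nlinarith [sq_nonneg r, mul_nonneg hd (sq_nonneg r),
          mul_nonneg (mul_nonneg hd hd) (sq_nonneg r)]

theorem inv_two_pow_mul_pos {m : ℕ} (hm : 1 ≤ m) (z : Fin d → ℕ) (i : Fin d) :
    (2 ^ m : ℝ)⁻¹ * (pos m z i : ℝ) = -(1 / 2) + z i / 2 ^ m := by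
  obtain ⟨k, rfl⟩ := Nat.exists_eq_add_of_le hm
  have h2 : (0 : ℝ) < 2 ^ k := by positivity
  simp only [pos, Nat.add_sub_cancel_left, pow_add]
  push_cast
  field_simp
  ring

theorem corner_mem_cube {m : ℕ} (hm : 1 ≤ m) (z : Fin d → ℕ) :
    (2 ^ m : ℝ)⁻¹ • latticePoint (pos m z) ∈ cube m z := by
  intro i
  have h2 : (0 : ℝ) < 2 ^ m := by positivity
  have e : ((2 ^ m : ℝ)⁻¹ • latticePoint (pos m z)) i = -(1 / 2) + z i / 2 ^ m := by
    rw [← inv_two_pow_mul_pos hm]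
    simp [latticePoint]
  rw [e]
  refine ⟨le_rfl, ?_⟩
  gcongr
  linarith

theorem closure_cube_subset (m : ℕ) (z : Fin d → ℕ) :
    closure (cube m z) ⊆ {x | ∀ i, -(1 / 2) + (z i : ℝ) / 2 ^ m ≤ x i ∧
      x i ≤ -(1 / 2) + ((z i : ℝ) + 1) / 2 ^ m} := by
  refine closure_minimal (fun x hx i => ⟨(hx i).1, (hx i).2.le⟩) ?_
  simp only [Set.ofPred_forall, Set.ofPred_and]
  refine isClosed_iInter fun i => (isClosed_le ?_ ?_).inter (isClosed_le ?_ ?_) <;> fun_prop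

theorem abs_two_pow_smul_sub_pos_le {m : ℕ} (hm : 1 ≤ m) {z : Fin d → ℕ}
    {q : EuclideanSpace ℝ (Fin d)} (hq : q ∈ closure (cube m z)) (i : Fin d) :
    |2 ^ m * q i - pos m z i| ≤ 1 := by
  have h2 : (0 : ℝ) < 2 ^ m := by positivity
  obtain ⟨h3, h4⟩ := closure_cube_subset m z hq i
  have e := inv_two_pow_mul_pos hm z i
  have e' : (pos m z i : ℝ) = 2 ^ m * (-(1 / 2) + z i / 2 ^ m) := by
    rw [← e, mul_inv_cancel_left₀ h2.ne']
  have h5 : (2 : ℝ) ^ m * (-(1 / 2) + (z i + 1) / 2 ^ m) =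
      2 ^ m * (-(1 / 2) + z i / 2 ^ m) + 1 := by
    field_simp
    ring
  have h6 := mul_le_mul_of_nonneg_left h3 h2.le
  have h7 := mul_le_mul_of_nonneg_left h4 h2.le
  rw [e', abs_le]
  constructor <;> linarith

theorem isCompact_closure_cube (m : ℕ) (z : Fin d → ℕ) : IsCompact (closure (cube m z)) := by
  refine Metric.isCompact_of_isClosed_isBounded isClosed_closure (Metric.isBounded_iff.2
    ⟨(d + 1) * (2 ^ m)⁻¹, fun x hx y hy => dist_le_of_coord_le (by positivity) fun i => ?_⟩)
  obtain ⟨h1, h2⟩ := closure_cube_subset m z hx i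
  obtain ⟨h3, h4⟩ := closure_cube_subset m z hy i
  rw [add_div, one_div (2 ^ m : ℝ)] at h2 h4
  rw [abs_le]
  constructor <;> linarith

theorem cube_succ_subset (m : ℕ) (z : Fin d → ℕ) :
    cube (m + 1) z ⊆ cube m fun i => z i / 2 := by
  intro x hx i
  have h2 : (0 : ℝ) < 2 ^ m := by positivity
  obtain ⟨h3, h4⟩ := hx i
  have h5 : ((z i / 2 : ℕ) : ℝ) * 2 ≤ z i := by exact_mod_cast Nat.div_mul_le_self _ _
  have h6 : (z i : ℝ) + 1 ≤ (((z i / 2 : ℕ) : ℝ) + 1) * 2 := by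
    have : z i + 1 ≤ (z i / 2 + 1) * 2 := by omega
    exact_mod_cast this
  rw [pow_succ] at h3 h4
  constructor
  · refine le_trans (add_le_add_right ?_ _) h3
    rw [div_le_div_iff₀ h2 (by positivity)]
    nlinarith
  · refine h4.trans_le (add_le_add_right ?_ _)
    rw [div_le_div_iff₀ (by positivity) h2]
    nlinarith

/-- The union of the closures of the cubes of level `m` that remain. -/
def levelSet (m : ℕ) (ω : Config d) : Set (EuclideanSpace ℝ (Fin d)) :=
  ⋃ z ∈ remaining ω m, closure (cube m z)

theorem finite_remaining (ω : Config d) (m : ℕ) : (remaining ω m).Finite :=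
  (leaves d m).finite_toSet.subset fun z hz => ((mem_remaining_iff ω m z).1 hz).1

theorem isCompact_levelSet (m : ℕ) (ω : Config d) : IsCompact (levelSet m ω) :=
  (finite_remaining ω m).isCompact_biUnion fun z _ => isCompact_closure_cube m z

theorem levelSet_succ_subset (m : ℕ) (ω : Config d) : levelSet (m + 1) ω ⊆ levelSet m ω :=
  Set.iUnion₂_subset fun z hz => (closure_mono (cube_succ_subset m z)).trans
    (Set.subset_biUnion_of_mem (u := fun z => closure (cube m z)) hz.1)

theorem continuousPerc_eq (ω : Config d) : continuousPerc ω = ⋂ n, levelSet (n + 1) ω := by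
  ext x
  simp only [continuousPerc, levelSet, Set.mem_iInter]
  exact ⟨fun h n => h (n + 1) (by omega), fun h n hn => by
    obtain ⟨k, rfl⟩ := Nat.exists_eq_add_of_le' hn
    exact h k⟩

-- The level set is determined by the finitely many cubes up to level m, so no regularity of f is
-- needed.
open scoped Classical in
theorem measurable_comp_levelSet (m : ℕ) (f : Set (EuclideanSpace ℝ (Fin d)) → ℝ≥0∞) :
    Measurable fun ω : Config d => f (levelSet m ω) := by
  have h := measurable_apply_filter (cubes d m) fun T => f (levelSet m (T : Set (ℕ × (Fin d → ℕ))))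
  convert h using 3 with ω
  ext z
  simp only [levelSet, Set.mem_iUnion, exists_prop]
  refine exists_congr fun w => and_congr_left fun _ => ?_
  rw [mem_remaining_iff, mem_remaining_iff]
  refine and_congr_right fun hw => forall₂_congr fun c hc => ?_
  simp [anc_subset_cubes hw hc]

/-- The lattice points obtained by rounding down the points of `2 ^ m Λ`. -/
noncomputable def latticeApprox (m : ℕ) (Λ : Set (EuclideanSpace ℝ (Fin d))) :
    Set (Fin d → ℤ) :=
  (fun u i => ⌊2 ^ m * u i⌋) '' Λ

theorem latticeApprox_subset_Icc {Λ : Set (EuclideanSpace ℝ (Fin d))}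
    (hΛ : ∀ x ∈ Λ, ∀ i, x i ∈ Set.Icc (0 : ℝ) 1) (m : ℕ) :
    latticeApprox m Λ ⊆ Set.Icc 0 fun _ => 2 ^ m := by
  rintro _ ⟨u, hu, rfl⟩
  have h2 : (0 : ℝ) < 2 ^ m := by positivity
  refine ⟨fun i => Int.floor_nonneg.2 (mul_nonneg h2.le (hΛ u hu i).1), fun i => ?_⟩
  refine Int.floor_le_iff.2 ?_
  push_cast
  nlinarith [(hΛ u hu i).2]

theorem dist_le_of_mem_latticeApprox {Λ : Set (EuclideanSpace ℝ (Fin d))}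
    (hΛ : ∀ x ∈ Λ, ∀ i, x i ∈ Set.Icc (0 : ℝ) 1) (m : ℕ) {x y : Fin d → ℤ}
    (hx : x ∈ latticeApprox m Λ) (hy : y ∈ latticeApprox m Λ) : dist x y ≤ 2 ^ m := by
  refine (dist_pi_le_iff (by positivity)).2 fun i => ?_
  have hx' := latticeApprox_subset_Icc hΛ m hx
  have hy' := latticeApprox_subset_Icc hΛ m hy
  have h1 : (0 : ℤ) ≤ x i := hx'.1 i
  have h2 : x i ≤ 2 ^ m := hx'.2 i
  have h3 : (0 : ℤ) ≤ y i := hy'.1 i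
  have h4 : y i ≤ 2 ^ m := hy'.2 i
  rw [Int.dist_eq, abs_le]
  have h1' : (0 : ℝ) ≤ x i := by exact_mod_cast h1
  have h2' : (x i : ℝ) ≤ 2 ^ m := by exact_mod_cast h2
  have h3' : (0 : ℝ) ≤ y i := by exact_mod_cast h3
  have h4' : (y i : ℝ) ≤ 2 ^ m := by exact_mod_cast h4
  constructor <;> linarith

theorem finite_latticeApprox {Λ : Set (EuclideanSpace ℝ (Fin d))}
    (hΛ : ∀ x ∈ Λ, ∀ i, x i ∈ Set.Icc (0 : ℝ) 1) (m : ℕ) : (latticeApprox m Λ).Finite :=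
  (Set.finite_Icc _ _).subset (latticeApprox_subset_Icc hΛ m)

theorem abs_sub_floor_le (t : ℝ) : |t - ⌊t⌋| ≤ 1 := by
  rw [abs_le]
  constructor <;> linarith [Int.floor_le t, Int.lt_floor_add_one t]

/-- The closed thickening of `Λ` at scale `2 ^ (-m)`. -/
noncomputable def scaleThickening (m : ℕ) (Λ : Set (EuclideanSpace ℝ (Fin d))) :
    Set (EuclideanSpace ℝ (Fin d)) :=
  Metric.cthickening ((d + 1) * (2 ^ m)⁻¹) Λ

theorem scaleThickening_succ_subset (m : ℕ) (Λ : Set (EuclideanSpace ℝ (Fin d))) :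
    scaleThickening (m + 1) Λ ⊆ scaleThickening m Λ := by
  refine Metric.cthickening_mono ?_ _
  gcongr
  · norm_num
  · omega

theorem isCompact_scaleThickening (m : ℕ) {Λ : Set (EuclideanSpace ℝ (Fin d))}
    (hΛ : IsCompact Λ) : IsCompact (scaleThickening m Λ) :=
  hΛ.cthickening

theorem iInter_scaleThickening_subset {Λ : Set (EuclideanSpace ℝ (Fin d))} (hΛ : IsClosed Λ) :
    ⋂ n, scaleThickening (n + 1) Λ ⊆ Λ := by
  intro x hx
  have hlim : Tendsto (fun n : ℕ => ((d : ℝ) + 1) * (2 ^ (n + 1))⁻¹) atTop (𝓝 0) := by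
    have h := (tendsto_pow_atTop_nhds_zero_of_lt_one (r := (2 : ℝ)⁻¹) (by norm_num)
      (by norm_num)).comp (tendsto_add_atTop_nat 1)
    simpa [Function.comp_def] using h.const_mul ((d : ℝ) + 1)
  have h0 : Metric.infEDist x Λ ≤ ENNReal.ofReal 0 :=
    ge_of_tendsto' (ENNReal.tendsto_ofReal hlim) fun n => Set.mem_iInter.1 hx n
  rw [ENNReal.ofReal_zero, nonpos_iff_eq_zero, ← Metric.mem_closure_iff_infEDist_zero,
    hΛ.closure_eq] at h0
  exact h0

theorem smul_latticeApprox_mem {m : ℕ} {Λ : Set (EuclideanSpace ℝ (Fin d))} {x : Fin d → ℤ}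
    (hx : x ∈ latticeApprox m Λ) : (2 ^ m : ℝ)⁻¹ • latticePoint x ∈ scaleThickening m Λ := by
  obtain ⟨u, hu, rfl⟩ := hx
  have h2 : (0 : ℝ) < 2 ^ m := by positivity
  refine Metric.mem_cthickening_of_dist_le _ u _ _ hu ?_
  rw [dist_comm]
  refine dist_le_of_coord_le (by positivity) fun i => ?_
  have e : u i - ((2 ^ m : ℝ)⁻¹ • latticePoint fun i => ⌊2 ^ m * u i⌋) i =
      (2 ^ m)⁻¹ * (2 ^ m * u i - ⌊2 ^ m * u i⌋) := by
    simp only [latticePoint, PiLp.smul_apply, smul_eq_mul]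
    field_simp
  rw [e, abs_mul, abs_of_pos (by positivity : (0 : ℝ) < (2 ^ m)⁻¹)]
  exact mul_le_of_le_one_right (by positivity) (abs_sub_floor_le _)

theorem exists_latticeApprox_near {m : ℕ} {Λ : Set (EuclideanSpace ℝ (Fin d))}
    {u : EuclideanSpace ℝ (Fin d)} (hu : u ∈ Λ) :
    ∃ v ∈ latticeApprox m Λ, dist ((2 ^ m : ℝ) • u) (latticePoint v) ≤ (d + 1) * 2 := by
  refine ⟨_, ⟨u, hu, rfl⟩, dist_le_of_coord_le (by norm_num) fun i => ?_⟩
  simp only [latticePoint, PiLp.smul_apply, smul_eq_mul]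
  linarith [abs_sub_floor_le (2 ^ m * u i)]

/-- Each coordinate carries two errors of at most one: rounding the point of Λ down, and moving to
the lowest corner of the cube. -/
theorem exists_add_discretePerc_near {m : ℕ} (hm : 1 ≤ m) {Λ : Set (EuclideanSpace ℝ (Fin d))}
    {ω : Config d} {u : EuclideanSpace ℝ (Fin d)} (hu : u ∈ Λ + levelSet m ω) :
    ∃ v ∈ latticeApprox m Λ + discretePerc m ω,
      dist ((2 ^ m : ℝ) • u) (latticePoint v) ≤ (d + 1) * 2 := by
  obtain ⟨l, hl, q, hq, rfl⟩ := hu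
  obtain ⟨z, hz, hqz⟩ := Set.mem_iUnion₂.1 hq
  rw [discretePerc_eq hm]
  refine ⟨_, Set.add_mem_add ⟨l, hl, rfl⟩ ⟨z, hz, rfl⟩,
    dist_le_of_coord_le (by norm_num) fun i => ?_⟩
  have h1 := abs_le.1 (abs_sub_floor_le (2 ^ m * l i))
  have h2 := abs_le.1 (abs_two_pow_smul_sub_pos_le hm hqz i)
  simp only [latticePoint, PiLp.smul_apply, PiLp.add_apply, Pi.add_apply, smul_eq_mul,
    Int.cast_add]
  rw [abs_le]
  constructor <;> linarith [h1.1, h1.2, h2.1, h2.2]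

theorem smul_add_discretePerc_mem {m : ℕ} (hm : 1 ≤ m) {Λ : Set (EuclideanSpace ℝ (Fin d))}
    {ω : Config d} {x : Fin d → ℤ} (hx : x ∈ latticeApprox m Λ + discretePerc m ω) :
    (2 ^ m : ℝ)⁻¹ • latticePoint x ∈ scaleThickening m Λ + levelSet m ω := by
  rw [discretePerc_eq hm] at hx
  obtain ⟨y, hy, _, ⟨z, hz, rfl⟩, rfl⟩ := hx
  have e : (2 ^ m : ℝ)⁻¹ • latticePoint (y + pos m z) =
      (2 ^ m : ℝ)⁻¹ • latticePoint y + (2 ^ m : ℝ)⁻¹ • latticePoint (pos m z) := by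
    ext i
    simp [latticePoint, mul_add]
  simp only [e]
  exact Set.add_mem_add (smul_latticeApprox_mem hy)
    (Set.mem_iUnion₂.2 ⟨z, hz, subset_closure (corner_mem_cube hm z)⟩)

theorem finite_add_discretePerc {m : ℕ} (hm : 1 ≤ m) {A : Set (Fin d → ℤ)} (hA : A.Finite)
    (ω : Config d) : (A + discretePerc m ω).Finite := by
  rw [discretePerc_eq hm]
  exact hA.add ((finite_remaining ω m).image _)

/-- The decomposition of x may change with n. The admissible percolation summands form decreasing
nonempty compact sets, so one summand serves for all n. -/
theorem iInter_add_levelSet_subset {Λ : Set (EuclideanSpace ℝ (Fin d))} (hΛ : IsClosed Λ)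
    (hΛc : IsCompact Λ) (ω : Config d) :
    ⋂ n, (scaleThickening (n + 1) Λ + levelSet (n + 1) ω) ⊆ Λ + continuousPerc ω := by
  intro x hx
  let S : ℕ → Set (EuclideanSpace ℝ (Fin d)) := fun n =>
    levelSet (n + 1) ω ∩ {q | x - q ∈ scaleThickening (n + 1) Λ}
  have hclosed : ∀ n, IsClosed {q | x - q ∈ scaleThickening (n + 1) Λ} := fun n =>
    (isCompact_scaleThickening (n + 1) hΛc).isClosed.preimage (continuous_const.sub continuous_id)
  obtain ⟨q, hq⟩ := IsCompact.nonempty_iInter_of_sequence_nonempty_isCompact_isClosed S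
    (fun n q hq => ⟨levelSet_succ_subset _ _ hq.1, scaleThickening_succ_subset _ _ hq.2⟩)
    (fun n => by
      obtain ⟨l, hl, q, hq, hlq⟩ := Set.mem_iInter.1 hx n
      refine ⟨q, hq, ?_⟩
      rw [Set.mem_ofPred_eq, ← hlq]
      simpa using hl)
    ((isCompact_levelSet 1 ω).inter_right (hclosed 0))
    (fun n => (isCompact_levelSet (n + 1) ω).isClosed.inter (hclosed n))
  rw [Set.mem_iInter] at hq
  refine ⟨x - q, iInter_scaleThickening_subset hΛ (Set.mem_iInter.2 fun n => (hq n).2), q, ?_,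
    sub_add_cancel x q⟩
  rw [continuousPerc_eq]
  exact Set.mem_iInter.2 fun n => (hq n).1

theorem isCompact_of_coord_mem {Λ : Set (EuclideanSpace ℝ (Fin d))} (hΛ : IsClosed Λ)
    (h : ∀ x ∈ Λ, ∀ i, x i ∈ Set.Icc (0 : ℝ) 1) : IsCompact Λ := by
  refine Metric.isCompact_of_isClosed_isBounded hΛ (Metric.isBounded_iff.2
    ⟨(d + 1) * 1, fun x hx y hy => dist_le_of_coord_le zero_le_one fun i => ?_⟩)
  rw [abs_le]
  constructor <;> linarith [(h x hx i).1, (h x hx i).2, (h y hy i).1, (h y hy i).2]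

/-- The percolation set lies inside every level set, so only the deterministic side has to pass to
the limit: the thickenings of Λ decrease to Λ. -/
theorem lintegral_newtonCap_le (ha : 0 < a) (hab : a < b) (hbd : b < d) : ∃ C : ℝ, 0 < C ∧
    ∀ Λ : Set (EuclideanSpace ℝ (Fin d)), IsClosed Λ → Λ.Nonempty →
      (∀ x ∈ Λ, ∀ i, x i ∈ Set.Icc (0 : ℝ) 1) →
      ∫⁻ ω, newtonCap b (Λ + continuousPerc ω)
        ∂(percLaw d ⟨2 ^ (b - a - d), two_rpow_mem ha hbd⟩) ≤
        ENNReal.ofReal C * newtonCap a Λ := by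
  obtain ⟨C, hC, hmain⟩ := lintegral_latticeCap_le ha hab hbd
  have hb : 0 < b := ha.trans hab
  set R : ℝ := (d + 1) * 2 with hR
  have hR0 : 0 ≤ R := by positivity
  refine ⟨(2 * R + 1) ^ b * C, by positivity, fun Λ hΛ hne hcube => ?_⟩
  have hΛc := isCompact_of_coord_mem hΛ hcube
  have hlevel : ∀ n, ∫⁻ ω, newtonCap b (Λ + continuousPerc ω)
      ∂(percLaw d ⟨2 ^ (b - a - d), two_rpow_mem ha hbd⟩) ≤
      ENNReal.ofReal ((2 * R + 1) ^ b * C) *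
        truncCap (n + 1) a (scaleThickening (n + 1) Λ) := by
    intro n
    have ht : (0 : ℝ) < 2 ^ (n + 1) := by positivity
    calc _ ≤ ∫⁻ ω, ENNReal.ofReal (((2 * R + 1) / 2 ^ (n + 1)) ^ b) *
          latticeCap b (latticeApprox (n + 1) Λ + discretePerc (n + 1) ω)
          ∂(percLaw d ⟨2 ^ (b - a - d), two_rpow_mem ha hbd⟩) := by
          refine lintegral_mono fun ω => newtonCap_le_latticeCap hb (n + 1) hR0
            (finite_add_discretePerc (by omega) (finite_latticeApprox hcube _) ω) fun u hu => ?_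
          refine exists_add_discretePerc_near (by omega) (Set.add_subset_add_left ?_ hu)
          rw [continuousPerc_eq]
          exact Set.iInter_subset _ n
      _ = ENNReal.ofReal (((2 * R + 1) / 2 ^ (n + 1)) ^ b) *
          ∫⁻ ω, latticeCap b (latticeApprox (n + 1) Λ + discretePerc (n + 1) ω)
          ∂(percLaw d ⟨2 ^ (b - a - d), two_rpow_mem ha hbd⟩) :=
          lintegral_const_mul' _ _ ENNReal.ofReal_ne_top
      _ ≤ ENNReal.ofReal (((2 * R + 1) / 2 ^ (n + 1)) ^ b) *
          (ENNReal.ofReal (C * (2 ^ (n + 1)) ^ (b - a)) *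
          (ENNReal.ofReal ((2 ^ (n + 1)) ^ a) *
            truncCap (n + 1) a (scaleThickening (n + 1) Λ))) := by
          gcongr
          refine (hmain _ (finite_latticeApprox hcube (n + 1)) (hne.image _) (n + 1) (by omega)
            (2 ^ (n + 1)) le_rfl fun x hx y hy =>
              dist_le_of_mem_latticeApprox hcube _ hx hy).trans ?_
          gcongr
          exact latticeCap_le_truncCap ha (n + 1) fun x hx => smul_latticeApprox_mem hx
      _ = _ := by
          rw [← mul_assoc, ← mul_assoc, ← ENNReal.ofReal_mul (by positivity),
            ← ENNReal.ofReal_mul (by positivity)]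
          -- The exponents of 2^(n+1) are -b, b - a and a, and they cancel.
          congr 2
          rw [Real.div_rpow (by positivity) ht.le, Real.rpow_sub ht]
          field_simp
  calc _ ≤ ⨅ n, ENNReal.ofReal ((2 * R + 1) ^ b * C) *
        truncCap (n + 1) a (scaleThickening (n + 1) Λ) := le_iInf hlevel
    _ = ENNReal.ofReal ((2 * R + 1) ^ b * C) *
        ⨅ n, truncCap (n + 1) a (scaleThickening (n + 1) Λ) := by
        rw [ENNReal.mul_iInf fun h => absurd h ENNReal.ofReal_ne_top]
    _ ≤ _ := by
        gcongr
        refine (iInf_truncCap_le ha (fun n => isCompact_scaleThickening _ hΛc)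
          fun n => scaleThickening_succ_subset _ _).trans
          (newtonCap_mono a (iInter_scaleThickening_subset hΛ))

/-- Here the random side passes to the limit: the truncated capacities of the sets K n decrease,
which permits monotone convergence, and their infimum is controlled for each configuration by weak
compactness. -/
theorem newtonCap_le_lintegral (ha : 0 < a) (hab : a < b) (hbd : b < d) : ∃ C : ℝ, 0 < C ∧
    ∀ Λ : Set (EuclideanSpace ℝ (Fin d)), IsClosed Λ → Λ.Nonempty →
      (∀ x ∈ Λ, ∀ i, x i ∈ Set.Icc (0 : ℝ) 1) →
      newtonCap a Λ ≤ ENNReal.ofReal C * ∫⁻ ω, newtonCap b (Λ + continuousPerc ω)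
        ∂(percLaw d ⟨2 ^ (b - a - d), two_rpow_mem ha hbd⟩) := by
  obtain ⟨C, hC, hmain⟩ := latticeCap_le_lintegral ha hab hbd
  have hb : 0 < b := ha.trans hab
  set R : ℝ := (d + 1) * 2 with hR
  have hR0 : 0 ≤ R := by positivity
  refine ⟨(2 * R + 1) ^ a * C, by positivity, fun Λ hΛ hne hcube => ?_⟩
  have hΛc := isCompact_of_coord_mem hΛ hcube
  have hprob : IsProbabilityMeasure (percLaw d ⟨2 ^ (b - a - d), two_rpow_mem ha hbd⟩) := by
    unfold percLaw
    infer_instance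
  set P := percLaw d ⟨2 ^ (b - a - d), two_rpow_mem ha hbd⟩ with hP
  let K : ℕ → Config d → Set (EuclideanSpace ℝ (Fin d)) := fun n ω =>
    scaleThickening (n + 1) Λ + levelSet (n + 1) ω
  have hKc : ∀ n ω, IsCompact (K n ω) := fun n ω =>
    (isCompact_scaleThickening _ hΛc).add (isCompact_levelSet _ ω)
  have hKanti : ∀ n ω, K (n + 1) ω ⊆ K n ω := fun n ω =>
    Set.add_subset_add (scaleThickening_succ_subset _ _) (levelSet_succ_subset _ _)
  have hlevel : ∀ n, newtonCap a Λ ≤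
      ENNReal.ofReal ((2 * R + 1) ^ a * C) * ∫⁻ ω, truncCap (n + 1) b (K n ω) ∂P := by
    intro n
    have ht : (0 : ℝ) < 2 ^ (n + 1) := by positivity
    calc newtonCap a Λ ≤ ENNReal.ofReal (((2 * R + 1) / 2 ^ (n + 1)) ^ a) *
          latticeCap a (latticeApprox (n + 1) Λ) :=
          newtonCap_le_latticeCap ha (n + 1) hR0 (finite_latticeApprox hcube _) fun u hu =>
            exists_latticeApprox_near hu
      _ ≤ ENNReal.ofReal (((2 * R + 1) / 2 ^ (n + 1)) ^ a) *
          (ENNReal.ofReal (C * 2 ^ ((a - b) * ((n + 1 : ℕ) : ℝ))) *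
          ∫⁻ ω, ENNReal.ofReal ((2 ^ (n + 1)) ^ b) * truncCap (n + 1) b (K n ω) ∂P) := by
          gcongr
          refine (hmain _ (finite_latticeApprox hcube (n + 1)) (hne.image _) (n + 1)
            (by omega)).trans ?_
          gcongr with ω
          exact latticeCap_le_truncCap hb (n + 1) fun x hx =>
            smul_add_discretePerc_mem (by omega) hx
      _ = _ := by
          rw [lintegral_const_mul' _ _ ENNReal.ofReal_ne_top, ← mul_assoc, ← mul_assoc,
            ← ENNReal.ofReal_mul (by positivity), ← ENNReal.ofReal_mul (by positivity)]
          congr 2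
          rw [mul_comm (a - b), Real.rpow_mul (by norm_num), Real.rpow_natCast,
            Real.div_rpow (by positivity) ht.le, Real.rpow_sub ht]
          field_simp
  -- Monotone convergence from above needs one finite integral; K 0 stays in a fixed bounded set, on
  -- which the truncated capacity is finite.
  have hfin : ∫⁻ ω, truncCap (0 + 1) b (K 0 ω) ∂P ≠ ⊤ := by
    have hbd' : Bornology.IsBounded
        (scaleThickening 1 Λ + closure (cube 0 (0 : Fin d → ℕ))) :=
      ((isCompact_scaleThickening _ hΛc).add (isCompact_closure_cube _ _)).isBounded
    refine ((lintegral_mono fun ω => truncCap_anti hb le_rfl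
      (Set.add_subset_add_left ?_)).trans_lt (b := ∫⁻ _ω, truncCap (0 + 1) b
        (scaleThickening 1 Λ + closure (cube 0 (0 : Fin d → ℕ))) ∂P) ?_).ne
    · refine (levelSet_succ_subset 0 ω).trans ?_
      simp [levelSet, remaining]
    · rw [lintegral_const, measure_univ, mul_one]
      exact truncCap_lt_top hb _ hbd'
  calc newtonCap a Λ ≤ ⨅ n, ENNReal.ofReal ((2 * R + 1) ^ a * C) *
        ∫⁻ ω, truncCap (n + 1) b (K n ω) ∂P := le_iInf hlevel
    _ = ENNReal.ofReal ((2 * R + 1) ^ a * C) *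
        ∫⁻ ω, ⨅ n, truncCap (n + 1) b (K n ω) ∂P := by
        rw [lintegral_iInf (fun n => measurable_comp_levelSet (n + 1) fun L =>
            truncCap (n + 1) b (scaleThickening (n + 1) Λ + L))
          (antitone_nat_of_succ_le fun n ω => truncCap_anti hb (by omega) (hKanti n ω)) hfin,
          ENNReal.mul_iInf fun h => absurd h ENNReal.ofReal_ne_top]
    _ ≤ _ := by
        gcongr with ω
        exact (iInf_truncCap_le hb (fun n => hKc n ω) fun n => hKanti n ω).trans
          (newtonCap_mono b (iInter_add_levelSet_subset hΛ hΛc ω))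

end Scaling

end FractalPercolation
open FractalPercolation in
theorem corollary4 (d : ℕ) (a b : ℝ) (ha : 0 < a) (hab : a < b) (hbd : b < d) :
    ∃ c C : ℝ, 0 < c ∧ 0 < C ∧
      (∀ (A : Set (Fin d → ℤ)), A.Finite → A.Nonempty → ∀ m : ℕ, 1 ≤ m →
        ENNReal.ofReal (c * 2 ^ ((a - b) * max (m : ℝ) (Real.logb 2 (latticeDiam A)))) ≤
            latticeCap a A /
              ∫⁻ ω, latticeCap b (A + discretePerc m ω)
                ∂(percLaw d ⟨2 ^ (b - a - d), two_rpow_mem ha hbd⟩) ∧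
        latticeCap a A /
              ∫⁻ ω, latticeCap b (A + discretePerc m ω)
                ∂(percLaw d ⟨2 ^ (b - a - d), two_rpow_mem ha hbd⟩) ≤
            ENNReal.ofReal (C * 2 ^ ((a - b) * (m : ℝ)))) ∧
      (∀ (Λ : Set (EuclideanSpace ℝ (Fin d))), IsClosed Λ → Λ.Nonempty →
        (∀ x ∈ Λ, ∀ i, x i ∈ Set.Icc (0 : ℝ) 1) →
        ENNReal.ofReal c *
              ∫⁻ ω, newtonCap b (Λ + continuousPerc ω)
                ∂(percLaw d ⟨2 ^ (b - a - d), two_rpow_mem ha hbd⟩) ≤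
            newtonCap a Λ ∧
        newtonCap a Λ ≤
            ENNReal.ofReal C *
              ∫⁻ ω, newtonCap b (Λ + continuousPerc ω)
                ∂(percLaw d ⟨2 ^ (b - a - d), two_rpow_mem ha hbd⟩)) := by
  obtain ⟨c₁, C₁, hc₁, hC₁, h₁⟩ := discrete_bounds (d := d) ha hab hbd
  obtain ⟨C₂, hC₂, h₂⟩ := lintegral_newtonCap_le (d := d) ha hab hbd
  obtain ⟨C₃, hC₃, h₃⟩ := newtonCap_le_lintegral (d := d) ha hab hbd
  refine ⟨min c₁ C₂⁻¹, max C₁ C₃, lt_min hc₁ (inv_pos.2 hC₂), lt_max_of_lt_left hC₁,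
    fun A hA hne m hm => ⟨?_, ?_⟩, fun Λ hΛ hne hcube => ⟨?_, ?_⟩⟩
  · refine le_trans (ENNReal.ofReal_le_ofReal ?_) (h₁ A hA hne m hm).1
    gcongr
    exact min_le_left _ _
  · refine (h₁ A hA hne m hm).2.trans (ENNReal.ofReal_le_ofReal ?_)
    gcongr
    exact le_max_left _ _
  · calc _ ≤ ENNReal.ofReal C₂⁻¹ * (ENNReal.ofReal C₂ * newtonCap a Λ) :=
          mul_le_mul' (ENNReal.ofReal_le_ofReal (min_le_right _ _)) (h₂ Λ hΛ hne hcube)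
      _ = newtonCap a Λ := by
          rw [← mul_assoc, ← ENNReal.ofReal_mul (by positivity), inv_mul_cancel₀ hC₂.ne',
            ENNReal.ofReal_one, one_mul]
  · exact (h₃ Λ hΛ hne hcube).trans
      (mul_le_mul' (ENNReal.ofReal_le_ofReal (le_max_right _ _)) le_rfl)
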